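/- Let $\Bbbk$ be a field and let $A=\bigoplus_{i\geq 0}A_i$ be a connected $\mathbb{N}$-graded $\Bbbk$-algebra (that is, $A_0=\Bbbk$). Put $A^e=A\otimes A^{op}$ with its total grading, so that left $A^e$-modules, right $A^e$-modules and $A$-bimodules are the same thing. For graded modules $M$, $N$ let $\underline{\mathrm{Hom}}(M,N)=\bigoplus_{j\in\mathbb{Z}}\mathrm{Hom}(M,N)_j$ be the sum of the spaces of homogeneous linear maps of degree $j$, let $\underline{\mathrm{Ext}}^i$ be its derived functors on the category of graded modules (computed with graded projective resolutions of $M$), and put $M(\ell)_i=M_{i+\ell}$. The index $A^e-$ (resp. $-A^e$) refers to left (resp. right) modules. A graded projective resolution is minimal if each of its terms is a projective cover of the corresponding syzygy, i.e. all the kernels are superfluous. For $n\geq 1$ and $\ell\in\mathbb{Z}$, $A$ is called left graded Calabi-Yau of dimension $n$ and parameter $\ell$ if $\underline{\mathrm{Ext}}^i_{A^e-}(A,A^e)$ is isomorphic, as a graded right $A^e$-module, to $A(\ell)$ for $i=n$ and to $0$ for $i\neq n$; right graded Calabi-Yau is defined in the same way with left and right exchanged. $A$ is called left Calabi-Yau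 of dimension $n$ if $\mathrm{Ext}^i_{A^e-}(A,A^e)$ is isomorphic, as a right $A^e$-module, to $A$ for $i=n$ and to $0$ for $i\ne n$; similarly for right Calabi-Yau. $A$ is called AS-Gorenstein of dimension $n$ and parameter $\ell$ if $A$ has injective dimension $n$ as a left and as a right module over itself, $\underline{\mathrm{Ext}}^i_{A-}(\Bbbk,A)$ is isomorphic, as a graded right $A$-module, to $\Bbbk(\ell)$ for $i=n$ and to $0$ for $i\neq n$, and the same holds with left and right exchanged. Suppose that $A$ is left graded Calabi-Yau of dimension $n$ and parameter $\ell$, and that $A$ has finite (left) global dimension $D$. Then: (i) $n=D$. (ii) The bimodule $A$ has a resolution by graded free $A^e$-modules of finite type; it can be chosen to vanish in degrees $>n$. (iii) For every minimal projective resolution $\mathcal{P}=(P_i)_{i\ge 0}$ of $A$ in the category of graded left $A^e$-modules, one has $P_i=0$ for $i>n$, and the complex $\underline{\mathrm{Hom}}_{A^e-}(\mathcal{P},A^e)$, with $\underline{\mathrm{Hom}}_{A^e-}(P_{i},A^e)$ placed in homological degree $n-i$, is a minimal projective resolution of $A(\ell)$ in the category of graded right $A^e$-modules. (iv) $A$ is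 AS-Gorenstein of dimension $n$ and parameter $\ell$, and $\ell\geq 0$. (v) $A$ is right graded Calabi-Yau of dimension $n$ and parameter $\ell$. (vi) $A$ is left and right Calabi-Yau of dimension $n$. -/

import Mathlib

open scoped TensorProduct

universe u v

namespace GradedCY

/-! ### Graded rings and graded modules -/

section Internal

/-- A family of subgroups that spans and is separated by additive projections is an internal
direct sum decomposition. -/
theorem isInternal_of_proj {M : Type*} [AddCommGroup M] (deg : ℤ → AddSubgroup M)
    (p : ℤ → M →+ M) (h₁ : ∀ i, ∀ x ∈ deg i, p i x = x)
    (h₂ : ∀ i j, i ≠ j → ∀ x ∈ deg i, p j x = 0) (h₃ : ∀ x, x ∈ ⨆ i, deg i) :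
    DirectSum.IsInternal deg := by
  classical
  constructor
  · rw [injective_iff_map_eq_zero]
    intro f hf
    have key : ∀ (g : DirectSum ℤ fun i => deg i) (j : ℤ),
        p j (DirectSum.coeAddMonoidHom deg g) = (g j : M) := by
      intro g j
      induction g using DirectSum.induction_on with
      | zero => simp
      | of i x =>
        rw [DirectSum.coeAddMonoidHom_of]
        by_cases hij : i = j
        · subst hij
          rw [h₁ i x x.2, DirectSum.of_eq_same]
        · rw [h₂ i j hij x x.2, DirectSum.of_eq_of_ne _ _ _ (Ne.symm hij)]
          rfl
      | add a b ha hb => simp [ha, hb]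
    ext j
    rw [← key f j, hf]
    simp
  · intro x
    have hx := h₃ x
    rw [AddSubgroup.iSup_eq_closure] at hx
    refine AddSubgroup.closure_induction (p := fun x _ => ∃ a, DirectSum.coeAddMonoidHom deg a = x) ?_ ?_ ?_ ?_ hx
    · intro y hy
      obtain ⟨i, hi⟩ := Set.mem_iUnion.1 hy
      exact ⟨DirectSum.of (fun i => deg i) i ⟨y, hi⟩, DirectSum.coeAddMonoidHom_of _ _ _⟩
    · exact ⟨0, map_zero _⟩
    · rintro _ _ _ _ ⟨a, rfl⟩ ⟨b, rfl⟩
      exact ⟨a + b, map_add _ _ _⟩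
    · rintro _ _ ⟨a, rfl⟩
      exact ⟨-a, map_neg _ _⟩

theorem mem_iSup_of_isInternal {M : Type*} [AddCommGroup M] {deg : ℤ → AddSubgroup M}
    (h : DirectSum.IsInternal deg) (x : M) : x ∈ ⨆ i, deg i := by
  classical
  obtain ⟨f, rfl⟩ := h.2 x
  induction f using DirectSum.induction_on with
  | zero => simp
  | of i x =>
    rw [DirectSum.coeAddMonoidHom_of]
    exact AddSubgroup.mem_iSup_of_mem i x.2
  | add a b ha hb =>
    rw [map_add]
    exact add_mem ha hb

end Internal

section Gradings

variable {k : Type v} [Field k] {A : Type u} [Ring A] [Algebra k A]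

/-- An `ℕ`-grading seen as a `ℤ`-grading that vanishes in negative degrees. -/
def intGrading (𝒜 : ℕ → Submodule k A) (i : ℤ) : AddSubgroup A :=
  if 0 ≤ i then (𝒜 i.toNat).toAddSubgroup else ⊥

theorem mem_intGrading {𝒜 : ℕ → Submodule k A} {i : ℤ} {x : A} :
    x ∈ intGrading 𝒜 i ↔ (0 ≤ i ∧ x ∈ 𝒜 i.toNat) ∨ x = 0 := by
  unfold intGrading
  split_ifs with h
  · constructor
    · exact fun hx => Or.inl ⟨h, hx⟩
    · rintro (hx | rfl)
      · exact hx.2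
      · exact zero_mem _
  · simp [h]

theorem intGrading_natCast (𝒜 : ℕ → Submodule k A) (n : ℕ) :
    intGrading 𝒜 n = (𝒜 n).toAddSubgroup := by
  simp [intGrading]

theorem intGrading_isInternal (𝒜 : ℕ → Submodule k A) [GradedAlgebra 𝒜] :
    DirectSum.IsInternal (intGrading 𝒜) := by
  classical
  refine isInternal_of_proj _
    (fun i => if 0 ≤ i then (GradedRing.proj 𝒜 i.toNat) else 0) ?_ ?_ ?_
  · intro i x hx
    obtain ⟨hi, hx⟩ | rfl := mem_intGrading.1 hx
    · simp [hi, GradedRing.proj_apply, DirectSum.decompose_of_mem_same 𝒜 hx]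
    · exact map_zero _
  · intro i j hij x hx
    obtain ⟨hi, hx⟩ | rfl := mem_intGrading.1 hx
    · by_cases hj : 0 ≤ j
      · have : i.toNat ≠ j.toNat := by omega
        simp [hj, GradedRing.proj_apply, DirectSum.decompose_of_mem_ne 𝒜 hx this]
      · simp [hj]
    · exact map_zero _
  · intro x
    rw [← DirectSum.sum_support_decompose 𝒜 x]
    refine sum_mem fun n _ => AddSubgroup.mem_iSup_of_mem (n : ℤ) ?_
    rw [intGrading_natCast]
    exact (DirectSum.decompose 𝒜 x n).2

noncomputable instance (𝒜 : ℕ → Submodule k A) [GradedAlgebra 𝒜] :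
    GradedRing (intGrading 𝒜) where
  one_mem := mem_intGrading.2 (Or.inl ⟨le_rfl, SetLike.GradedOne.one_mem (A := 𝒜)⟩)
  mul_mem := by
    intro i j a b ha hb
    obtain ⟨hi, ha⟩ | rfl := mem_intGrading.1 ha
    · obtain ⟨hj, hb⟩ | rfl := mem_intGrading.1 hb
      · refine mem_intGrading.2 (Or.inl ⟨add_nonneg hi hj, ?_⟩)
        rw [Int.toNat_add hi hj]
        exact SetLike.GradedMul.mul_mem ha hb
      · simp
    · simp
  toDecomposition := (intGrading_isInternal 𝒜).chooseDecomposition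

/-- The total grading of the enveloping algebra `A ⊗ Aᵒᵖ`: the degree `m` part is
`⨁ (i + j = m), A_i ⊗ A_j`. -/
def envGrading (𝒜 : ℕ → Submodule k A) (m : ℕ) : Submodule k (A ⊗[k] Aᵐᵒᵖ) :=
  Submodule.span k {x | ∃ i j : ℕ, i + j = m ∧ ∃ a ∈ 𝒜 i, ∃ b ∈ 𝒜 j,
    x = a ⊗ₜ[k] MulOpposite.op b}

/-- The projection of `A ⊗ Aᵒᵖ` on its component of degree `m`. -/
noncomputable def envProj (𝒜 : ℕ → Submodule k A) [GradedAlgebra 𝒜] (m : ℕ) :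
    A ⊗[k] Aᵐᵒᵖ →ₗ[k] A ⊗[k] Aᵐᵒᵖ :=
  ∑ p ∈ Finset.HasAntidiagonal.antidiagonal m, TensorProduct.map (GradedAlgebra.proj 𝒜 p.1)
    ((MulOpposite.opLinearEquiv k).toLinearMap ∘ₗ GradedAlgebra.proj 𝒜 p.2 ∘ₗ
      (MulOpposite.opLinearEquiv k).symm.toLinearMap)

theorem envProj_tmul (𝒜 : ℕ → Submodule k A) [GradedAlgebra 𝒜] {i j : ℕ} {a b : A}
    (ha : a ∈ 𝒜 i) (hb : b ∈ 𝒜 j) (m : ℕ) :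
    envProj 𝒜 m (a ⊗ₜ[k] MulOpposite.op b) =
      if i + j = m then a ⊗ₜ[k] MulOpposite.op b else 0 := by
  classical
  have hpa : ∀ n, GradedAlgebra.proj 𝒜 n a = if i = n then a else 0 := by
    intro n
    rw [GradedAlgebra.proj_apply, DirectSum.decompose_of_mem 𝒜 ha, DirectSum.coe_of_apply]
    split_ifs <;> rfl
  have hpb : ∀ n, GradedAlgebra.proj 𝒜 n b = if j = n then b else 0 := by
    intro n
    rw [GradedAlgebra.proj_apply, DirectSum.decompose_of_mem 𝒜 hb, DirectSum.coe_of_apply]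
    split_ifs <;> rfl
  simp only [envProj, LinearMap.sum_apply, TensorProduct.map_tmul, LinearMap.comp_apply,
    LinearEquiv.coe_coe, MulOpposite.coe_opLinearEquiv_symm, MulOpposite.coe_opLinearEquiv,
    MulOpposite.unop_op, hpa, hpb]
  split_ifs with h
  · rw [Finset.sum_eq_single (i, j)]
    · simp
    · rintro ⟨p, q⟩ _ hne
      by_cases h1 : i = p
      · have h2 : j ≠ q := fun h2 => hne (by rw [h1, h2])
        simp [h2]
      · simp [h1]
    · intro hn
      exact absurd (Finset.HasAntidiagonal.mem_antidiagonal.2 h) hn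
  · refine Finset.sum_eq_zero ?_
    rintro ⟨p, q⟩ hpq
    rw [Finset.HasAntidiagonal.mem_antidiagonal] at hpq
    by_cases h1 : i = p
    · have h2 : j ≠ q := fun h2 => h (by rw [h1, h2]; exact hpq)
      simp [h2]
    · simp [h1]

theorem envProj_of_mem (𝒜 : ℕ → Submodule k A) [GradedAlgebra 𝒜] {m : ℕ}
    {x : A ⊗[k] Aᵐᵒᵖ} (hx : x ∈ envGrading 𝒜 m) (n : ℕ) :
    envProj 𝒜 n x = if m = n then x else 0 := by
  induction hx using Submodule.span_induction with
  | mem x h =>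
    obtain ⟨i, j, rfl, a, ha, b, hb, rfl⟩ := h
    exact envProj_tmul 𝒜 ha hb n
  | zero => simp
  | add x y _ _ hx hy => rw [map_add, hx, hy]; split_ifs <;> simp
  | smul c x _ hx => rw [map_smul, hx]; split_ifs <;> simp

theorem mem_iSup_envGrading (𝒜 : ℕ → Submodule k A) [GradedAlgebra 𝒜]
    (x : A ⊗[k] Aᵐᵒᵖ) : x ∈ ⨆ m, envGrading 𝒜 m := by
  classical
  induction x using TensorProduct.induction_on with
  | zero => exact zero_mem _
  | add x y hx hy => exact add_mem hx hy
  | tmul a b =>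
    induction b using MulOpposite.rec' with | _ b => ?_
    change a ⊗ₜ[k] MulOpposite.opAddEquiv b ∈ _
    rw [← DirectSum.sum_support_decompose 𝒜 a, ← DirectSum.sum_support_decompose 𝒜 b,
      map_sum, TensorProduct.sum_tmul]
    refine sum_mem fun i _ => ?_
    rw [TensorProduct.tmul_sum]
    refine sum_mem fun j _ => ?_
    exact Submodule.mem_iSup_of_mem (i + j) (Submodule.subset_span
      ⟨i, j, rfl, _, (DirectSum.decompose 𝒜 a i).2, _, (DirectSum.decompose 𝒜 b j).2, rfl⟩)

theorem envGrading_isInternal (𝒜 : ℕ → Submodule k A) [GradedAlgebra 𝒜] :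
    DirectSum.IsInternal (envGrading 𝒜) := by
  classical
  refine DirectSum.isInternal_submodule_of_iSupIndep_of_iSup_eq_top ?_ ?_
  · intro i
    rw [Submodule.disjoint_def]
    intro x hx hx'
    have h0 : (⨆ j, ⨆ (_ : j ≠ i), envGrading 𝒜 j) ≤ LinearMap.ker (envProj 𝒜 i) := by
      refine iSup₂_le fun j hj y hy => ?_
      rw [LinearMap.mem_ker, envProj_of_mem 𝒜 hy, if_neg hj]
    have h1 := h0 hx'
    rwa [LinearMap.mem_ker, envProj_of_mem 𝒜 hx, if_pos rfl] at h1
  · exact eq_top_iff.2 fun x _ => mem_iSup_envGrading 𝒜 x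

noncomputable instance (𝒜 : ℕ → Submodule k A) [GradedAlgebra 𝒜] :
    GradedAlgebra (envGrading 𝒜) where
  one_mem := Submodule.subset_span
    ⟨0, 0, rfl, 1, SetLike.GradedOne.one_mem, 1, SetLike.GradedOne.one_mem, rfl⟩
  mul_mem := by
    intro i j x y hx hy
    induction hx using Submodule.span_induction with
    | zero => rw [zero_mul]; exact zero_mem _
    | add x x' _ _ h h' => rw [add_mul]; exact add_mem h h'
    | smul c x _ h => rw [smul_mul_assoc]; exact Submodule.smul_mem _ _ h
    | mem x h =>
      obtain ⟨p, q, rfl, a, ha, b, hb, rfl⟩ := h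
      induction hy using Submodule.span_induction with
      | zero => rw [mul_zero]; exact zero_mem _
      | add y y' _ _ h h' => rw [mul_add]; exact add_mem h h'
      | smul c y _ h => rw [mul_smul_comm]; exact Submodule.smul_mem _ _ h
      | mem y h =>
        obtain ⟨r, s, rfl, a', ha', b', hb', rfl⟩ := h
        refine Submodule.subset_span ⟨p + r, s + q, by omega, a * a',
          SetLike.GradedMul.mul_mem ha ha', b' * b, SetLike.GradedMul.mul_mem hb' hb, ?_⟩
        simp
  toDecomposition := (envGrading_isInternal 𝒜).chooseDecomposition

/-- The grading of the opposite ring. -/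
def opGrading {R : Type u} [Ring R] (𝓡 : ℤ → AddSubgroup R) (i : ℤ) : AddSubgroup Rᵐᵒᵖ :=
  (𝓡 i).comap (MulOpposite.opAddEquiv (α := R)).symm.toAddMonoidHom

theorem mem_opGrading {R : Type u} [Ring R] {𝓡 : ℤ → AddSubgroup R} {i : ℤ} {x : Rᵐᵒᵖ} :
    x ∈ opGrading 𝓡 i ↔ x.unop ∈ 𝓡 i := Iff.rfl

theorem opGrading_isInternal {R : Type u} [Ring R] (𝓡 : ℤ → AddSubgroup R) [GradedRing 𝓡] :
    DirectSum.IsInternal (opGrading 𝓡) := by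
  classical
  refine isInternal_of_proj _ (fun i => (MulOpposite.opAddEquiv (α := R)).toAddMonoidHom.comp
    ((GradedRing.proj 𝓡 i).comp (MulOpposite.opAddEquiv (α := R)).symm.toAddMonoidHom)) ?_ ?_ ?_
  · intro i x hx
    simp [GradedRing.proj_apply, DirectSum.decompose_of_mem_same 𝓡 (mem_opGrading.1 hx)]
  · intro i j hij x hx
    simp [GradedRing.proj_apply, DirectSum.decompose_of_mem_ne 𝓡 (mem_opGrading.1 hx) hij]
  · intro x
    change MulOpposite.opAddEquiv x.unop ∈ _
    rw [← DirectSum.sum_support_decompose 𝓡 x.unop, map_sum]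
    exact sum_mem fun i _ => AddSubgroup.mem_iSup_of_mem i
      (mem_opGrading.2 (DirectSum.decompose 𝓡 x.unop i).2)

noncomputable instance {R : Type u} [Ring R] (𝓡 : ℤ → AddSubgroup R) [GradedRing 𝓡] :
    GradedRing (opGrading 𝓡) where
  one_mem := mem_opGrading.2 SetLike.GradedOne.one_mem
  mul_mem := by
    intro i j a b ha hb
    rw [mem_opGrading, MulOpposite.unop_mul, add_comm]
    exact SetLike.GradedMul.mul_mem (mem_opGrading.1 hb) (mem_opGrading.1 ha)
  toDecomposition := (opGrading_isInternal 𝓡).chooseDecomposition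

end Gradings

section GradedModules

variable {R : Type u} [Ring R] (𝓡 : ℤ → AddSubgroup R) [GradedRing 𝓡]
variable {S : Type u} [Ring S] (𝓢 : ℤ → AddSubgroup S) [GradedRing 𝓢]

/-- `ℤ`-graded left modules over a `ℤ`-graded ring `R`. Graded right `R`-modules are graded left
modules over `Rᵐᵒᵖ`. -/
structure GrMod where
  carrier : Type u
  [addCommGroup : AddCommGroup carrier]
  [module : Module R carrier]
  deg : ℤ → AddSubgroup carrier
  isInternal : DirectSum.IsInternal deg
  smul_mem : ∀ {i j : ℤ} {r : R} {x : carrier}, r ∈ 𝓡 i → x ∈ deg j → r • x ∈ deg (i + j)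

attribute [instance] GrMod.addCommGroup GrMod.module

/-- Graded left `R`-modules with a second, commuting graded left action of `S`. For `S = Rᵐᵒᵖ`
these are the graded `R`-`R`-bimodules. -/
structure GrBimod where
  carrier : Type u
  [addCommGroup : AddCommGroup carrier]
  [module : Module R carrier]
  [module' : Module S carrier]
  [smulComm : SMulCommClass R S carrier]
  deg : ℤ → AddSubgroup carrier
  isInternal : DirectSum.IsInternal deg
  smul_mem : ∀ {i j : ℤ} {r : R} {x : carrier}, r ∈ 𝓡 i → x ∈ deg j → r • x ∈ deg (i + j)
  smul_mem' : ∀ {i j : ℤ} {s : S} {x : carrier}, s ∈ 𝓢 i → x ∈ deg j → s • x ∈ deg (i + j)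

attribute [instance] GrBimod.addCommGroup GrBimod.module GrBimod.module' GrBimod.smulComm

/-- The graded ring `R` as a left module over itself, with right multiplication as second
action. -/
def regular : GrBimod 𝓡 (opGrading 𝓡) where
  carrier := R
  deg := 𝓡
  isInternal := DirectSum.Decomposition.isInternal 𝓡
  smul_mem hr hx := SetLike.GradedMul.mul_mem hr hx
  smul_mem' {i j s x} hs hx := by
    rw [add_comm]
    exact SetLike.GradedMul.mul_mem hx (mem_opGrading.1 hs)

/-- The graded ring `R` as a right module over itself, with left multiplication as second
action. -/
def regularOp : GrBimod (opGrading 𝓡) 𝓡 where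
  carrier := R
  deg := 𝓡
  isInternal := DirectSum.Decomposition.isInternal 𝓡
  smul_mem {i j s x} hs hx := by
    rw [add_comm]
    exact SetLike.GradedMul.mul_mem hx (mem_opGrading.1 hs)
  smul_mem' hr hx := SetLike.GradedMul.mul_mem hr hx

variable {𝓡 𝓢}

namespace GrMod

/-- The shifted module `M(ℓ)`, with `M(ℓ)_i = M_{i + ℓ}`. -/
def shift (M : GrMod 𝓡) (ℓ : ℤ) : GrMod 𝓡 where
  carrier := M.carrier
  deg i := M.deg (i + ℓ)
  isInternal := by
    classical
    have hind := M.isInternal.addSubgroup_iSupIndep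
    have hb := M.isInternal
    have hdec := hb.chooseDecomposition
    refine isInternal_of_proj _ (fun i => (M.deg (i + ℓ)).subtype.comp
      ((DFinsupp.evalAddMonoidHom (i + ℓ)).comp
        (DirectSum.decomposeAddEquiv M.deg).toAddMonoidHom)) ?_ ?_ ?_
    · intro i x hx
      exact DirectSum.decompose_of_mem_same M.deg hx
    · intro i j hij x hx
      exact DirectSum.decompose_of_mem_ne M.deg hx (by omega)
    · intro x
      have hx := mem_iSup_of_isInternal M.isInternal x
      refine (iSup_le fun i => ?_ : (⨆ i, M.deg i) ≤ _) hx
      have := le_iSup (fun i => M.deg (i + ℓ)) (i - ℓ)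
      simpa using this
  smul_mem {i j r x} hr hx := by
    rw [add_assoc]
    exact M.smul_mem hr hx

/-- Morphisms of graded modules: linear maps that preserve the degree. -/
structure Hom (M N : GrMod 𝓡) where
  toLin : M.carrier →ₗ[R] N.carrier
  map_mem : ∀ {i : ℤ} {x : M.carrier}, x ∈ M.deg i → toLin x ∈ N.deg i

/-- Isomorphisms of graded modules: linear bijections that preserve the degree. -/
structure Iso (M N : GrMod 𝓡) where
  toEquiv : M.carrier ≃ₗ[R] N.carrier
  mem_iff : ∀ (i : ℤ) (x : M.carrier), toEquiv x ∈ N.deg i ↔ x ∈ M.deg i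

/-- Projective objects of the category of graded modules. -/
def IsProjective (P : GrMod 𝓡) : Prop :=
  ∀ (M N : GrMod 𝓡) (g : Hom M N) (f : Hom P N), Function.Surjective g.toLin →
    ∃ h : Hom P M, g.toLin ∘ₗ h.toLin = f.toLin

/-- Graded free modules of finite type: there is a finite basis of homogeneous elements, so that
the module is a finite direct sum of shifts of `R`. -/
def IsFiniteFree (P : GrMod 𝓡) : Prop :=
  ∃ (m : ℕ) (e : Fin m → ℤ) (b : Module.Basis (Fin m) R P.carrier), ∀ i, b i ∈ P.deg (e i)

/-- Graded submodules: those generated by homogeneous elements. -/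
def IsGradedSubmodule (M : GrMod 𝓡) (N : Submodule R M.carrier) : Prop :=
  Submodule.span R {x | x ∈ N ∧ ∃ i, x ∈ M.deg i} = N

/-- `K` is superfluous (small) in `M`, in the category of graded modules. -/
def IsSuperfluous (M : GrMod 𝓡) (K : Submodule R M.carrier) : Prop :=
  ∀ N : Submodule R M.carrier, M.IsGradedSubmodule N → N ⊔ K = ⊤ → N = ⊤

end GrMod

/-! ### The graded `Hom` -/

section GradedHom

/-- The group of the `R`-linear maps `M → N` that are homogeneous of degree `j`. -/
def homDeg (M : GrMod 𝓡) (N : GrBimod 𝓡 𝓢) (j : ℤ) :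
    AddSubgroup (M.carrier →ₗ[R] N.carrier) where
  carrier := {f | ∀ (i : ℤ) (x : M.carrier), x ∈ M.deg i → f x ∈ N.deg (i + j)}
  zero_mem' _ _ _ := zero_mem _
  add_mem' hf hg i x hx := add_mem (hf i x hx) (hg i x hx)
  neg_mem' hf i x hx := neg_mem (hf i x hx)

theorem smul_mem_homDeg {M : GrMod 𝓡} {N : GrBimod 𝓡 𝓢} {i j : ℤ} {s : S}
    {f : M.carrier →ₗ[R] N.carrier} (hs : s ∈ 𝓢 i) (hf : f ∈ homDeg M N j) :
    s • f ∈ homDeg M N (i + j) := by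
  intro p x hx
  have := N.smul_mem' hs (hf p x hx)
  rw [show p + (i + j) = i + (p + j) by ring]
  exact this

/-- The sum, inside `Hom_R(M, N)`, of the groups of homogeneous maps of degree `j`, `j ∈ ℤ`. -/
def gradedHomSubmodule (M : GrMod 𝓡) (N : GrBimod 𝓡 𝓢) :
    Submodule S (M.carrier →ₗ[R] N.carrier) where
  toAddSubmonoid := (⨆ j, homDeg M N j).toAddSubmonoid
  smul_mem' := by
    intro s f hf
    change s • f ∈ ⨆ j, homDeg M N j
    replace hf : f ∈ ⨆ j, homDeg M N j := hf
    have hs := mem_iSup_of_isInternal (DirectSum.Decomposition.isInternal 𝓢) s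
    refine AddSubgroup.iSup_induction _ (C := fun s => s • f ∈ ⨆ j, homDeg M N j) hs ?_ ?_ ?_
    · intro i s hs
      refine AddSubgroup.iSup_induction _ (C := fun f => s • f ∈ ⨆ j, homDeg M N j)
        hf ?_ ?_ ?_
      · intro j f hf
        exact AddSubgroup.mem_iSup_of_mem (i + j) (smul_mem_homDeg hs hf)
      · rw [smul_zero]
        exact zero_mem _
      · intro f g hf hg
        rw [smul_add]
        exact add_mem hf hg
    · rw [zero_smul]
      exact zero_mem _
    · intro s t hs ht
      rw [add_smul]
      exact add_mem hs ht

theorem mem_gradedHomSubmodule {M : GrMod 𝓡} {N : GrBimod 𝓡 𝓢}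
    {f : M.carrier →ₗ[R] N.carrier} :
    f ∈ gradedHomSubmodule M N ↔ f ∈ ⨆ j, homDeg M N j := Iff.rfl

theorem iSupIndep_homDeg (M : GrMod 𝓡) (N : GrBimod 𝓡 𝓢) : iSupIndep (homDeg M N) := by
  classical
  intro j
  rw [AddSubgroup.disjoint_def]
  intro f hf hf'
  have hN := N.isInternal.addSubgroup_iSupIndep
  ext x
  rw [LinearMap.zero_apply]
  refine AddSubgroup.iSup_induction _ (C := fun x => f x = 0)
    (mem_iSup_of_isInternal M.isInternal x) ?_ (map_zero f) ?_
  · intro i x hx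
    have h1 : f x ∈ N.deg (i + j) := hf i x hx
    have h2 : f x ∈ ⨆ l, ⨆ (_ : l ≠ i + j), N.deg l := by
      let ev : (M.carrier →ₗ[R] N.carrier) →+ N.carrier :=
        { toFun := fun g => g x, map_zero' := rfl, map_add' := fun _ _ => rfl }
      have hle : (⨆ l, ⨆ (_ : l ≠ j), homDeg M N l) ≤
          (⨆ l, ⨆ (_ : l ≠ i + j), N.deg l).comap ev := by
        refine iSup₂_le fun l hl g hg => ?_
        have hne : i + l ≠ i + j := by omega
        exact (le_iSup₂ (f := fun l (_ : l ≠ i + j) => N.deg l) (i + l) hne) (hg i x hx)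
      exact hle hf'
    exact (AddSubgroup.disjoint_def.1 (hN (i + j))) h1 h2
  · intro x y hx hy
    rw [map_add, hx, hy, add_zero]

/-- The graded Hom `⨁_j Hom_R(M, N)_j`, a graded `S`-module through the second action
on `N`. -/
def gradedHom (M : GrMod 𝓡) (N : GrBimod 𝓡 𝓢) : GrMod 𝓢 where
  carrier := gradedHomSubmodule M N
  deg j := (homDeg M N j).comap (gradedHomSubmodule M N).subtype.toAddMonoidHom
  isInternal := by
    classical
    constructor
    · rw [injective_iff_map_eq_zero]
      intro f hf
      have hinj := (iSupIndep_homDeg M N).dfinsuppSumAddHom_injective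
      let φ : (DirectSum ℤ fun j => (homDeg M N j).comap
          (gradedHomSubmodule M N).subtype.toAddMonoidHom) →+
          DirectSum ℤ fun j => homDeg M N j :=
        DirectSum.map fun j =>
          { toFun := fun x => ⟨x.1.1, x.2⟩, map_zero' := rfl, map_add' := fun _ _ => rfl }
      have hφ : ∀ g, DirectSum.coeAddMonoidHom (homDeg M N) (φ g) =
          ((DirectSum.coeAddMonoidHom _ g : gradedHomSubmodule M N) :
            M.carrier →ₗ[R] N.carrier) := by
        intro g
        induction g using DirectSum.induction_on with
        | zero => simp
        | of i x => simp [φ, DirectSum.map_of, DirectSum.coeAddMonoidHom_of]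
        | add a b ha hb => simp only [map_add, ha, hb, Submodule.coe_add]
      have h0 : φ f = 0 := by
        apply hinj
        rw [map_zero]
        have := hφ f
        rw [hf] at this
        exact this
      ext j
      have hj : (φ f j : M.carrier →ₗ[R] N.carrier) = 0 := by rw [h0]; rfl
      have hj' : ((f j).1.1 : M.carrier →ₗ[R] N.carrier) = 0 := by
        rw [← hj]
        simp only [φ, DirectSum.map_apply]
        rfl
      exact LinearMap.congr_fun hj' _
    · rintro ⟨f, hf⟩
      rw [mem_gradedHomSubmodule] at hf
      refine AddSubgroup.iSup_induction' _
        (C := fun f hf => ∃ a, DirectSum.coeAddMonoidHom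
          (fun j => (homDeg M N j).comap (gradedHomSubmodule M N).subtype.toAddMonoidHom) a =
          (⟨f, hf⟩ : gradedHomSubmodule M N)) ?_ ?_ ?_ hf
      · intro i f hf
        exact ⟨DirectSum.of (fun j => (homDeg M N j).comap
          (gradedHomSubmodule M N).subtype.toAddMonoidHom) i
          ⟨⟨f, AddSubgroup.mem_iSup_of_mem i hf⟩, hf⟩, DirectSum.coeAddMonoidHom_of _ _ _⟩
      · exact ⟨0, map_zero _⟩
      · rintro f g hf hg ⟨a, ha⟩ ⟨b, hb⟩
        exact ⟨a + b, by rw [map_add, ha, hb]; rfl⟩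
  smul_mem hs hf := smul_mem_homDeg hs hf

theorem comp_mem_homDeg {M M' : GrMod 𝓡} {N : GrBimod 𝓡 𝓢} (d : GrMod.Hom M M') {j : ℤ}
    {f : M'.carrier →ₗ[R] N.carrier} (hf : f ∈ homDeg M' N j) :
    f ∘ₗ d.toLin ∈ homDeg M N j :=
  fun i _ hx => hf i _ (d.map_mem hx)

theorem comp_mem_gradedHomSubmodule {M M' : GrMod 𝓡} {N : GrBimod 𝓡 𝓢} (d : GrMod.Hom M M')
    {f : M'.carrier →ₗ[R] N.carrier} (hf : f ∈ gradedHomSubmodule M' N) :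
    f ∘ₗ d.toLin ∈ gradedHomSubmodule M N := by
  rw [mem_gradedHomSubmodule] at hf ⊢
  refine AddSubgroup.iSup_induction _
    (C := fun f => f ∘ₗ d.toLin ∈ ⨆ j, homDeg M N j) hf ?_ ?_ ?_
  · intro j f hf
    exact AddSubgroup.mem_iSup_of_mem j (comp_mem_homDeg d hf)
  · rw [LinearMap.zero_comp]
    exact zero_mem _
  · intro f g hf hg
    rw [LinearMap.add_comp]
    exact add_mem hf hg

/-- The morphism `f ↦ f ∘ d` between graded Homs. -/
def gradedHomMap {M M' : GrMod 𝓡} (d : GrMod.Hom M M') (N : GrBimod 𝓡 𝓢) :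
    GrMod.Hom (gradedHom M' N) (gradedHom M N) where
  toLin :=
    { toFun := fun f => ⟨f.1 ∘ₗ d.toLin, comp_mem_gradedHomSubmodule d f.2⟩
      map_add' := fun _ _ => rfl
      map_smul' := fun _ _ => rfl }
  map_mem hf := comp_mem_homDeg d hf

end GradedHom

/-! ### Graded projective resolutions and graded `Ext` -/

/-- Projective resolutions `⋯ → X 1 → X 0 → M → 0` in the category of graded modules. -/
structure ProjRes (M : GrMod 𝓡) where
  X : ℕ → GrMod 𝓡
  d : ∀ n, GrMod.Hom (X (n + 1)) (X n)
  ε : GrMod.Hom (X 0) M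
  projective : ∀ n, (X n).IsProjective
  surjective : Function.Surjective ε.toLin
  exact_zero : Function.Exact (d 0).toLin ε.toLin
  exact_succ : ∀ n, Function.Exact (d (n + 1)).toLin (d n).toLin

namespace ProjRes

variable {M : GrMod 𝓡} (P : ProjRes M)

/-- A projective resolution is minimal if `X 0 → M` and all the `X (n + 1) → im d n` are
projective covers, that is, have superfluous kernels. -/
def IsMinimal : Prop :=
  (P.X 0).IsSuperfluous (LinearMap.ker P.ε.toLin) ∧
    ∀ n, (P.X (n + 1)).IsSuperfluous (LinearMap.ker (P.d n).toLin)

/-- The coboundaries in degree `n` of the complex of graded Homs from `P` to `N`. -/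
def coboundaries (N : GrBimod 𝓡 𝓢) : ∀ n : ℕ, Submodule S (gradedHom (P.X n) N).carrier
  | 0 => ⊥
  | n + 1 => LinearMap.range (gradedHomMap (P.d n) N).toLin

/-- The cocycles in degree `n` of the complex of graded Homs from `P` to `N`. -/
def cocycles (N : GrBimod 𝓡 𝓢) (n : ℕ) : Submodule S (gradedHom (P.X n) N).carrier :=
  LinearMap.ker (gradedHomMap (P.d n) N).toLin

/-- The graded Ext in cohomological degree `n`, computed with `P`. -/
abbrev Ext (N : GrBimod 𝓡 𝓢) (n : ℕ) : Type u :=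
  P.cocycles N n ⧸ (P.coboundaries N n).submoduleOf (P.cocycles N n)

/-- The component of degree `j` of the graded Ext: the classes of cocycles of degree `j`. -/
def extDeg (N : GrBimod 𝓡 𝓢) (n : ℕ) (j : ℤ) : AddSubgroup (P.Ext N n) :=
  (((gradedHom (P.X n) N).deg j).comap (P.cocycles N n).subtype.toAddMonoidHom).map
    ((P.coboundaries N n).submoduleOf (P.cocycles N n)).mkQ.toAddMonoidHom

end ProjRes

/-- The graded Ext modules of `M` with values in `N` are isomorphic, as graded `S`-modules, to `E`
in cohomological degree `n` and to `0` in the other degrees. As usual the Ext modules do not depend,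
up to isomorphism, on the projective resolution of `M` that is used to compute them. -/
def ExtConcentrated (M : GrMod 𝓡) (N : GrBimod 𝓡 𝓢) (n : ℕ) (E : GrMod 𝓢) : Prop :=
  ∃ P : ProjRes M,
    (∃ e : P.Ext N n ≃ₗ[S] E.carrier, ∀ (j : ℤ) (x : P.Ext N n),
      e x ∈ E.deg j ↔ x ∈ P.extDeg N n j) ∧
    ∀ i, i ≠ n → Subsingleton (P.Ext N i)

end GradedModules

/-! ### `A` as a left and as a right module over `A ⊗ Aᵒᵖ` -/

section Enveloping

variable (k : Type v) [Field k] (A : Type u) [Ring A] [Algebra k A]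

/-- `A` as a left module over `A ⊗ Aᵒᵖ`: `(a ⊗ b) • x = a * x * b`. -/
abbrev leftEnvModule : Module (A ⊗[k] Aᵐᵒᵖ) A := instModuleTensorProductMop k A

/-- The isomorphism `(A ⊗ Aᵒᵖ)ᵒᵖ ≃ A ⊗ Aᵒᵖ`, `a ⊗ b ↦ b ⊗ a`. -/
noncomputable def envFlip : (A ⊗[k] Aᵐᵒᵖ)ᵐᵒᵖ ≃ₐ[k] A ⊗[k] Aᵐᵒᵖ :=
  ((Algebra.TensorProduct.opAlgEquiv k k A Aᵐᵒᵖ).symm.trans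
    (Algebra.TensorProduct.congr AlgEquiv.refl (AlgEquiv.opOp k A).symm)).trans
    (Algebra.TensorProduct.comm k Aᵐᵒᵖ A)

/-- `A` as a right module over `A ⊗ Aᵒᵖ`: `x • (a ⊗ b) = b * x * a`. -/
noncomputable abbrev rightEnvModule : Module (A ⊗[k] Aᵐᵒᵖ)ᵐᵒᵖ A :=
  letI := leftEnvModule k A
  Module.compHom A (envFlip k A : (A ⊗[k] Aᵐᵒᵖ)ᵐᵒᵖ →+* A ⊗[k] Aᵐᵒᵖ)

attribute [local instance] leftEnvModule rightEnvModule

theorem leftEnv_smul (a b x : A) :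
    (a ⊗ₜ[k] MulOpposite.op b) • x = a * x * b := by
  change TensorProduct.Algebra.moduleAux _ _ = _
  simp [TensorProduct.Algebra.moduleAux, ← mul_assoc]

theorem rightEnv_smul (a b x : A) :
    MulOpposite.op (a ⊗ₜ[k] MulOpposite.op b) • x = b * x * a := by
  rw [← leftEnv_smul k]
  change (envFlip k A _) • x = _
  congr 1

/-! ### Calabi-Yau algebras -/

open CategoryTheory in
/-- The group `Ext_R^i(M, N)`, with the action of `S` induced by the second action of `S`
on `N`, is isomorphic to the `S`-module `E`. -/
def ExtIso (R S M N E : Type u) [Ring R] [Ring S] [AddCommGroup M] [Module R M]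
    [AddCommGroup N] [Module R N] [Module S N] [SMulCommClass S R N]
    [AddCommGroup E] [Module S E] (i : ℕ) : Prop :=
  ∃ φ : Abelian.Ext (ModuleCat.of R M) (ModuleCat.of R N) i ≃+ E,
    ∀ (s : S) (x : Abelian.Ext (ModuleCat.of R M) (ModuleCat.of R N) i),
      φ (x.comp (Abelian.Ext.mk₀ (ModuleCat.ofHom (DistribSMul.toLinearMap R N s)))
        (add_zero i)) = s • φ x

open CategoryTheory in
/-- `A` is left Calabi-Yau of dimension `n`: `Ext^i(A, Aᵉ)` in the category of left
`Aᵉ`-modules is isomorphic to `A` for `i = n` and to `0` otherwise, as a right `Aᵉ`-module. -/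
def IsLeftCalabiYau (n : ℕ) : Prop :=
  1 ≤ n ∧
  ExtIso (A ⊗[k] Aᵐᵒᵖ) (A ⊗[k] Aᵐᵒᵖ)ᵐᵒᵖ A (A ⊗[k] Aᵐᵒᵖ) A n ∧
  ∀ i, i ≠ n → Subsingleton
    (Abelian.Ext (ModuleCat.of (A ⊗[k] Aᵐᵒᵖ) A)
      (ModuleCat.of (A ⊗[k] Aᵐᵒᵖ) (A ⊗[k] Aᵐᵒᵖ)) i)

open CategoryTheory in
/-- `A` is right Calabi-Yau of dimension `n`: `Ext^i(A, Aᵉ)` in the category of right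
`Aᵉ`-modules is isomorphic to `A` for `i = n` and to `0` otherwise, as a left `Aᵉ`-module. -/
def IsRightCalabiYau (n : ℕ) : Prop :=
  1 ≤ n ∧
  ExtIso (A ⊗[k] Aᵐᵒᵖ)ᵐᵒᵖ (A ⊗[k] Aᵐᵒᵖ) A (A ⊗[k] Aᵐᵒᵖ) A n ∧
  ∀ i, i ≠ n → Subsingleton
    (Abelian.Ext (ModuleCat.of (A ⊗[k] Aᵐᵒᵖ)ᵐᵒᵖ A)
      (ModuleCat.of (A ⊗[k] Aᵐᵒᵖ)ᵐᵒᵖ (A ⊗[k] Aᵐᵒᵖ)) i)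

variable {k A}
variable (𝒜 : ℕ → Submodule k A) [GradedAlgebra 𝒜]

/-- `A` is connected: `A ≠ 0` and `A_0 = k`. -/
def IsConnected : Prop :=
  Nontrivial A ∧ 𝒜 0 = Subalgebra.toSubmodule (⊥ : Subalgebra k A)

/-- The `ℤ`-grading of `A ⊗ Aᵒᵖ`. -/
abbrev envInt : ℤ → AddSubgroup (A ⊗[k] Aᵐᵒᵖ) := intGrading (envGrading 𝒜)

theorem env_smul_mem {m : ℕ} {j : ℤ} {r : A ⊗[k] Aᵐᵒᵖ} {x : A} (hr : r ∈ envGrading 𝒜 m)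
    (hx : x ∈ intGrading 𝒜 j) : r • x ∈ intGrading 𝒜 (m + j) := by
  induction hr using Submodule.span_induction with
  | zero =>
    rw [zero_smul (A ⊗[k] Aᵐᵒᵖ) x]
    exact zero_mem _
  | add r r' _ _ h h' => rw [add_smul]; exact add_mem h h'
  | smul c r _ h =>
    have : (c • r) • x = c • (r • x) := by
      change TensorProduct.Algebra.moduleAux _ _ = c • TensorProduct.Algebra.moduleAux _ _
      simp
    rw [this]
    obtain ⟨h0, h⟩ | h := mem_intGrading.1 h
    · exact mem_intGrading.2 (Or.inl ⟨h0, Submodule.smul_mem _ _ h⟩)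
    · rw [h, smul_zero]; exact zero_mem _
  | mem r h =>
    obtain ⟨p, q, rfl, a, ha, b, hb, rfl⟩ := h
    rw [leftEnv_smul]
    have ha' : a ∈ intGrading 𝒜 p := by rw [intGrading_natCast]; exact ha
    have hb' : b ∈ intGrading 𝒜 q := by rw [intGrading_natCast]; exact hb
    have := SetLike.GradedMul.mul_mem (SetLike.GradedMul.mul_mem ha' hx) hb'
    rwa [show (p : ℤ) + j + q = ((p + q : ℕ) : ℤ) + j by push_cast; ring] at this

theorem envFlip_mem {m : ℕ} {r : A ⊗[k] Aᵐᵒᵖ} (hr : r ∈ envGrading 𝒜 m) :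
    envFlip k A (MulOpposite.op r) ∈ envGrading 𝒜 m := by
  induction hr using Submodule.span_induction with
  | zero => rw [MulOpposite.op_zero, map_zero]; exact zero_mem _
  | add r r' _ _ h h' => rw [MulOpposite.op_add, map_add]; exact add_mem h h'
  | smul c r _ h => rw [MulOpposite.op_smul, map_smul]; exact Submodule.smul_mem _ _ h
  | mem r h =>
    obtain ⟨p, q, rfl, a, ha, b, hb, rfl⟩ := h
    exact Submodule.subset_span ⟨q, p, add_comm _ _, b, hb, a, ha, rfl⟩

/-- `A` as a graded left `Aᵉ`-module. -/
noncomputable def leftBimodule : GrMod (envInt 𝒜) where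
  carrier := A
  module := leftEnvModule k A
  deg := intGrading 𝒜
  isInternal := intGrading_isInternal 𝒜
  smul_mem {i j r x} hr hx := by
    obtain ⟨hi, hr⟩ | rfl := mem_intGrading.1 hr
    · have := env_smul_mem 𝒜 hr hx
      rwa [Int.toNat_of_nonneg hi] at this
    · rw [zero_smul (A ⊗[k] Aᵐᵒᵖ) x]
      exact zero_mem _

/-- `A` as a graded right `Aᵉ`-module. -/
noncomputable def rightBimodule : GrMod (opGrading (envInt 𝒜)) where
  carrier := A
  module := rightEnvModule k A
  deg := intGrading 𝒜
  isInternal := intGrading_isInternal 𝒜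
  smul_mem {i j r x} hr hx := by
    obtain ⟨hi, hr⟩ | h := mem_intGrading.1 (mem_opGrading.1 hr)
    · have := env_smul_mem 𝒜 (envFlip_mem 𝒜 hr) hx
      rwa [Int.toNat_of_nonneg hi] at this
    · rw [(MulOpposite.unop_eq_zero_iff r).1 h, zero_smul (A ⊗[k] Aᵐᵒᵖ)ᵐᵒᵖ x]
      exact zero_mem _

/-- `A` is left graded Calabi-Yau of dimension `n` and parameter `ℓ`: the graded Ext module
`Ext^i(A, Aᵉ)` over left graded `Aᵉ`-modules is isomorphic to `A(ℓ)` for `i = n` and to `0`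
otherwise, as a graded right `Aᵉ`-module. -/
def IsLeftGradedCalabiYau (n : ℕ) (ℓ : ℤ) : Prop :=
  1 ≤ n ∧ ExtConcentrated (leftBimodule 𝒜) (regular (envInt 𝒜)) n ((rightBimodule 𝒜).shift ℓ)

/-- The right-hand version of `IsLeftGradedCalabiYau`. -/
def IsRightGradedCalabiYau (n : ℕ) (ℓ : ℤ) : Prop :=
  1 ≤ n ∧ ExtConcentrated (rightBimodule 𝒜) (regularOp (envInt 𝒜)) n ((leftBimodule 𝒜).shift ℓ)

end Enveloping

/-! ### AS-Gorenstein algebras -/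

section Gorenstein

variable {k : Type v} [Field k] {A : Type u} [Ring A] [Algebra k A]
variable (𝒜 : ℕ → Submodule k A) [GradedAlgebra 𝒜]

/-- The grading of a group concentrated in degree `0`. -/
def degreeZero (M : Type u) [AddCommGroup M] (i : ℤ) : AddSubgroup M := if i = 0 then ⊤ else ⊥

theorem degreeZero_isInternal (M : Type u) [AddCommGroup M] :
    DirectSum.IsInternal (degreeZero M) := by
  refine isInternal_of_proj _ (fun i => if i = 0 then AddMonoidHom.id M else 0) ?_ ?_ ?_
  · intro i x hx
    by_cases h : i = 0
    · simp [h]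
    · simp only [degreeZero, h, if_false, AddSubgroup.mem_bot] at hx
      rw [hx, map_zero]
  · intro i j hij x hx
    by_cases h : i = 0
    · have : j ≠ 0 := by omega
      simp [this]
    · simp only [degreeZero, h, if_false, AddSubgroup.mem_bot] at hx
      rw [hx, map_zero]
  · intro x
    refine AddSubgroup.mem_iSup_of_mem 0 ?_
    simp [degreeZero]

theorem projZero_of_mem {i : ℤ} (hi : i ≠ 0) {r : A} (hr : r ∈ intGrading 𝒜 i) :
    GradedRing.projZeroRingHom' 𝒜 r = 0 := by
  obtain ⟨h, hr⟩ | rfl := mem_intGrading.1 hr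
  · have : i.toNat ≠ 0 := by omega
    ext
    simp [DirectSum.decompose_of_mem_ne 𝒜 hr this]
  · exact map_zero _

/-- The trivial graded left `A`-module `A / A_{>0} = A_0`, in degree `0`; this is `k` if `A` is
connected. -/
noncomputable def trivialLeft : GrMod (intGrading 𝒜) where
  carrier := 𝒜 0
  module := Module.compHom (𝒜 0) (GradedRing.projZeroRingHom' 𝒜)
  deg := degreeZero (𝒜 0)
  isInternal := degreeZero_isInternal (𝒜 0)
  smul_mem {i j r x} hr hx := by
    let _ : Module A (𝒜 0) := Module.compHom (𝒜 0) (GradedRing.projZeroRingHom' 𝒜)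
    by_cases hi : i = 0
    · subst hi
      rw [zero_add]
      by_cases hj : j = 0
      · simp [degreeZero, hj]
      · simp only [degreeZero, hj, if_false, AddSubgroup.mem_bot] at hx ⊢
        rw [hx, smul_zero]
    · have : r • x = 0 := by
        change GradedRing.projZeroRingHom' 𝒜 r * x = 0
        rw [projZero_of_mem 𝒜 hi hr, zero_mul]
      rw [this]
      exact zero_mem _

/-- The trivial graded right `A`-module `A / A_{>0} = A_0`, in degree `0`; this is `k` if `A` is
connected. -/
noncomputable def trivialRight : GrMod (opGrading (intGrading 𝒜)) where
  carrier := 𝒜 0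
  module := Module.compHom (𝒜 0) (GradedRing.projZeroRingHom' 𝒜).op
  deg := degreeZero (𝒜 0)
  isInternal := degreeZero_isInternal (𝒜 0)
  smul_mem {i j r x} hr hx := by
    let _ : Module Aᵐᵒᵖ (𝒜 0) := Module.compHom (𝒜 0) (GradedRing.projZeroRingHom' 𝒜).op
    by_cases hi : i = 0
    · subst hi
      rw [zero_add]
      by_cases hj : j = 0
      · simp [degreeZero, hj]
      · simp only [degreeZero, hj, if_false, AddSubgroup.mem_bot] at hx ⊢
        rw [hx, smul_zero]
    · have : r • x = 0 := by
        change x * GradedRing.projZeroRingHom' 𝒜 r.unop = 0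
        rw [projZero_of_mem 𝒜 hi (mem_opGrading.1 hr), mul_zero]
      rw [this]
      exact zero_mem _

open CategoryTheory in
/-- `A` is AS-Gorenstein of dimension `n` and parameter `ℓ`: it has injective dimension `n` as a
left and as a right module over itself, and, on both sides, the graded Ext module `Ext^i(k, A)` is
isomorphic to `k(ℓ)` for `i = n` and to `0` otherwise. -/
structure IsASGorenstein (n : ℕ) (ℓ : ℤ) : Prop where
  injdim_left : injectiveDimension (ModuleCat.of A A) = n
  injdim_right : injectiveDimension (ModuleCat.of Aᵐᵒᵖ A) = n
  ext_left : ExtConcentrated (trivialLeft 𝒜) (regular (intGrading 𝒜)) n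
    ((trivialRight 𝒜).shift ℓ)
  ext_right : ExtConcentrated (trivialRight 𝒜) (regularOp (intGrading 𝒜)) n
    ((trivialLeft 𝒜).shift ℓ)

open CategoryTheory in
/-- The left global dimension of a ring: the supremum of the projective dimensions of the left
modules. -/
noncomputable def globalDimension (A : Type u) [Ring A] : WithBot ℕ∞ :=
  ⨆ M : ModuleCat.{u} A, projectiveDimension M

end Gorenstein

/-! ### Duals of resolutions -/

section Dual

variable {R : Type u} [Ring R] {𝓡 : ℤ → AddSubgroup R} [GradedRing 𝓡]

/-- The dual complex `P ↦ Hom_R(P, R)`, where `P` is a projective resolution that vanishes in degrees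
`> n`, is, once reindexed by `i ↦ n - i`, the projective resolution `Q`. -/
structure IsDual {M : GrMod 𝓡} {M' : GrMod (opGrading 𝓡)} (n : ℕ) (P : ProjRes M)
    (Q : ProjRes M') : Prop where
  subsingleton_left : ∀ i, n < i → Subsingleton (P.X i).carrier
  subsingleton_right : ∀ i, n < i → Subsingleton (Q.X i).carrier
  exists_iso : ∃ θ : ∀ i j : ℕ, i + j = n →
      GrMod.Iso (Q.X i) (gradedHom (P.X j) (regular 𝓡)),
    ∀ (i j : ℕ) (h : i + 1 + j = n) (x : (Q.X (i + 1)).carrier),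
      (θ i (j + 1) (by omega)).toEquiv ((Q.d i).toLin x) =
        (gradedHomMap (P.d j) (regular 𝓡)).toLin ((θ (i + 1) j h).toEquiv x)

end Dual

end GradedCY

set_option linter.unusedSectionVars false

/-! Write `E = A ⊗ Aᵒᵖ`. It is again connected graded, so graded `E`-modules bounded below satisfy
Nakayama's lemma and have minimal free resolutions, recognised by differentials with values in
`E₊P`. Let `P` be such a resolution of the bimodule `A`; graded Ext does not depend on the
resolution, so the Calabi-Yau hypothesis may be read on `P`.

The lever is `Aug.coord_notMem_coboundaries`: by minimality a coboundary with values in `E` takes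
its values in the augmentation ideal, whereas a coordinate function of a basis takes the value 1.
Since Ext lives in degree `n` only, a last nonzero term of `P` cannot lie above `n`
(`subsingleton_of_bounded`); since `Ext^n = A(ℓ)` is cyclic, `P_n` has rank one
(`subsingleton_basis_top`); and finite rank passes from `P_{i+1}` to `P_i` (`finite_of_succ`). That
`P` is bounded at all comes from the global dimension: `P ⊗_A k` is a minimal resolution of `k`, and
`Ext^i_A(k, k) = 0` for `i > D`. This also gives `n ≤ D`. A generator of `P_n` has degree `e ≥ 0`
and its coordinate function has a nonzero class in `A_{ℓ - e}`, whence `ℓ ≥ 0`.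

Since `P` is finite free and concentrated, its dual is a minimal free resolution `Q` of `A(ℓ)` on
the other side (`exists_dual`). Finite free modules are reflexive, so the dual of `Q` is `P`, and
after a shift this is the right Calabi-Yau property (`IsDual.exists_concentrated`). Uniqueness of
minimal resolutions carries the duality statement to all of them.

To descend to `A`, one uses that `P` splits as a complex of one-sided `A`-modules. Hence `P ⊗_A M`
is a projective resolution of any `M` (`Res.exists_tensor`), which bounds the global dimensions of
`A` and `Aᵒᵖ` by `n`. For `M = k` the tensor product is taken coordinatewise, along `τ : E → A`, `a
⊗ b ↦ a ε(b)`, which keeps bases and degrees (`exists_reduction`). Reducing `Q` as well identifies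
the dual of `P ⊗_A k` with a resolution of `k(ℓ)` (`exists_concentrated_reduction`); dualising once
more gives the AS-Gorenstein property on both sides. Finally, on modules with a finite homogeneous
basis every linear map is a sum of homogeneous ones, so graded and ungraded Ext agree. -/

namespace GradedCY

/-! ### Homogeneous components -/

section Components

variable {M : Type*} [AddCommGroup M] {deg : ℤ → AddSubgroup M}

/-- The homogeneous component of degree `i`. -/
noncomputable def dcomp (h : DirectSum.IsInternal deg) (i : ℤ) : M →+ M :=
  letI := Classical.decEq M
  letI := h.chooseDecomposition
  (deg i).subtype.comp ((DFinsupp.evalAddMonoidHom i).comp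
    (DirectSum.decomposeAddEquiv deg).toAddMonoidHom)

theorem dcomp_mem (h : DirectSum.IsInternal deg) (i : ℤ) (x : M) : dcomp h i x ∈ deg i :=
  SetLike.coe_mem _

theorem dcomp_of_mem (h : DirectSum.IsInternal deg) {i : ℤ} {x : M} (hx : x ∈ deg i) :
    dcomp h i x = x := by
  let _ := h.chooseDecomposition
  exact DirectSum.decompose_of_mem_same deg hx

theorem dcomp_of_ne (h : DirectSum.IsInternal deg) {i j : ℤ} {x : M} (hx : x ∈ deg i)
    (hij : i ≠ j) : dcomp h j x = 0 := by
  let _ := h.chooseDecomposition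
  exact DirectSum.decompose_of_mem_ne deg hx hij

theorem dcomp_eq_ite (h : DirectSum.IsInternal deg) {i : ℤ} (j : ℤ) {x : M} (hx : x ∈ deg i) :
    dcomp h j x = if i = j then x else 0 := by
  split_ifs with hij
  · subst hij; exact dcomp_of_mem h hx
  · exact dcomp_of_ne h hx hij

theorem dinduction (h : DirectSum.IsInternal deg) {p : M → Prop} (x : M)
    (hom : ∀ i, ∀ x ∈ deg i, p x) (add : ∀ x y, p x → p y → p (x + y)) : p x :=
  AddSubgroup.iSup_induction _ (C := p) (mem_iSup_of_isInternal h x) hom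
    (hom 0 0 (zero_mem _)) add

theorem exists_sum_dcomp (h : DirectSum.IsInternal deg) (x : M) :
    ∃ s : Finset ℤ, x = ∑ i ∈ s, dcomp h i x := by
  classical
  let _ := h.chooseDecomposition
  exact ⟨_, (DirectSum.sum_support_decompose deg x).symm⟩

theorem mem_deg_iff_dcomp (h : DirectSum.IsInternal deg) {i : ℤ} {x : M} :
    x ∈ deg i ↔ dcomp h i x = x :=
  ⟨dcomp_of_mem h, fun hx => hx ▸ dcomp_mem h i x⟩

end Components

/-! ### Morphisms, homogeneous bases and free objects for graded modules -/

section GradedModules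

variable {R : Type u} [Ring R] {𝓡 : ℤ → AddSubgroup R} [GradedRing 𝓡]

variable (𝓡) in
/-- The homogeneous component of degree `i` of an element of a graded ring. -/
noncomputable abbrev rcomp (i : ℤ) : R →+ R := dcomp (DirectSum.Decomposition.isInternal 𝓡) i

namespace GrMod

/-- The homogeneous component of degree `i` of an element of a graded module. -/
noncomputable abbrev comp (M : GrMod 𝓡) (i : ℤ) : M.carrier →+ M.carrier :=
  dcomp M.isInternal i

theorem comp_smul_of_mem (M : GrMod 𝓡) {j : ℤ} (i : ℤ) (r : R) {m : M.carrier}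
    (hm : m ∈ M.deg j) : M.comp i (r • m) = rcomp 𝓡 (i - j) r • m := by
  refine dinduction (DirectSum.Decomposition.isInternal 𝓡)
    (p := fun r => M.comp i (r • m) = rcomp 𝓡 (i - j) r • m) r ?_ ?_
  · intro l r hr
    rw [comp, dcomp_eq_ite _ _ (M.smul_mem hr hm), rcomp, dcomp_eq_ite _ _ hr]
    by_cases hl : l = i - j
    · rw [if_pos (by omega), if_pos hl]
    · rw [if_neg (by omega), if_neg hl, zero_smul]
  · intro r s hr hs
    rw [add_smul, map_add, hr, hs, map_add, add_smul]

theorem Hom.comp_apply {M N : GrMod 𝓡} (f : Hom M N) (i : ℤ) (x : M.carrier) :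
    N.comp i (f.toLin x) = f.toLin (M.comp i x) := by
  refine dinduction M.isInternal (p := fun x => N.comp i (f.toLin x) = f.toLin (M.comp i x)) x ?_ ?_
  · intro l x hx
    rw [comp, dcomp_eq_ite _ _ (f.map_mem hx), comp, dcomp_eq_ite _ _ hx]
    split_ifs <;> simp
  · intro x y hx hy
    simp only [map_add, hx, hy]

/-- The composition of morphisms of graded modules. -/
def Hom.trans {M N P : GrMod 𝓡} (f : Hom M N) (g : Hom N P) : Hom M P where
  toLin := g.toLin ∘ₗ f.toLin
  map_mem hx := g.map_mem (f.map_mem hx)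

/-- The identity morphism. -/
def Hom.refl (M : GrMod 𝓡) : Hom M M := ⟨LinearMap.id, fun hx => hx⟩

/-- The zero morphism. -/
def Hom.zero (M N : GrMod 𝓡) : Hom M N := ⟨0, fun _ => zero_mem _⟩

/-- The difference of two morphisms. -/
def Hom.sub {M N : GrMod 𝓡} (f g : Hom M N) : Hom M N :=
  ⟨f.toLin - g.toLin, fun hx => sub_mem (f.map_mem hx) (g.map_mem hx)⟩

/-- The morphism underlying an isomorphism. -/
def Iso.hom {M N : GrMod 𝓡} (f : Iso M N) : Hom M N :=
  ⟨f.toEquiv.toLinearMap, fun hx => (f.mem_iff _ _).2 hx⟩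

/-- The inverse isomorphism. -/
def Iso.symm {M N : GrMod 𝓡} (f : Iso M N) : Iso N M where
  toEquiv := f.toEquiv.symm
  mem_iff i x := by rw [← f.mem_iff, LinearEquiv.apply_symm_apply]

/-- The identity isomorphism. -/
def Iso.refl (M : GrMod 𝓡) : Iso M M := ⟨LinearEquiv.refl _ _, fun _ _ => Iff.rfl⟩

/-- A bijective morphism is an isomorphism. -/
noncomputable def Hom.toIso {M N : GrMod 𝓡} (f : Hom M N) (hf : Function.Bijective f.toLin) :
    Iso M N where
  toEquiv := LinearEquiv.ofBijective f.toLin hf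
  mem_iff i x := by
    refine ⟨fun h => ?_, f.map_mem⟩
    have : f.toLin x ∈ N.deg i := h
    -- Morphisms commute with components, so injectivity pulls back the equation "equal to its own
    -- component".
    rw [mem_deg_iff_dcomp N.isInternal, f.comp_apply] at this
    rw [mem_deg_iff_dcomp M.isInternal]
    exact hf.1 this

/-- An arbitrary preimage may be replaced by its component of degree `i`, so surjections are
surjective degree by degree. -/
theorem exists_mem_deg_of_surjective {M N : GrMod 𝓡} (g : Hom M N)
    (hg : Function.Surjective g.toLin) {i : ℤ} {y : N.carrier} (hy : y ∈ N.deg i) :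
    ∃ x ∈ M.deg i, g.toLin x = y := by
  obtain ⟨x, rfl⟩ := hg y
  exact ⟨M.comp i x, dcomp_mem _ _ _, by rw [← g.comp_apply]; exact dcomp_of_mem _ hy⟩

/-- A basis that consists of homogeneous elements. -/
structure HBasis (P : GrMod 𝓡) (ι : Type*) where
  e : ι → ℤ
  b : Module.Basis ι R P.carrier
  mem : ∀ j, b j ∈ P.deg (e j)

namespace HBasis

variable {P : GrMod 𝓡} {ι : Type*} (B : HBasis P ι)
include B

theorem induction {p : P.carrier → Prop} (x : P.carrier) (zero : p 0)
    (add : ∀ x y, p x → p y → p (x + y)) (smul : ∀ (r : R) j, p (r • B.b j)) : p x := by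
  rw [← B.b.repr.symm_apply_apply x]
  induction B.b.repr x using Finsupp.induction_linear with
  | zero => simpa using zero
  | add f g hf hg => rw [map_add]; exact add _ _ hf hg
  | single j r => rw [Module.Basis.repr_symm_single]; exact smul r j

theorem repr_comp (i : ℤ) (x : P.carrier) (j : ι) :
    B.b.repr (P.comp i x) j = rcomp 𝓡 (i - B.e j) (B.b.repr x j) := by
  classical
  refine B.induction (p := fun x => B.b.repr (P.comp i x) j =
    rcomp 𝓡 (i - B.e j) (B.b.repr x j)) x ?_ ?_ ?_
  · simp
  · intro x y hx hy; simp [hx, hy]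
  · intro r l
    rw [comp_smul_of_mem P i r (B.mem l)]
    simp only [map_smul, Module.Basis.repr_self, Finsupp.smul_single, smul_eq_mul, mul_one,
      Finsupp.single_apply]
    split_ifs with h
    · rw [h]
    · simp

/-- Degrees can be read on coordinates; this makes the coordinate functions homogeneous, hence
elements of the graded dual. -/
theorem mem_deg_iff {i : ℤ} {x : P.carrier} :
    x ∈ P.deg i ↔ ∀ j, B.b.repr x j ∈ 𝓡 (i - B.e j) := by
  rw [mem_deg_iff_dcomp P.isInternal]
  constructor
  · intro h j
    rw [← h]
    change B.b.repr (P.comp i x) j ∈ _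
    rw [B.repr_comp]
    exact dcomp_mem _ _ _
  · intro h
    apply B.b.repr.injective
    ext j
    change B.b.repr (P.comp i x) j = _
    rw [B.repr_comp]
    exact dcomp_of_mem _ (h j)

/-- The morphism that sends the basis to given homogeneous elements. -/
noncomputable def lift {N : GrMod 𝓡} (y : ι → N.carrier) (hy : ∀ j, y j ∈ N.deg (B.e j)) :
    Hom P N where
  toLin := B.b.constr ℕ y
  map_mem {i x} hx := by
    rw [B.mem_deg_iff] at hx
    rw [B.b.constr_apply]
    refine sum_mem fun j _ => ?_
    have := N.smul_mem (hx j) (hy j)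
    rwa [sub_add_cancel] at this

@[simp] theorem lift_basis {N : GrMod 𝓡} (y : ι → N.carrier) (hy : ∀ j, y j ∈ N.deg (B.e j))
    (j : ι) : (B.lift y hy).toLin (B.b j) = y j := by
  simp [lift]

theorem isProjective : P.IsProjective := by
  intro M N g f hg
  choose y hy hgy using fun j => exists_mem_deg_of_surjective g hg (f.map_mem (B.mem j))
  refine ⟨B.lift y hy, B.b.ext fun j => ?_⟩
  simp [hgy]

/-- Transport of a homogeneous basis along an isomorphism. -/
noncomputable def ofIso {Q : GrMod 𝓡} (f : Iso P Q) : HBasis Q ι where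
  e := B.e
  b := B.b.map f.toEquiv
  mem j := by rw [Module.Basis.map_apply, f.mem_iff]; exact B.mem j

/-- Reindexing of a homogeneous basis. -/
noncomputable def reindex {κ : Type*} (f : ι ≃ κ) : HBasis P κ where
  e := B.e ∘ f.symm
  b := B.b.reindex f
  mem j := by rw [Module.Basis.reindex_apply]; exact B.mem _

theorem isFiniteFree [Finite ι] : P.IsFiniteFree := by
  obtain ⟨m, ⟨f⟩⟩ := Finite.exists_equiv_fin ι
  exact ⟨m, _, (B.reindex f).b, (B.reindex f).mem⟩

end HBasis

/-- The graded free module with generators of degrees `e j`. -/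
noncomputable def free (𝓡 : ℤ → AddSubgroup R) [GradedRing 𝓡] {ι : Type u} (e : ι → ℤ) :
    GrMod 𝓡 where
  carrier := ι →₀ R
  deg i :=
    { carrier := {x | ∀ j, x j ∈ 𝓡 (i - e j)}
      zero_mem' := fun _ => zero_mem _
      add_mem' := fun hx hy j => add_mem (hx j) (hy j)
      neg_mem' := fun hx j => neg_mem (hx j) }
  isInternal := by
    classical
    let p : ℤ → (ι →₀ R) →+ (ι →₀ R) := fun i => Finsupp.liftAddHom fun j =>
      (Finsupp.singleAddHom j).comp (rcomp 𝓡 (i - e j))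
    have hp : ∀ i x j, p i x j = rcomp 𝓡 (i - e j) (x j) := by
      intro i x j
      induction x using Finsupp.induction_linear with
      | zero => simp
      | add f g hf hg => simp [hf, hg]
      | single l r =>
        simp only [p, Finsupp.liftAddHom_apply_single, AddMonoidHom.comp_apply,
          Finsupp.singleAddHom_apply, Finsupp.single_apply]
        split_ifs with h
        · rw [h]
        · simp
    refine isInternal_of_proj _ p ?_ ?_ ?_
    · intro i x hx
      ext j
      rw [hp]
      exact dcomp_of_mem _ (hx j)
    · intro i j hij x hx
      ext l
      rw [hp]
      exact dcomp_of_ne _ (hx l) (by omega)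
    · intro x
      induction x using Finsupp.induction_linear with
      | zero => exact zero_mem _
      | add f g hf hg => exact add_mem hf hg
      | single l r =>
        refine dinduction (DirectSum.Decomposition.isInternal 𝓡)
          (p := fun r => Finsupp.single l r ∈ _) r ?_ ?_
        · intro i r hr
          refine AddSubgroup.mem_iSup_of_mem (i + e l) fun j => ?_
          rw [Finsupp.single_apply]
          split_ifs with h
          · subst h; rwa [add_sub_cancel_right]
          · exact zero_mem _
        · intro r s hr hs
          rw [Finsupp.single_add]
          exact add_mem hr hs
  smul_mem {i j r x} hr hx l := by
    have := SetLike.GradedMul.mul_mem hr (hx l)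
    rwa [← add_sub_assoc] at this

/-- The standard basis of a graded free module. -/
noncomputable def freeBasis {ι : Type u} (e : ι → ℤ) : HBasis (free 𝓡 e) ι where
  e := e
  b := Finsupp.basisSingleOne
  mem j := by
    classical
    intro l
    have : (Finsupp.basisSingleOne j : ι →₀ R) l = if j = l then 1 else 0 := by
      rw [Finsupp.coe_basisSingleOne, Finsupp.single_apply]
    refine this.symm ▸ ?_
    split_ifs with h
    · subst h; rw [sub_self]; exact SetLike.GradedOne.one_mem
    · exact zero_mem _

/-- The kernel of a morphism of graded modules. -/
def ker {M N : GrMod 𝓡} (f : Hom M N) : GrMod 𝓡 where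
  carrier := LinearMap.ker f.toLin
  deg i := (M.deg i).comap (LinearMap.ker f.toLin).subtype.toAddMonoidHom
  isInternal := by
    have hc : ∀ i x, x ∈ LinearMap.ker f.toLin → M.comp i x ∈ LinearMap.ker f.toLin := by
      intro i x hx
      rw [LinearMap.mem_ker] at hx ⊢
      rw [← f.comp_apply, hx, map_zero]
    refine isInternal_of_proj _ (fun i => ((M.comp i).comp
      (LinearMap.ker f.toLin).subtype.toAddMonoidHom).codRestrict
        (LinearMap.ker f.toLin).toAddSubgroup (fun x => hc i x x.2)) ?_ ?_ ?_
    · intro i x hx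
      exact Subtype.ext (dcomp_of_mem M.isInternal hx)
    · intro i j hij x hx
      exact Subtype.ext (dcomp_of_ne M.isInternal hx hij)
    · intro x
      obtain ⟨s, hs⟩ := exists_sum_dcomp M.isInternal x.1
      have : x = ∑ i ∈ s, ⟨M.comp i x.1, hc i x.1 x.2⟩ := by
        apply Subtype.ext
        rw [AddSubmonoidClass.coe_finsetSum]
        exact hs
      rw [this]
      exact sum_mem fun i _ => AddSubgroup.mem_iSup_of_mem i (dcomp_mem M.isInternal i x.1)
  smul_mem hr hx := M.smul_mem hr hx

/-- The inclusion of the kernel. -/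
def kerι {M N : GrMod 𝓡} (f : Hom M N) : Hom (ker f) M :=
  ⟨(LinearMap.ker f.toLin).subtype, fun hx => hx⟩

/-- A component of a product is a sum of products of components. `N` is only a subgroup, so that
stability under scalars can be checked on the products that occur. -/
theorem comp_smul_mem {M : GrMod 𝓡} {N : AddSubgroup M.carrier} {r : R} {x : M.carrier} {i : ℤ}
    (h : ∀ j, rcomp 𝓡 (i - j) r • M.comp j x ∈ N) : M.comp i (r • x) ∈ N := by
  obtain ⟨s, hs⟩ := exists_sum_dcomp M.isInternal x
  rw [hs, Finset.smul_sum, map_sum]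
  refine sum_mem fun j _ => ?_
  rw [comp_smul_of_mem M i r (dcomp_mem _ _ _)]
  exact h j

theorem isGradedSubmodule_iff {M : GrMod 𝓡} {N : Submodule R M.carrier} :
    M.IsGradedSubmodule N ↔ ∀ i, ∀ x ∈ N, M.comp i x ∈ N := by
  constructor
  · intro h i x hx
    rw [← h] at hx
    induction hx using Submodule.span_induction generalizing i with
    | mem x hx =>
      obtain ⟨hx, j, hj⟩ := hx
      rw [comp, dcomp_eq_ite _ _ hj]
      split_ifs
      exacts [hx, zero_mem _]
    | zero => rw [map_zero]; exact zero_mem _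
    | add x y _ _ hx hy => rw [map_add]; exact add_mem (hx i) (hy i)
    | smul r x _ hx => exact comp_smul_mem (N := N.toAddSubgroup) fun j => N.smul_mem _ (hx j)
  · intro h
    refine le_antisymm (Submodule.span_le.2 fun x hx => hx.1) fun x hx => ?_
    obtain ⟨s, hs⟩ := exists_sum_dcomp M.isInternal x
    rw [hs]
    exact sum_mem fun i _ => Submodule.subset_span ⟨h i x hx, i, dcomp_mem _ _ _⟩

end GrMod

/-! ### Connected graded rings -/

/-- An augmentation of a connected graded ring: a ring morphism onto a field that identifies the
component of degree `0` with the field and kills the other components, the components of negative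
degree being zero. -/
structure Aug (𝓡 : ℤ → AddSubgroup R) (K : Type*) [Field K] where
  hom : R →+* K
  neg : ∀ i < 0, ∀ x ∈ 𝓡 i, x = 0
  ne : ∀ i ≠ 0, ∀ x ∈ 𝓡 i, hom x = 0
  inj : ∀ x ∈ 𝓡 0, hom x = 0 → x = 0
  surj : ∀ c, ∃ x ∈ 𝓡 0, hom x = c

namespace Aug

variable {K : Type*} [Field K] (a : Aug 𝓡 K)

theorem hom_rcomp_zero (r : R) : a.hom (rcomp 𝓡 0 r) = a.hom r := by
  refine dinduction (DirectSum.Decomposition.isInternal 𝓡)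
    (p := fun r => a.hom (rcomp 𝓡 0 r) = a.hom r) r ?_ ?_
  · intro i x hx
    rw [rcomp, dcomp_eq_ite _ _ hx]
    split_ifs with h
    · rfl
    · rw [map_zero, a.ne i h x hx]
  · intro x y hx hy
    simp only [map_add, hx, hy]

/-- The augmentation of the opposite ring. -/
def op : Aug (opGrading 𝓡) K where
  hom := a.hom.fromOpposite fun _ _ => mul_comm _ _
  neg i hi x hx := MulOpposite.unop_injective (a.neg i hi _ hx)
  ne i hi x hx := a.ne i hi _ hx
  inj x hx h := MulOpposite.unop_injective (a.inj _ hx h)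
  surj c := by
    obtain ⟨x, hx, rfl⟩ := a.surj c
    exact ⟨MulOpposite.op x, hx, rfl⟩

/-- The submodule `R_+ M`. -/
def sub (M : GrMod 𝓡) : Submodule R M.carrier :=
  Submodule.span R {x | ∃ r m, a.hom r = 0 ∧ x = r • m}

variable {a} in
theorem smul_mem_sub {M : GrMod 𝓡} {r : R} (hr : a.hom r = 0) (m : M.carrier) :
    r • m ∈ a.sub M :=
  Submodule.subset_span ⟨r, m, hr, rfl⟩

theorem map_mem_sub {M N : GrMod 𝓡} (f : GrMod.Hom M N) {x : M.carrier} (hx : x ∈ a.sub M) :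
    f.toLin x ∈ a.sub N := by
  have : a.sub M ≤ (a.sub N).comap f.toLin := by
    refine Submodule.span_le.2 ?_
    rintro _ ⟨r, m, hr, rfl⟩
    change f.toLin (r • m) ∈ a.sub N
    rw [map_smul]
    exact smul_mem_sub hr _
  exact this hx

/-- Makes minimality a condition on matrix entries: they all have to lie in the augmentation ideal.
-/
theorem mem_sub_iff {P : GrMod 𝓡} {ι : Type*} (B : GrMod.HBasis P ι) {x : P.carrier} :
    x ∈ a.sub P ↔ ∀ j, a.hom (B.b.repr x j) = 0 := by
  constructor
  · intro h
    induction h using Submodule.span_induction with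
    | mem x hx =>
      obtain ⟨r, m, hr, rfl⟩ := hx
      intro j
      simp [hr]
    | zero => simp
    | add x y _ _ hx hy => intro j; simp [hx j, hy j]
    | smul r x _ hx => intro j; simp [hx j]
  · intro h
    rw [← B.b.linearCombination_repr x, Finsupp.linearCombination_apply]
    exact sum_mem fun j _ => smul_mem_sub (h j) _

theorem basis_notMem_sub {P : GrMod 𝓡} {ι : Type*} (B : GrMod.HBasis P ι) (j : ι) :
    B.b j ∉ a.sub P := by
  intro h
  have := (a.mem_sub_iff B).1 h j
  simp at this

/-- Nakayama's lemma for graded modules bounded below over connected graded rings. -/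
theorem nakayama {M : GrMod 𝓡} {c : ℤ} (hc : ∀ i < c, ∀ x ∈ M.deg i, x = 0)
    {N : Submodule R M.carrier} (hN : M.IsGradedSubmodule N) (h : N ⊔ a.sub M = ⊤) : N = ⊤ := by
  -- Induction on the degree, starting below `c` where the module vanishes.
  have key : ∀ (m : ℕ) (i : ℤ), i < c + m → ∀ x ∈ M.deg i, x ∈ N := by
    intro m
    induction m with
    | zero =>
      intro i hi x hx
      rw [hc i (by simpa using hi) x hx]
      exact zero_mem _
    | succ m ih =>
      intro i hi x hx
      have h1 : ∀ z ∈ a.sub M, M.comp i z ∈ N := by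
        intro z hz
        refine Submodule.closure_induction (p := fun z _ => M.comp i z ∈ N) ?_ ?_ ?_ hz
        · rw [map_zero]; exact zero_mem _
        · intro y z _ _ hy hz
          rw [map_add]; exact add_mem hy hz
        · rintro s _ ⟨r, m', hr, rfl⟩
          rw [← mul_smul]
          refine GrMod.comp_smul_mem (N := N.toAddSubgroup) fun j => ?_
          -- A scalar component of negative degree is zero; one of degree 0 is zero since the
          -- augmentation kills it and is injective there; for positive degree the vector component
          -- has smaller degree, and the induction hypothesis applies.
          rcases lt_trichotomy (i - j) 0 with hij | hij | hij
          · rw [a.neg _ hij _ (dcomp_mem _ _ _), zero_smul]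
            exact zero_mem _
          · have : rcomp 𝓡 (i - j) (s * r) = 0 := by
              rw [hij]
              refine a.inj _ (dcomp_mem _ _ _) ?_
              rw [a.hom_rcomp_zero, map_mul, hr, mul_zero]
            rw [this, zero_smul]
            exact zero_mem _
          · refine N.smul_mem _ (ih j ?_ _ (dcomp_mem _ _ _))
            push_cast at hi
            omega
      obtain ⟨y, hy, z, hz, rfl⟩ := Submodule.mem_sup.1 (h.symm ▸ Submodule.mem_top : x ∈ N ⊔ a.sub M)
      rw [← dcomp_of_mem M.isInternal hx, map_add]
      exact add_mem (GrMod.isGradedSubmodule_iff.1 hN i y hy) (h1 z hz)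
  rw [eq_top_iff]
  rintro x -
  refine dinduction M.isInternal (p := fun x => x ∈ N) x ?_ fun _ _ => add_mem
  intro i x hx
  exact key (i - c + 1).toNat i (by omega) x hx

/-- Nakayama's lemma, in the form that certifies projective covers. -/
theorem isSuperfluous {M : GrMod 𝓡} {c : ℤ} (hc : ∀ i < c, ∀ x ∈ M.deg i, x = 0)
    {L : Submodule R M.carrier} (hL : L ≤ a.sub M) : M.IsSuperfluous L := by
  intro N hN h
  refine a.nakayama hc hN (top_unique ?_)
  rw [← h]
  exact sup_le_sup_left hL _

include a in
theorem bounded_of_hbasis {P : GrMod 𝓡} {ι : Type*} (B : GrMod.HBasis P ι) {c : ℤ}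
    (hc : ∀ j, c ≤ B.e j) : ∀ i < c, ∀ x ∈ P.deg i, x = 0 := by
  intro i hi x hx
  rw [B.mem_deg_iff] at hx
  apply B.b.repr.injective
  ext j
  rw [a.neg _ (by have := hc j; omega) _ (hx j)]
  simp

/-- Minimal graded free covers. -/
theorem exists_cover (M : GrMod 𝓡) {c : ℤ} (hc : ∀ i < c, ∀ x ∈ M.deg i, x = 0) :
    ∃ (F : GrMod 𝓡) (ι : Type u) (B : GrMod.HBasis F ι) (p : GrMod.Hom F M),
      (∀ j, c ≤ B.e j) ∧ Function.Surjective p.toLin ∧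
      LinearMap.ker p.toLin ≤ a.sub F := by
  classical
  -- `Ind T` is linear independence over the residue field modulo `R₊M`. A maximal set of
  -- homogeneous elements with this property lifts a homogeneous basis of `M / R₊M`.
  let Ind : Set M.carrier → Prop := fun T => ∀ x : M.carrier →₀ R, (x.support : Set M.carrier) ⊆ T →
    Finsupp.linearCombination R id x ∈ a.sub M → ∀ b, a.hom (x b) = 0
  obtain ⟨T, hT⟩ : ∃ T, Maximal (fun T => (∀ b ∈ T, ∃ i, b ∈ M.deg i) ∧ Ind T) T := by
    refine zorn_subset {T | (∀ b ∈ T, ∃ i, b ∈ M.deg i) ∧ Ind T} ?_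
    intro C hC hchain
    refine ⟨⋃₀ C, ⟨?_, ?_⟩, fun s hs => Set.subset_sUnion_of_mem hs⟩
    · rintro b ⟨T, hT, hb⟩
      exact (hC hT).1 b hb
    · intro x hx hmem
      rcases C.eq_empty_or_nonempty with rfl | hne
      · have : x = 0 := by
          rw [← Finsupp.support_eq_empty, ← Finset.coe_eq_empty]
          simpa using hx
        simp [this]
      · obtain ⟨T, hTC, hxT⟩ := DirectedOn.exists_mem_subset_of_finset_subset_biUnion
          (f := id) hne hchain.directedOn (by simpa [Set.sUnion_eq_biUnion] using hx)
        exact (hC hTC).2 x hxT hmem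
  choose e he using fun b : T => hT.1.1 b b.2
  -- Zero belongs to every degree, so only nonzero generators have a degree that is bounded below by
  -- `c`.
  have hne : ∀ b ∈ T, b ≠ 0 := by
    rintro b hb rfl
    have := hT.1.2 (Finsupp.single 0 1) (by
      intro y hy
      have := Finsupp.support_single_subset hy
      rw [Finset.mem_singleton] at this
      rwa [this]) (by simp) 0
    simp at this
  let F := GrMod.free 𝓡 e
  let B : GrMod.HBasis F T := GrMod.freeBasis e
  let p := B.lift (N := M) (fun b => b) he
  have hrange : LinearMap.range p.toLin = Submodule.span R T := by
    change LinearMap.range (B.b.constr ℕ _) = _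
    rw [Module.Basis.constr_range, Subtype.range_coe]
  refine ⟨F, T, B, p, ?_, ?_, ?_⟩
  · intro b
    by_contra hlt
    exact hne b b.2 (hc _ (not_le.1 hlt) _ (he b))
  · rw [← LinearMap.range_eq_top, hrange]
    have hgr : M.IsGradedSubmodule (Submodule.span R T) := by
      refine le_antisymm (Submodule.span_le.2 fun x hx => hx.1) (Submodule.span_mono ?_)
      exact fun b hb => ⟨Submodule.subset_span hb, hT.1.1 b hb⟩
    refine a.nakayama hc hgr (eq_top_iff.2 ?_)
    rintro x -
    refine dinduction M.isInternal (p := fun x => x ∈ Submodule.span R T ⊔ a.sub M) x ?_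
      fun _ _ => add_mem
    intro i m hm
    by_contra hmem
    have hmT : m ∉ T := fun h => hmem (Submodule.mem_sup_left (Submodule.subset_span h))
    -- A homogeneous `m` outside `span T + R₊M` could be added to `T`, against maximality.
    have hind : Ind (insert m T) := by
      intro x hx hlin
      have hx' : ((x.erase m).support : Set M.carrier) ⊆ T := by
        intro y hy
        rw [Finsupp.support_erase, Finset.mem_coe, Finset.mem_erase] at hy
        exact (hx hy.2).resolve_left hy.1
      have hlin' : x m • m + Finsupp.linearCombination R id (x.erase m) ∈ a.sub M := by
        have := hlin
        rw [← Finsupp.single_add_erase m x] at this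
        rw [map_add, Finsupp.linearCombination_single] at this
        simpa using this
      have hspan : Finsupp.linearCombination R id (x.erase m) ∈ Submodule.span R T := by
        rw [Finsupp.linearCombination_apply]
        exact sum_mem fun y hy => Submodule.smul_mem _ _ (Submodule.subset_span (hx' hy))
      have hm0 : a.hom (x m) = 0 := by
        -- If the coefficient of `m` is invertible in the residue field, multiplying by a lift `c'`
        -- of its inverse expresses `m` modulo `R₊M` through `T`.
        by_contra h0
        obtain ⟨c', -, hc'⟩ := a.surj (a.hom (x m))⁻¹
        have h1 : (c' * x m - 1) • m ∈ a.sub M := smul_mem_sub (by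
          rw [map_sub, map_mul, hc', inv_mul_cancel₀ h0, map_one, sub_self]) m
        have h2 : x m • m ∈ Submodule.span R T ⊔ a.sub M := by
          have := sub_mem (Submodule.mem_sup_right (S := Submodule.span R T) hlin')
            (Submodule.mem_sup_left (T := a.sub M) hspan)
          simpa using this
        have h3 := sub_mem (Submodule.smul_mem _ c' h2)
          (Submodule.mem_sup_right (S := Submodule.span R T) h1)
        rw [sub_smul, mul_smul, one_smul, sub_sub_cancel] at h3
        exact hmem h3
      have := hT.1.2 (x.erase m) hx' (by
        have := sub_mem hlin' (smul_mem_sub hm0 m)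
        simpa using this)
      intro b
      by_cases hb : b = m
      · rw [hb, hm0]
      · rw [← Finsupp.erase_ne hb]
        exact this b
    have := hT.2 (y := insert m T) ⟨by
      rintro b (rfl | hb)
      exacts [⟨i, hm⟩, hT.1.1 b hb], hind⟩ (Set.subset_insert m T) (Set.mem_insert m T)
    exact hmT this
  · intro x hx
    rw [a.mem_sub_iff B]
    intro b
    -- An element of the kernel is a relation between the generators; independence modulo `R₊M` says
    -- that its coefficients are killed by the augmentation.
    have h1 : Finsupp.linearCombination R id ((B.b.repr x).mapDomain (Subtype.val : T → M.carrier))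
        = p.toLin x := by
      rw [Finsupp.linearCombination_mapDomain]
      change _ = B.b.constr ℕ _ x
      rw [Module.Basis.constr_apply]
      rfl
    have := hT.1.2 ((B.b.repr x).mapDomain (Subtype.val : T → M.carrier)) (by
      intro y hy
      obtain ⟨z, -, rfl⟩ := Finset.mem_image.1 (Finsupp.mapDomain_support hy)
      exact z.2) (by
      rw [h1, LinearMap.mem_ker.1 hx]
      exact zero_mem _) b
    rwa [Finsupp.mapDomain_apply Subtype.val_injective] at this

end Aug
end GradedModules
section Resolutions

variable {R : Type u} [Ring R] {𝓡 : ℤ → AddSubgroup R} [GradedRing 𝓡]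
variable {S : Type u} [Ring S] {𝓢 : ℤ → AddSubgroup S} [GradedRing 𝓢]

/-! ### Existence of minimal resolutions -/

/-- Minimal covers are iterated on the successive kernels. The recursion runs over modules bounded
below by the fixed `c`: a cover has generators of degree at least `c`, so its kernel satisfies the
same bound. -/
theorem Aug.exists_resolution {K : Type*} [Field K] (a : Aug 𝓡 K) (M : GrMod 𝓡) {c : ℤ}
    (hc : ∀ i < c, ∀ x ∈ M.deg i, x = 0) :
    ∃ (P : ProjRes M) (ι : ℕ → Type u) (B : ∀ n, GrMod.HBasis (P.X n) (ι n)),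
      (∀ n j, c ≤ (B n).e j) ∧ LinearMap.ker P.ε.toLin ≤ a.sub (P.X 0) ∧
      ∀ n, LinearMap.ker (P.d n).toLin ≤ a.sub (P.X (n + 1)) := by
  let St := {Z : GrMod 𝓡 // ∀ i < c, ∀ x ∈ Z.deg i, x = 0}
  choose F ι B p h1 h2 h3 using fun Z : St => a.exists_cover Z.1 Z.2
  let next : St → St := fun Z => ⟨GrMod.ker (p Z), fun i hi x hx =>
    Subtype.ext (a.bounded_of_hbasis (B Z) (h1 Z) i hi x.1 hx)⟩
  let Z : ℕ → St := fun n => Nat.rec ⟨M, hc⟩ (fun _ => next) n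
  have hker : ∀ n x, (GrMod.kerι (p (Z n))).toLin ((p (Z (n + 1))).toLin x) = 0 ↔
      (p (Z (n + 1))).toLin x = 0 := fun n x =>
    (injective_iff_map_eq_zero' _).1 (Submodule.subtype_injective _) _
  have hex : ∀ n, Function.Exact ((p (Z (n + 1))).trans (GrMod.kerι (p (Z n)))).toLin
      (p (Z n)).toLin := by
    intro n y
    constructor
    · intro hy
      obtain ⟨x, hx⟩ := h2 (Z (n + 1)) ⟨y, hy⟩
      exact ⟨x, congrArg Subtype.val hx⟩
    · rintro ⟨x, rfl⟩
      exact ((p (Z (n + 1))).toLin x).2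
  refine ⟨{ X := fun n => F (Z n)
            d := fun n => (p (Z (n + 1))).trans (GrMod.kerι (p (Z n)))
            ε := p (Z 0)
            projective := fun n => (B (Z n)).isProjective
            surjective := h2 (Z 0)
            exact_zero := hex 0
            exact_succ := fun n y => (hker n y).trans (hex (n + 1) y) },
    fun n => ι (Z n), fun n => B (Z n), fun n => h1 (Z n), h3 (Z 0), fun n x hx => ?_⟩
  exact h3 (Z (n + 1)) ((hker n x).1 hx)

/-! ### Comparison of resolutions -/

/-- Exactness turns `g` into a surjection onto the kernel of `h`, to which projectivity applies. -/
theorem GrMod.IsProjective.exists_lift {P X Y Z : GrMod 𝓡} (hP : P.IsProjective)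
    {g : GrMod.Hom X Y} {h : GrMod.Hom Y Z} (hgh : Function.Exact g.toLin h.toLin)
    (f : GrMod.Hom P Y) (hf : ∀ x, h.toLin (f.toLin x) = 0) :
    ∃ l : GrMod.Hom P X, ∀ x, g.toLin (l.toLin x) = f.toLin x := by
  obtain ⟨l, hl⟩ := hP X (GrMod.ker h)
    ⟨g.toLin.codRestrict (LinearMap.ker h.toLin) fun x => (hgh _).2 ⟨x, rfl⟩,
      fun hx => g.map_mem hx⟩
    ⟨f.toLin.codRestrict (LinearMap.ker h.toLin) hf, fun hx => f.map_mem hx⟩ (by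
      rintro ⟨y, hy⟩
      obtain ⟨x, rfl⟩ := (hgh y).1 hy
      exact ⟨x, rfl⟩)
  exact ⟨l, fun x => congrArg Subtype.val (LinearMap.congr_fun hl x)⟩

/-- Chain maps and homotopies are built by choices in which a new term exists only because the two
previous ones are compatible. The recursion therefore carries consecutive pairs; the first two terms
are separate since they involve the augmentation. -/
theorem exists_dependent_seq {α : ℕ → Type*} {q : α 0 → Prop} {r : ∀ n, α n → α (n + 1) → Prop}
    (h0 : ∃ a, q a) (h1 : ∀ a, q a → ∃ b, r 0 a b)
    (h2 : ∀ n a b, r n a b → ∃ c, r (n + 1) b c) :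
    ∃ f : ∀ n, α n, q (f 0) ∧ ∀ n, r n (f n) (f (n + 1)) := by
  obtain ⟨a, ha⟩ := h0
  obtain ⟨b, hb⟩ := h1 a ha
  choose c hc using h2
  let g : ∀ n, {p : α n × α (n + 1) // r n p.1 p.2} := fun n =>
    Nat.rec ⟨(a, b), hb⟩ (fun n p => ⟨(p.1.2, c n p.1.1 p.1.2 p.2), hc n p.1.1 p.1.2 p.2⟩) n
  exact ⟨fun n => (g n).1.1, ha, fun n => (g n).2⟩

namespace ProjRes

variable {M : GrMod 𝓡}

/-- Chain maps between resolutions of `M` that lift the identity. -/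
structure ChainMap (P P' : ProjRes M) where
  f : ∀ n, GrMod.Hom (P.X n) (P'.X n)
  ε : ∀ x, P'.ε.toLin ((f 0).toLin x) = P.ε.toLin x
  d : ∀ n x, (P'.d n).toLin ((f (n + 1)).toLin x) = (f n).toLin ((P.d n).toLin x)

theorem ε_d (P : ProjRes M) (x : (P.X 1).carrier) : P.ε.toLin ((P.d 0).toLin x) = 0 :=
  (P.exact_zero _).2 ⟨x, rfl⟩

theorem d_d (P : ProjRes M) (n : ℕ) (x : (P.X (n + 2)).carrier) :
    (P.d n).toLin ((P.d (n + 1)).toLin x) = 0 :=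
  (P.exact_succ n _).2 ⟨x, rfl⟩

theorem exists_chainMap (P P' : ProjRes M) : Nonempty (ChainMap P P') := by
  obtain ⟨f, h0, h⟩ := exists_dependent_seq
    (α := fun n => GrMod.Hom (P.X n) (P'.X n))
    (q := fun f => ∀ x, P'.ε.toLin (f.toLin x) = P.ε.toLin x)
    (r := fun n f g => ∀ x, (P'.d n).toLin (g.toLin x) = f.toLin ((P.d n).toLin x))
    (by
      obtain ⟨f, hf⟩ := P.projective 0 _ _ P'.ε P.ε P'.surjective
      exact ⟨f, fun x => LinearMap.congr_fun hf x⟩)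
    (fun f hf => (P.projective 1).exists_lift P'.exact_zero ((P.d 0).trans f) fun x => by
      change P'.ε.toLin (f.toLin ((P.d 0).toLin x)) = 0
      rw [hf, P.ε_d])
    (fun n f g hg => (P.projective (n + 2)).exists_lift (P'.exact_succ n)
      ((P.d (n + 1)).trans g) fun x => by
      change (P'.d n).toLin (g.toLin ((P.d (n + 1)).toLin x)) = 0
      rw [hg, P.d_d, map_zero])
  exact ⟨⟨f, h0, h⟩⟩

/-- The composition of chain maps. -/
def ChainMap.trans {P P' P'' : ProjRes M} (f : ChainMap P P') (g : ChainMap P' P'') :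
    ChainMap P P'' where
  f n := (f.f n).trans (g.f n)
  ε x := by
    change P''.ε.toLin ((g.f 0).toLin ((f.f 0).toLin x)) = _
    rw [g.ε, f.ε]
  d n x := by
    change (P''.d n).toLin ((g.f (n + 1)).toLin ((f.f (n + 1)).toLin x)) =
      (g.f n).toLin ((f.f n).toLin ((P.d n).toLin x))
    rw [g.d, f.d]

/-- Only endomorphisms over the identity are compared: applied to the round trips between two
resolutions, this is all that the invariance of Ext requires. -/
theorem ChainMap.exists_homotopy {P : ProjRes M} (φ : ChainMap P P) :
    ∃ h : ∀ n, GrMod.Hom (P.X n) (P.X (n + 1)),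
      (∀ x, (P.d 0).toLin ((h 0).toLin x) = (φ.f 0).toLin x - x) ∧
      ∀ n x, (P.d (n + 1)).toLin ((h (n + 1)).toLin x) =
        (φ.f (n + 1)).toLin x - x - (h n).toLin ((P.d n).toLin x) := by
  refine exists_dependent_seq
    (α := fun n => GrMod.Hom (P.X n) (P.X (n + 1)))
    (q := fun h => ∀ x, (P.d 0).toLin (h.toLin x) = (φ.f 0).toLin x - x)
    (r := fun n h h' => ∀ x, (P.d (n + 1)).toLin (h'.toLin x) =
        (φ.f (n + 1)).toLin x - x - h.toLin ((P.d n).toLin x))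
    ((P.projective 0).exists_lift P.exact_zero ((φ.f 0).sub (.refl _)) fun x => ?_)
    (fun h hh => (P.projective 1).exists_lift (P.exact_succ 0)
      (((φ.f 1).sub (.refl _)).sub ((P.d 0).trans h)) fun x => ?_)
    (fun n h h' hh => (P.projective (n + 2)).exists_lift (P.exact_succ (n + 1))
      (((φ.f (n + 2)).sub (.refl _)).sub ((P.d (n + 1)).trans h')) fun x => ?_)
  · change P.ε.toLin ((φ.f 0).toLin x - x) = 0
    rw [map_sub, φ.ε, sub_self]
  · change (P.d 0).toLin ((φ.f 1).toLin x - x - h.toLin ((P.d 0).toLin x)) = 0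
    rw [map_sub, map_sub, hh, φ.d, sub_self]
  · change (P.d (n + 1)).toLin ((φ.f (n + 2)).toLin x - x - h'.toLin ((P.d (n + 1)).toLin x)) = 0
    rw [map_sub, map_sub, hh, φ.d, P.d_d, map_zero, sub_zero, sub_self]

/-! ### Graded Ext does not depend on the resolution -/

variable (N : GrBimod 𝓡 𝓢)

theorem gradedHom_ext_iff {X : GrMod 𝓡} {c c' : (gradedHom X N).carrier} :
    c = c' ↔ ∀ x, c.1 x = c'.1 x :=
  Subtype.ext_iff.trans LinearMap.ext_iff

theorem mem_cocycles {P : ProjRes M} {n : ℕ} {c : (gradedHom (P.X n) N).carrier} :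
    c ∈ P.cocycles N n ↔ ∀ x, c.1 ((P.d n).toLin x) = 0 := by
  rw [cocycles, LinearMap.mem_ker, gradedHom_ext_iff]
  rfl

theorem mem_coboundaries_zero {P : ProjRes M} {c : (gradedHom (P.X 0) N).carrier} :
    c ∈ P.coboundaries N 0 ↔ c = 0 := Iff.rfl

theorem mem_coboundaries_succ {P : ProjRes M} {n : ℕ}
    {c : (gradedHom (P.X (n + 1)) N).carrier} :
    c ∈ P.coboundaries N (n + 1) ↔
      ∃ g : (gradedHom (P.X n) N).carrier, ∀ x, g.1 ((P.d n).toLin x) = c.1 x := by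
  rw [coboundaries, LinearMap.mem_range]
  refine exists_congr fun g => ?_
  rw [gradedHom_ext_iff]
  rfl

variable {N}

/-- The graded Ext computed with `P` is `E` in degree `n` and zero in the other degrees. -/
structure Concentrated (P : ProjRes M) (N : GrBimod 𝓡 𝓢) (n : ℕ) (E : GrMod 𝓢)
    (ψ : P.cocycles N n →ₗ[S] E.carrier) : Prop where
  surjective : Function.Surjective ψ
  eq_zero_iff : ∀ c, ψ c = 0 ↔ c.1 ∈ P.coboundaries N n
  deg : ∀ j c, c.1 ∈ (gradedHom (P.X n) N).deg j → ψ c ∈ E.deg j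
  exact : ∀ i, i ≠ n → P.cocycles N i ≤ P.coboundaries N i

theorem ChainMap.cocycle {P P' : ProjRes M} (f : ChainMap P P') {n : ℕ}
    {c : (gradedHom (P'.X n) N).carrier} (hc : c ∈ P'.cocycles N n) :
    (gradedHomMap (f.f n) N).toLin c ∈ P.cocycles N n := by
  rw [mem_cocycles] at hc ⊢
  intro x
  change c.1 ((f.f n).toLin ((P.d n).toLin x)) = 0
  rw [← f.d, hc]

theorem ChainMap.coboundary {P P' : ProjRes M} (f : ChainMap P P') {n : ℕ}
    {c : (gradedHom (P'.X n) N).carrier} (hc : c ∈ P'.coboundaries N n) :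
    (gradedHomMap (f.f n) N).toLin c ∈ P.coboundaries N n := by
  cases n with
  | zero =>
    rw [mem_coboundaries_zero] at hc ⊢
    rw [hc, map_zero]
  | succ n =>
    rw [mem_coboundaries_succ] at hc ⊢
    obtain ⟨g, hg⟩ := hc
    refine ⟨(gradedHomMap (f.f n) N).toLin g, fun x => ?_⟩
    change g.1 ((f.f n).toLin ((P.d n).toLin x)) = c.1 ((f.f (n + 1)).toLin x)
    rw [← f.d, hg]

theorem ChainMap.sub_mem_coboundaries {P : ProjRes M} (φ : ChainMap P P) {n : ℕ}
    {c : (gradedHom (P.X n) N).carrier} (hc : c ∈ P.cocycles N n) :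
    (gradedHomMap (φ.f n) N).toLin c - c ∈ P.coboundaries N n := by
  obtain ⟨h, h0, h1⟩ := φ.exists_homotopy
  rw [mem_cocycles] at hc
  cases n with
  | zero =>
    rw [mem_coboundaries_zero, gradedHom_ext_iff]
    intro x
    change c.1 ((φ.f 0).toLin x) - c.1 x = 0
    rw [← map_sub, ← h0, hc]
  | succ n =>
    rw [mem_coboundaries_succ]
    -- In `φ - 1 = d h + h d` the cocycle `c` kills the summand `d h`, so the difference is the
    -- coboundary of `c ∘ h`.
    refine ⟨(gradedHomMap (h n) N).toLin c, fun x => ?_⟩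
    change c.1 ((h n).toLin ((P.d n).toLin x)) = c.1 ((φ.f (n + 1)).toLin x) - c.1 x
    rw [← map_sub, ← sub_eq_zero, ← map_sub, ← neg_eq_zero, ← map_neg, neg_sub, ← h1, hc]

/-- Trades the quotient for a surjection from cocycles with the coboundaries as kernel. Only one
direction of the degree condition is kept; `Concentrated.extConcentrated` recovers the other. -/
theorem exists_concentrated {P : ProjRes M} {n : ℕ} {E : GrMod 𝓢}
    (he : ∃ e : P.Ext N n ≃ₗ[S] E.carrier, ∀ (j : ℤ) (x : P.Ext N n),
      e x ∈ E.deg j ↔ x ∈ P.extDeg N n j)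
    (h : ∀ i, i ≠ n → Subsingleton (P.Ext N i)) : ∃ ψ, P.Concentrated N n E ψ := by
  obtain ⟨e, he⟩ := he
  refine ⟨e.toLinearMap ∘ₗ Submodule.mkQ _, e.surjective.comp (Submodule.mkQ_surjective _), ?_, ?_, ?_⟩
  · intro c
    rw [LinearMap.comp_apply, LinearEquiv.coe_coe, e.map_eq_zero_iff, Submodule.mkQ_apply,
      Submodule.Quotient.mk_eq_zero]
    rfl
  · intro j c hc
    exact (he j _).2 ⟨c, hc, rfl⟩
  · intro i hi c hc
    have := h i hi
    have := (Submodule.Quotient.mk_eq_zero _).1 (Subsingleton.elim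
      (Submodule.Quotient.mk (p := (P.coboundaries N i).submoduleOf (P.cocycles N i)) ⟨c, hc⟩) 0)
    exact this

theorem Concentrated.extConcentrated {P : ProjRes M} {n : ℕ} {E : GrMod 𝓢}
    {ψ : P.cocycles N n →ₗ[S] E.carrier} (h : P.Concentrated N n E ψ) :
    ExtConcentrated M N n E := by
  have hker : (P.coboundaries N n).submoduleOf (P.cocycles N n) = LinearMap.ker ψ := by
    ext c
    exact (h.eq_zero_iff c).symm
  refine ⟨P, ⟨(Submodule.quotEquivOfEq _ _ hker).trans
    (ψ.quotKerEquivOfSurjective h.surjective), ?_⟩, ?_⟩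
  · intro j x
    obtain ⟨c, rfl⟩ := Submodule.mkQ_surjective _ x
    change ψ c ∈ E.deg j ↔ _
    constructor
    · intro hc
      have hcomp' : ∀ j, (gradedHom (P.X n) N).comp j c.1 ∈ P.cocycles N n := by
        intro j
        refine LinearMap.mem_ker.2 ?_
        rw [← GrMod.Hom.comp_apply, LinearMap.mem_ker.1 c.2, map_zero]
      -- Since `ψ` commutes with components, a class with image in degree `j` is represented by the
      -- component of degree `j` of any of its cocycles.
      have hψ : ∀ j, E.comp j (ψ c) = ψ ⟨_, hcomp' j⟩ := by
        intro j
        obtain ⟨s, hs⟩ := exists_sum_dcomp (gradedHom (P.X n) N).isInternal c.1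
        have h1 : c = ∑ i ∈ s, ⟨_, hcomp' i⟩ := Subtype.ext (by
          rw [AddSubmonoidClass.coe_finsetSum]; exact hs)
        by_cases hj : j ∈ s
        · conv_lhs => rw [h1]
          rw [map_sum, map_sum, Finset.sum_eq_single_of_mem j hj]
          · exact dcomp_of_mem _ (h.deg j _ (dcomp_mem _ _ _))
          · intro i _ hij
            exact dcomp_of_ne _ (h.deg i _ (dcomp_mem _ _ _)) hij
        · conv_lhs => rw [h1]
          rw [map_sum, map_sum, Finset.sum_eq_zero]
          · have h2 : (gradedHom (P.X n) N).comp j c.1 = 0 := by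
              rw [hs, map_sum]
              exact Finset.sum_eq_zero fun i hi =>
                dcomp_of_ne _ (dcomp_mem _ _ _) fun hij => hj (hij ▸ hi)
            rw [show (⟨_, hcomp' j⟩ : P.cocycles N n) = 0 from Subtype.ext h2, map_zero]
          · intro i hi
            exact dcomp_of_ne _ (h.deg i _ (dcomp_mem _ _ _)) fun hij => hj (hij ▸ hi)
      refine ⟨⟨_, hcomp' j⟩, dcomp_mem (gradedHom (P.X n) N).isInternal j c.1, ?_⟩
      refine (Submodule.Quotient.eq _).2 ?_
      rw [hker, LinearMap.mem_ker, map_sub, ← hψ, sub_eq_zero]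
      exact dcomp_of_mem _ hc
    · rintro ⟨c', hc', he⟩
      have : c' - c ∈ (P.coboundaries N n).submoduleOf (P.cocycles N n) :=
        (Submodule.Quotient.eq _).1 he
      rw [hker, LinearMap.mem_ker, map_sub, sub_eq_zero] at this
      rw [← this]
      exact h.deg j c' hc'
  · intro i hi
    refine ⟨fun x y => ?_⟩
    obtain ⟨x, rfl⟩ := Submodule.mkQ_surjective _ x
    obtain ⟨y, rfl⟩ := Submodule.mkQ_surjective _ y
    exact (Submodule.Quotient.eq _).2 (h.exact i hi (x - y).2)

/-- Composition with comparison maps in both directions is inverse on cohomology, because both round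
trips are homotopic to the identity. -/
theorem Concentrated.transfer {P : ProjRes M} {n : ℕ} {E : GrMod 𝓢}
    {ψ : P.cocycles N n →ₗ[S] E.carrier} (h : P.Concentrated N n E ψ) (P' : ProjRes M) :
    ∃ ψ', P'.Concentrated N n E ψ' := by
  obtain ⟨f⟩ := exists_chainMap P P'
  obtain ⟨g⟩ := exists_chainMap P' P
  let F : P'.cocycles N n →ₗ[S] P.cocycles N n :=
    (gradedHomMap (f.f n) N).toLin.restrict fun _ => f.cocycle
  refine ⟨ψ ∘ₗ F, ?_, ?_, ?_, ?_⟩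
  · intro y
    obtain ⟨c, rfl⟩ := h.surjective y
    refine ⟨⟨_, g.cocycle c.2⟩, ?_⟩
    have := (f.trans g).sub_mem_coboundaries c.2
    exact sub_eq_zero.1 ((map_sub ψ _ _).symm.trans
      ((h.eq_zero_iff (F ⟨_, g.cocycle c.2⟩ - c)).2 this))
  · intro c
    rw [LinearMap.comp_apply, h.eq_zero_iff]
    refine ⟨fun hc => ?_, f.coboundary⟩
    have h1 := (g.trans f).sub_mem_coboundaries c.2
    have h2 := sub_mem (g.coboundary hc) h1
    convert h2 using 1
    exact (sub_sub_cancel _ _).symm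
  · intro j c hc
    exact h.deg j _ ((gradedHomMap (f.f n) N).map_mem hc)
  · intro i hi c hc
    have h1 := (g.trans f).sub_mem_coboundaries hc
    have h2 := sub_mem (g.coboundary (h.exact i hi (f.cocycle hc))) h1
    convert h2 using 1
    exact (sub_sub_cancel _ _).symm

/-! ### Uniqueness of minimal resolutions -/

theorem isGradedSubmodule_range {M N : GrMod 𝓡} (f : GrMod.Hom M N) :
    N.IsGradedSubmodule (LinearMap.range f.toLin) := by
  rw [GrMod.isGradedSubmodule_iff]
  rintro i _ ⟨x, rfl⟩
  exact ⟨M.comp i x, (f.comp_apply i x).symm⟩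

/-- Superfluity of `L` makes `f` surjective, and it splits since `F` is projective. The image of the
section and the kernel of `f` span `P`; superfluity of `K` makes the section surjective too. -/
theorem bijective_of_superfluous {P F : GrMod 𝓡} (hF : F.IsProjective) (f : GrMod.Hom P F)
    {K : Submodule R P.carrier} {L : Submodule R F.carrier} (hK : P.IsSuperfluous K)
    (hL : F.IsSuperfluous L) (h1 : LinearMap.range f.toLin ⊔ L = ⊤)
    (h2 : LinearMap.ker f.toLin ≤ K) : Function.Bijective f.toLin := by
  have hs := LinearMap.range_eq_top.1 (hL _ (isGradedSubmodule_range f) h1)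
  obtain ⟨s, hs'⟩ := hF _ _ f (.refl F) hs
  have hfs : ∀ x, f.toLin (s.toLin x) = x := fun x => LinearMap.congr_fun hs' x
  have := hK _ (isGradedSubmodule_range s) (by
    rw [eq_top_iff]
    rintro x -
    refine Submodule.mem_sup.2 ⟨s.toLin (f.toLin x), ⟨_, rfl⟩, x - s.toLin (f.toLin x), h2 ?_,
      add_sub_cancel _ _⟩
    rw [LinearMap.mem_ker, map_sub, hfs, sub_self])
  refine ⟨fun x y hxy => ?_, hs⟩
  obtain ⟨x, rfl⟩ := LinearMap.range_eq_top.1 this x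
  obtain ⟨y, rfl⟩ := LinearMap.range_eq_top.1 this y
  rw [hfs, hfs] at hxy
  rw [hxy]

theorem ChainMap.bijective {P P' : ProjRes M} (f : ChainMap P P') (hP : P.IsMinimal)
    (hP' : P'.IsMinimal) (n : ℕ) : Function.Bijective (f.f n).toLin := by
  have h0 : Function.Bijective (f.f 0).toLin := by
    refine bijective_of_superfluous (P'.projective 0) _ hP.1 hP'.1 ?_ ?_
    · rw [eq_top_iff]
      rintro x -
      obtain ⟨y, hy⟩ := P.surjective (P'.ε.toLin x)
      refine Submodule.mem_sup.2 ⟨(f.f 0).toLin y, ⟨_, rfl⟩, x - (f.f 0).toLin y, ?_,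
        add_sub_cancel _ _⟩
      rw [LinearMap.mem_ker, map_sub, f.ε, hy, sub_self]
    · intro x hx
      rw [LinearMap.mem_ker] at hx ⊢
      rw [← f.ε, hx, map_zero]
  have hstep : ∀ n, Function.Injective (f.f n).toLin →
      (∀ x, ∃ y, (f.f n).toLin ((P.d n).toLin y) =
        (P'.d n).toLin x) → Function.Bijective (f.f (n + 1)).toLin := by
    intro n hn hy
    refine bijective_of_superfluous (P'.projective (n + 1)) _ (hP.2 n) (hP'.2 n) ?_ ?_
    · rw [eq_top_iff]
      rintro x -
      obtain ⟨y, hy⟩ := hy x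
      refine Submodule.mem_sup.2 ⟨(f.f (n + 1)).toLin y, ⟨_, rfl⟩, x - (f.f (n + 1)).toLin y, ?_,
        add_sub_cancel _ _⟩
      rw [LinearMap.mem_ker, map_sub, f.d, hy, sub_self]
    · intro x hx
      rw [LinearMap.mem_ker] at hx ⊢
      apply hn
      rw [← f.d, hx, map_zero, map_zero]
  have h1 : Function.Bijective (f.f 1).toLin := by
    refine hstep 0 h0.1 fun x => ?_
    obtain ⟨y, hy⟩ := h0.2 ((P'.d 0).toLin x)
    obtain ⟨z, rfl⟩ := (P.exact_zero y).1 (by rw [← f.ε, hy, P'.ε_d])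
    exact ⟨z, hy⟩
  -- Two consecutive levels are needed: injectivity at `n` and surjectivity at `n + 1` lift
  -- boundaries, injectivity at `n + 1` controls the kernel at `n + 2`.
  suffices h : ∀ n, Function.Bijective (f.f n).toLin ∧ Function.Bijective (f.f (n + 1)).toLin from
    (h n).1
  intro n
  induction n with
  | zero => exact ⟨h0, h1⟩
  | succ n ih =>
    refine ⟨ih.2, hstep (n + 1) ih.2.1 fun x => ?_⟩
    obtain ⟨y, hy⟩ := ih.2.2 ((P'.d (n + 1)).toLin x)
    obtain ⟨z, rfl⟩ := (P.exact_succ n y).1 (by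
      apply ih.1.1
      rw [← f.d, hy, P'.d_d, map_zero])
    exact ⟨z, hy⟩

end ProjRes
end Resolutions
/-! ### Projective resolutions of modules and `Ext` -/

section Ungraded

variable {R : Type u} [Ring R] {M : Type u} [AddCommGroup M] [Module R M]

/-- Projective resolutions of modules. -/
structure Res (R : Type u) [Ring R] (M : Type u) [AddCommGroup M] [Module R M] where
  X : ℕ → ModuleCat.{u} R
  d : ∀ n, X (n + 1) →ₗ[R] X n
  ε : X 0 →ₗ[R] M
  projective : ∀ n, Module.Projective R (X n)
  surjective : Function.Surjective ε
  exact_zero : Function.Exact (d 0) ε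
  exact_succ : ∀ n, Function.Exact (d (n + 1)) (d n)

namespace Res

variable (P : Res R M)

theorem ε_d (x : P.X 1) : P.ε (P.d 0 x) = 0 := (P.exact_zero _).2 ⟨x, rfl⟩

theorem d_d (n : ℕ) (x : P.X (n + 2)) : P.d n (P.d (n + 1) x) = 0 := (P.exact_succ n _).2 ⟨x, rfl⟩

open CategoryTheory

/-- The chain complex of a resolution. -/
noncomputable def complex : ChainComplex (ModuleCat.{u} R) ℕ :=
  ChainComplex.of P.X (fun n => ModuleCat.ofHom (P.d n)) fun n => by
    ext x
    exact P.d_d n x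

theorem complex_d (n : ℕ) : P.complex.d (n + 1) n = ModuleCat.ofHom (P.d n) :=
  ChainComplex.of_d P.X (fun n => ModuleCat.ofHom (P.d n)) n

theorem complex_d_ε : P.complex.d 1 0 ≫ ModuleCat.ofHom P.ε = 0 := by
  rw [P.complex_d 0]
  ext x
  exact P.ε_d x

/-- The resolution as a projective resolution in the category of modules. -/
noncomputable def toProjectiveResolution : ProjectiveResolution (ModuleCat.of R M) where
  complex := P.complex
  projective n := by
    have := P.projective n
    exact (IsProjective.iff_projective (P.X n)).1 this
  π := (ChainComplex.toSingle₀Equiv P.complex (ModuleCat.of R M)).symm ⟨ModuleCat.ofHom P.ε, P.complex_d_ε⟩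
  quasiIso := ⟨fun n => by
    cases n with
    | zero =>
      rw [ChainComplex.quasiIsoAt₀_iff, ShortComplex.quasiIso_iff_of_zeros']
      · rw [ShortComplex.moduleCat_exact_iff, ModuleCat.epi_iff_surjective]
        have hπ : ∀ x : P.X 0, (ConcreteCategory.hom
            (((ChainComplex.toSingle₀Equiv P.complex (ModuleCat.of R M)).symm
              ⟨ModuleCat.ofHom P.ε, P.complex_d_ε⟩).f 0)) x = P.ε x := by
          intro x
          exact congrArg (fun f => (ConcreteCategory.hom f) x)
            (ChainComplex.toSingle₀Equiv_symm_apply_f_zero (C := P.complex) (X := ModuleCat.of R M)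
              (ModuleCat.ofHom P.ε) P.complex_d_ε)
        refine ⟨fun x hx => ?_, fun x => ?_⟩
        · obtain ⟨y, hy⟩ := (P.exact_zero x).1 ((hπ x).symm.trans hx)
          refine ⟨y, ?_⟩
          change (ConcreteCategory.hom (P.complex.d 1 0)) y = x
          rw [P.complex_d]
          exact hy
        · obtain ⟨y, hy⟩ := P.surjective x
          exact ⟨y, (hπ y).trans hy⟩
      · exact P.complex.shape _ _ (by simp)
      · rfl
      · rfl
    | succ n =>
      rw [quasiIsoAt_iff_exactAt' _ _ (ChainComplex.exactAt_succ_single_obj _ _),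
        HomologicalComplex.exactAt_iff' _ (n + 1 + 1) (n + 1) n (by simp) (by simp),
        ShortComplex.moduleCat_exact_iff]
      intro x hx
      have hx' : P.d n x = 0 :=
        (congrArg (fun f => (ConcreteCategory.hom f) x) (P.complex_d n)).symm.trans hx
      obtain ⟨y, hy⟩ := (P.exact_succ n x).1 hx'
      refine ⟨y, ?_⟩
      change (ConcreteCategory.hom (P.complex.d (n + 2) (n + 1))) y = x
      rw [P.complex_d]
      exact hy⟩

variable {N : Type u} [AddCommGroup N] [Module R N]

variable (N) in
/-- The cocycles of degree `n` of the complex of the linear maps from a resolution to `N`. -/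
def cocycles (n : ℕ) : AddSubgroup (P.X n →ₗ[R] N) where
  carrier := {f | f ∘ₗ P.d n = 0}
  zero_mem' := LinearMap.zero_comp _
  add_mem' hf hg := by
    rw [Set.mem_ofPred_eq] at hf hg ⊢
    rw [LinearMap.add_comp, hf, hg, add_zero]
  neg_mem' hf := by
    rw [Set.mem_ofPred_eq] at hf ⊢
    rw [LinearMap.neg_comp, hf, neg_zero]

theorem mem_cocycles {n : ℕ} {f : P.X n →ₗ[R] N} : f ∈ P.cocycles N n ↔ f ∘ₗ P.d n = 0 := Iff.rfl

theorem complex_d_comp {n : ℕ} {f : P.X n →ₗ[R] N} (hf : f ∈ P.cocycles N n) :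
    P.toProjectiveResolution.complex.d (n + 1) n ≫
      (ModuleCat.ofHom f : P.X n ⟶ ModuleCat.of R N) = 0 := by
  change P.complex.d (n + 1) n ≫ (ModuleCat.ofHom f : P.X n ⟶ ModuleCat.of R N) = 0
  rw [P.complex_d]
  exact congrArg ModuleCat.ofHom hf

variable (N) in
/-- The class of a cocycle in `Ext`. -/
noncomputable def extClass (n : ℕ) :
    P.cocycles N n →+ Abelian.Ext (ModuleCat.of R M) (ModuleCat.of R N) n where
  toFun f := P.toProjectiveResolution.extMk (ModuleCat.ofHom f.1) (n + 1) rfl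
    (P.complex_d_comp f.2)
  map_zero' := P.toProjectiveResolution.extMk_zero (n + 1) rfl
  map_add' f g := (P.toProjectiveResolution.add_extMk _ _ (n + 1) rfl
    (P.complex_d_comp f.2) (P.complex_d_comp g.2)).symm

theorem extClass_surjective (n : ℕ) : Function.Surjective (P.extClass N n) := by
  intro x
  obtain ⟨f, hf, rfl⟩ := P.toProjectiveResolution.extMk_surjective x (n + 1) rfl
  have h : P.complex.d (n + 1) n ≫ f = 0 := hf
  rw [P.complex_d] at h
  exact ⟨⟨f.hom, congrArg ModuleCat.Hom.hom h⟩, rfl⟩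

theorem extClass_eq_zero_iff (n : ℕ) (f : P.cocycles N (n + 1)) :
    P.extClass N (n + 1) f = 0 ↔ ∃ g : P.X n →ₗ[R] N, g ∘ₗ P.d n = f.1 := by
  refine (P.toProjectiveResolution.extMk_eq_zero_iff _ (n + 2) rfl
    (P.complex_d_comp f.2) n rfl).trans ⟨?_, ?_⟩
  · rintro ⟨g, hg⟩
    have h : P.complex.d (n + 1) n ≫ g = ModuleCat.ofHom f.1 := hg
    rw [P.complex_d] at h
    exact ⟨g.hom, congrArg ModuleCat.Hom.hom h⟩
  · rintro ⟨g, hg⟩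
    refine ⟨ModuleCat.ofHom g, ?_⟩
    change P.complex.d (n + 1) n ≫ (ModuleCat.ofHom g : P.X n ⟶ ModuleCat.of R N) =
      ModuleCat.ofHom f.1
    rw [P.complex_d, ← hg]
    rfl

theorem extClass_comp (n : ℕ) {N' : Type u} [AddCommGroup N'] [Module R N'] (g : N →ₗ[R] N')
    (f : P.cocycles N n) (f' : P.cocycles N' n) (h : f'.1 = g ∘ₗ f.1) :
    (P.extClass N n f).comp (Abelian.Ext.mk₀ (ModuleCat.ofHom g)) (add_zero n) =
      P.extClass N' n f' := by
  obtain ⟨f', hf'⟩ := f'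
  subst h
  exact P.toProjectiveResolution.extMk_comp_mk₀ _ (n + 1) rfl (P.complex_d_comp f.2)
    (ModuleCat.ofHom g)

theorem subsingleton_ext_zero (h : ∀ f ∈ P.cocycles N 0, f = 0) :
    Subsingleton (Abelian.Ext (ModuleCat.of R M) (ModuleCat.of R N) 0) := by
  refine ⟨fun x y => ?_⟩
  obtain ⟨f, rfl⟩ := P.extClass_surjective 0 x
  obtain ⟨g, rfl⟩ := P.extClass_surjective 0 y
  congr 1
  ext1
  rw [h f.1 f.2, h g.1 g.2]

theorem subsingleton_ext_succ_iff (n : ℕ) :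
    Subsingleton (Abelian.Ext (ModuleCat.of R M) (ModuleCat.of R N) (n + 1)) ↔
      ∀ f ∈ P.cocycles N (n + 1), ∃ g : P.X n →ₗ[R] N, g ∘ₗ P.d n = f := by
  constructor
  · intro h f hf
    exact (P.extClass_eq_zero_iff n ⟨f, hf⟩).1 (Subsingleton.elim _ _)
  · refine fun h => ⟨fun x y => ?_⟩
    obtain ⟨f, rfl⟩ := P.extClass_surjective _ x
    obtain ⟨g, rfl⟩ := P.extClass_surjective _ y
    rw [(P.extClass_eq_zero_iff n f).2 (h _ f.2), (P.extClass_eq_zero_iff n g).2 (h _ g.2)]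

/-- The cocycles form only a subgroup, with no action of `S`; compatibility of `ψ` with `S` is
therefore tested on pairs of cocycles related by a scalar. -/
theorem extIso {S E : Type u} [Ring S] [Module S N] [SMulCommClass S R N] [AddCommGroup E]
    [Module S E] (n : ℕ) (ψ : P.cocycles N (n + 1) →+ E) (hψ : Function.Surjective ψ)
    (h0 : ∀ f, ψ f = 0 ↔ ∃ g : P.X n →ₗ[R] N, g ∘ₗ P.d n = f.1)
    (hs : ∀ (s : S) (f f' : P.cocycles N (n + 1)), f'.1 = DistribSMul.toLinearMap R N s ∘ₗ f.1 → ψ f' = s • ψ f) :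
    ExtIso R S M N E (n + 1) := by
  have hker : (P.extClass N (n + 1)).ker = ψ.ker := by
    ext f
    rw [AddMonoidHom.mem_ker, AddMonoidHom.mem_ker, h0, P.extClass_eq_zero_iff]
  let e₁ := QuotientAddGroup.quotientKerEquivOfSurjective _ (P.extClass_surjective (N := N) (n + 1))
  let e₂ := QuotientAddGroup.quotientKerEquivOfSurjective _ hψ
  let e := e₁.symm.trans ((QuotientAddGroup.quotientAddEquivOfEq hker).trans e₂)
  have he : ∀ f, e (P.extClass N (n + 1) f) = ψ f := by
    intro f
    have : e₁.symm (P.extClass N (n + 1) f) = QuotientAddGroup.mk f := by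
      rw [AddEquiv.symm_apply_eq]
      rfl
    change e₂ (QuotientAddGroup.quotientAddEquivOfEq hker (e₁.symm _)) = _
    rw [this]
    rfl
  refine ⟨e, fun s x => ?_⟩
  obtain ⟨f, rfl⟩ := P.extClass_surjective _ x
  have hf' : DistribSMul.toLinearMap R N s ∘ₗ f.1 ∈ P.cocycles N (n + 1) := by
    rw [mem_cocycles, LinearMap.comp_assoc, f.2, LinearMap.comp_zero]
  rw [P.extClass_comp (n + 1) _ f ⟨_, hf'⟩ rfl, he, he]
  exact hs s f _ rfl

end Res
end Ungraded
/-! ### Resolutions that split over a smaller ring -/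

section Split

variable {R : Type u} [Ring R] {C : Type u} [Ring C] (γ : C →+* R)

/-- A module over `R` is projective over `C`, which acts through `γ`. -/
def ProjectiveOver (X : Type*) [AddCommGroup X] [Module R X] : Prop :=
  let _ := Module.compHom X γ
  Module.Projective C X

/-- `X` is a direct summand of a free `R`-module, which over `C` is a direct sum of copies of the
projective module `R`. -/
theorem projectiveOver_of_projective (hR : ProjectiveOver γ R)
    (X : Type u) [AddCommGroup X] [Module R X] [Module.Projective R X] : ProjectiveOver γ X := by
  let _ := Module.compHom X γ
  let _ := Module.compHom R γ
  have hR' : Module.Projective C R := hR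
  have : IsScalarTower C R X := ⟨fun c r x => mul_smul (γ c) r x⟩
  have : IsScalarTower C R R := ⟨fun c r x => mul_smul (γ c) r x⟩
  classical
  have : Module.Projective C (X →₀ R) :=
    Module.Projective.of_equiv' (finsuppLequivDFinsupp C (ι := X) (M := R)).symm
  obtain ⟨s, hs⟩ := (Module.projective_def' (R := R) (P := X)).1 inferInstance
  refine Module.Projective.of_split (s.restrictScalars C)
    ((Finsupp.linearCombination R id).restrictScalars C) ?_
  ext x
  exact LinearMap.congr_fun hs x

/-- Additive maps that commute with the action of `C` through `γ`. -/
def Commutes {X Y : Type*} [AddCommGroup X] [AddCommGroup Y] [Module R X] [Module R Y]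
    (s : X →+ Y) : Prop := ∀ c x, s (γ c • x) = γ c • s x

variable {M : Type u} [AddCommGroup M] [Module R M]

theorem exists_commutes_lift (hR : ProjectiveOver γ R)
    {X Y Z : Type u} [AddCommGroup X] [AddCommGroup Y] [AddCommGroup Z] [Module R X] [Module R Y]
    [Module R Z] [Module.Projective R X] (g : Y →ₗ[R] Z) (f : X →+ Z) (hf : Commutes γ f)
    (h : ∀ x, ∃ y, g y = f x) : ∃ l : X →+ Y, Commutes γ l ∧ ∀ x, g (l x) = f x := by
  let _ := Module.compHom X γ
  let _ := Module.compHom Y γ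
  let _ := Module.compHom Z γ
  have hX : Module.Projective C X := projectiveOver_of_projective γ hR X
  let G : Y →ₗ[C] Z := { g with map_smul' := fun c y => g.map_smul (γ c) y }
  let F : X →ₗ[C] Z := { f with map_smul' := fun c x => hf c x }
  obtain ⟨l, hl⟩ := Module.projective_lifting_property G.rangeRestrict
    (F.codRestrict G.range h) G.surjective_rangeRestrict
  exact ⟨l.toAddMonoidHom, fun c x => l.map_smul c x,
    fun x => congrArg Subtype.val (LinearMap.congr_fun hl x)⟩

namespace Res

variable (P : Res R M) (hR : ProjectiveOver γ R)
  (hM : ProjectiveOver γ M)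
include hR hM

theorem exists_splitting_zero : ∃ s : M →+ P.X 0, Commutes γ s ∧ ∀ m, P.ε (s m) = m := by
  let _ := Module.compHom M γ
  let _ := Module.compHom (P.X 0) γ
  have hM' : Module.Projective C M := hM
  let G : P.X 0 →ₗ[C] M := { P.ε with map_smul' := fun c y => P.ε.map_smul (γ c) y }
  obtain ⟨l, hl⟩ := Module.projective_lifting_property G LinearMap.id P.surjective
  exact ⟨l.toAddMonoidHom, fun c x => l.map_smul c x, fun x => LinearMap.congr_fun hl x⟩

/-- All terms and `M` are projective over `C`, so the exact complex splits there. Such splittings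
survive the functors that only see the `C`-structure. -/
theorem exists_splitting (n : ℕ) : ∃ s : P.X n →+ P.X (n + 1), Commutes γ s ∧
    ∀ x, P.d n (s (P.d n x)) = P.d n x := by
  induction n with
  | zero =>
    obtain ⟨s, hs, hεs⟩ := P.exists_splitting_zero γ hR hM
    have := P.projective 0
    -- With `ε s = 1`, the map `1 - s ε` takes values in the kernel of `ε`, that is, in the image of
    -- `d 0`. The inductive step does the same with `1 - s d`.
    obtain ⟨l, hl, hdl⟩ := exists_commutes_lift γ hR (P.d 0)
      (AddMonoidHom.id _ - s.comp P.ε.toAddMonoidHom)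
      (fun c x => by
        change γ c • x - s (P.ε (γ c • x)) = γ c • (x - s (P.ε x))
        rw [map_smul, hs, smul_sub])
      (fun x => (P.exact_zero _).1 (by
        change P.ε (x - s (P.ε x)) = 0
        rw [map_sub, hεs, sub_self]))
    refine ⟨l, hl, fun x => (hdl _).trans ?_⟩
    change P.d 0 x - s (P.ε (P.d 0 x)) = _
    rw [P.ε_d, map_zero, sub_zero]
  | succ n ih =>
    obtain ⟨s, hs, hds⟩ := ih
    have := P.projective (n + 1)
    obtain ⟨l, hl, hdl⟩ := exists_commutes_lift γ hR (P.d (n + 1))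
      (AddMonoidHom.id _ - s.comp (P.d n).toAddMonoidHom)
      (fun c x => by
        change γ c • x - s (P.d n (γ c • x)) = γ c • (x - s (P.d n x))
        rw [map_smul, hs, smul_sub])
      (fun x => (P.exact_succ n _).1 (by
        change P.d n (x - s (P.d n x)) = 0
        rw [map_sub, hds, sub_self]))
    refine ⟨l, hl, fun x => (hdl _).trans ?_⟩
    change P.d (n + 1) x - s (P.d n (P.d (n + 1) x)) = _
    rw [P.d_d, map_zero, sub_zero]

end Res
end Split

/-! ### The tensor product with a module over an algebra -/

section Tensor

variable {k : Type v} [Field k] {A : Type u} [Ring A] [Algebra k A]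

variable (k A) in
/-- A module over `A ⊗ Aᵒᵖ` seen as a bimodule. -/
def Bim (X : Type u) [AddCommGroup X] [Module (A ⊗[k] Aᵐᵒᵖ) X] : Type u := X

section

variable (X : Type u) [AddCommGroup X] [Module (A ⊗[k] Aᵐᵒᵖ) X]

instance : AddCommGroup (Bim k A X) := inferInstanceAs (AddCommGroup X)

noncomputable instance : Module A (Bim k A X) :=
  Module.compHom X (Algebra.TensorProduct.includeLeft : A →ₐ[k] A ⊗[k] Aᵐᵒᵖ).toRingHom

noncomputable instance : Module Aᵐᵒᵖ (Bim k A X) :=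
  Module.compHom X (Algebra.TensorProduct.includeRight : Aᵐᵒᵖ →ₐ[k] A ⊗[k] Aᵐᵒᵖ).toRingHom

noncomputable instance : Module k (Bim k A X) :=
  Module.compHom X (algebraMap k (A ⊗[k] Aᵐᵒᵖ))

variable {X}

theorem bim_smul_smul (a : A) (b : Aᵐᵒᵖ) (x : Bim k A X) :
    a • b • x = (a ⊗ₜ[k] b) • (show X from x) := by
  change (a ⊗ₜ[k] (1 : Aᵐᵒᵖ)) • ((1 : A) ⊗ₜ[k] b) • (show X from x) = _
  rw [← mul_smul, Algebra.TensorProduct.tmul_mul_tmul, mul_one, one_mul]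

variable (X)

instance : SMulCommClass A Aᵐᵒᵖ (Bim k A X) where
  smul_comm a b x := by
    rw [bim_smul_smul]
    change _ = ((1 : A) ⊗ₜ[k] b) • (a ⊗ₜ[k] (1 : Aᵐᵒᵖ)) • (show X from x)
    rw [← mul_smul, Algebra.TensorProduct.tmul_mul_tmul, mul_one, one_mul]

instance : IsScalarTower k A (Bim k A X) where
  smul_assoc c a x := by
    change ((c • a) ⊗ₜ[k] (1 : Aᵐᵒᵖ)) • (show X from x) =
      algebraMap k (A ⊗[k] Aᵐᵒᵖ) c • (a ⊗ₜ[k] (1 : Aᵐᵒᵖ)) • (show X from x)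
    rw [← mul_smul, ← Algebra.smul_def, TensorProduct.smul_tmul']

end

variable {M : Type u} [AddCommGroup M] [Module A M] [Module k M] [IsScalarTower k A M]

variable (k A M) in
/-- The relations that define `X ⊗_A M` as a quotient of `X ⊗_k M`. -/
noncomputable def balancedRel (X : Type u) [AddCommGroup X] [Module (A ⊗[k] Aᵐᵒᵖ) X] :
    Submodule A (Bim k A X ⊗[k] M) :=
  Submodule.span A {t | ∃ (x : Bim k A X) (a : A) (m : M),
    t = (MulOpposite.op a • x) ⊗ₜ[k] m - x ⊗ₜ[k] (a • m)}

section

variable {X Y Z : Type u} [AddCommGroup X] [Module (A ⊗[k] Aᵐᵒᵖ) X] [AddCommGroup Y]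
  [Module (A ⊗[k] Aᵐᵒᵖ) Y] [AddCommGroup Z] [Module (A ⊗[k] Aᵐᵒᵖ) Z]

/-- Left multiplication sends a relator to a relator, because the two actions on `X` commute; so the
`A`-span of the relators is their additive span. -/
theorem balancedRel_induction {p : Bim k A X ⊗[k] M → Prop} (zero : p 0)
    (add : ∀ s t, p s → p t → p (s + t))
    (rel : ∀ (x : Bim k A X) (a : A) (m : M),
      p ((MulOpposite.op a • x) ⊗ₜ[k] m - x ⊗ₜ[k] (a • m)))
    {t : Bim k A X ⊗[k] M} (ht : t ∈ balancedRel k A M X) : p t := by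
  refine Submodule.closure_induction (p := fun t _ => p t) zero (fun _ _ _ _ => add _ _) ?_ ht
  rintro b _ ⟨x, a, m, rfl⟩
  rw [smul_sub, TensorProduct.smul_tmul', TensorProduct.smul_tmul', smul_comm]
  exact rel _ _ _

/-- The map on the tensor products over `k` induced by an additive map compatible with the right
actions of `A`. -/
noncomputable def rmap (s : X →+ Y)
    (hs : Commutes (Algebra.TensorProduct.includeRight : Aᵐᵒᵖ →ₐ[k] A ⊗[k] Aᵐᵒᵖ).toRingHom s) :
    Bim k A X ⊗[k] M →ₗ[k] Bim k A Y ⊗[k] M :=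
  TensorProduct.map
    { toFun := s
      map_add' := s.map_add
      map_smul' := fun c x => by
        have := hs (algebraMap k Aᵐᵒᵖ c) x
        rw [AlgHom.toRingHom_eq_coe, RingHom.coe_coe, AlgHom.commutes] at this
        exact this } LinearMap.id

theorem rmap_mem (s : X →+ Y)
    (hs : Commutes (Algebra.TensorProduct.includeRight : Aᵐᵒᵖ →ₐ[k] A ⊗[k] Aᵐᵒᵖ).toRingHom s)
    {t : Bim k A X ⊗[k] M} (ht : t ∈ balancedRel k A M X) :
    rmap s hs t ∈ balancedRel k A M Y := by
  refine balancedRel_induction (p := fun t => rmap s hs t ∈ balancedRel k A M Y) ?_ ?_ ?_ ht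
  · rw [map_zero]; exact zero_mem _
  · intro s t hs ht
    rw [map_add]; exact add_mem hs ht
  · intro x a m
    rw [map_sub]
    refine Submodule.subset_span ⟨s x, a, m, ?_⟩
    have : s (MulOpposite.op a • x : Bim k A X) =
        (MulOpposite.op a • (show Bim k A Y from s x) : Bim k A Y) := hs _ x
    rw [← this]
    rfl

/-- The map on the tensor products over `k` induced by a morphism of bimodules. -/
noncomputable def lmap (f : X →ₗ[A ⊗[k] Aᵐᵒᵖ] Y) :
    Bim k A X ⊗[k] M →ₗ[A] Bim k A Y ⊗[k] M :=
  TensorProduct.AlgebraTensorModule.map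
    { toFun := f
      map_add' := f.map_add
      map_smul' := fun a x => f.map_smul (a ⊗ₜ[k] (1 : Aᵐᵒᵖ)) x } LinearMap.id

theorem lmap_mem (f : X →ₗ[A ⊗[k] Aᵐᵒᵖ] Y) {t : Bim k A X ⊗[k] M}
    (ht : t ∈ balancedRel k A M X) : lmap f t ∈ balancedRel k A M Y :=
  rmap_mem f.toAddMonoidHom (fun _ x => f.map_smul _ x) ht

/-- The splitting `s` commutes with the right action, so `s ⊗ 1` preserves the balanced relations.
Modulo these, `t` equals `t - s g t`, whose `Y`-entries lie in the kernel of `g`, which is the image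
of `f`. -/
theorem exact_lmap (f : X →ₗ[A ⊗[k] Aᵐᵒᵖ] Y) (g : Y →ₗ[A ⊗[k] Aᵐᵒᵖ] Z)
    (hfg : Function.Exact f g) (s : Z →+ Y)
    (hs : Commutes (Algebra.TensorProduct.includeRight : Aᵐᵒᵖ →ₐ[k] A ⊗[k] Aᵐᵒᵖ).toRingHom s)
    (hgs : ∀ y, g (s (g y)) = g y) {t : Bim k A Y ⊗[k] M}
    (ht : lmap g t ∈ balancedRel k A M Z) :
    ∃ u : Bim k A X ⊗[k] M, t - lmap f u ∈ balancedRel k A M Y := by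
  have key : ∀ t : Bim k A Y ⊗[k] M, ∃ u : Bim k A X ⊗[k] M,
      t - rmap s hs (lmap g t) = lmap f u := by
    intro t
    induction t using TensorProduct.induction_on with
    | zero => exact ⟨0, by simp⟩
    | add t t' ht ht' =>
      obtain ⟨u, hu⟩ := ht
      obtain ⟨u', hu'⟩ := ht'
      exact ⟨u + u', by rw [map_add, map_add, map_add, ← hu, ← hu']; abel⟩
    | tmul y m =>
      obtain ⟨x, hx⟩ := (hfg (@HSub.hSub Y Y Y _ y (s (g y)))).1 ((map_sub g _ _).trans (sub_eq_zero.2 (hgs y).symm))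
      refine ⟨(show Bim k A X from x) ⊗ₜ m, ?_⟩
      change y ⊗ₜ[k] m - (show Bim k A Y from s (g y)) ⊗ₜ[k] m = (show Bim k A Y from f x) ⊗ₜ[k] m
      rw [← TensorProduct.sub_tmul]
      exact congrArg (fun z : Bim k A Y => z ⊗ₜ[k] m) hx.symm
  obtain ⟨u, hu⟩ := key t
  refine ⟨u, ?_⟩
  rw [← hu, sub_sub_cancel]
  exact rmap_mem s hs ht

variable (k A M) in
/-- The tensor product `X ⊗_A M`. -/
abbrev BTensor (X : Type u) [AddCommGroup X] [Module (A ⊗[k] Aᵐᵒᵖ) X] : Type u :=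
  (Bim k A X ⊗[k] M) ⧸ balancedRel k A M X

variable (k A M) in
/-- The linear maps over `k` as a bimodule. -/
@[reducible]
noncomputable def homEnv (N : Type u) [AddCommGroup N] [Module A N] [Module k N]
    [IsScalarTower k A N] : Module (A ⊗[k] Aᵐᵒᵖ) (M →ₗ[k] N) :=
  letI : SMulCommClass k A N := IsScalarTower.to_smulCommClass
  letI : Module Aᵐᵒᵖ (M →ₗ[k] N) :=
    { smul := fun a f => f ∘ₗ Algebra.lsmul k k M a.unop
      one_smul := fun f => by ext m; exact congrArg f (one_smul A m)
      mul_smul := fun a b f => by ext m; exact congrArg f (mul_smul b.unop a.unop m)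
      smul_zero := fun a => rfl
      smul_add := fun a f g => rfl
      add_smul := fun a b f => by
        ext m
        exact (congrArg f (add_smul a.unop b.unop m)).trans (f.map_add _ _)
      zero_smul := fun f => by ext m; exact (congrArg f (zero_smul A m)).trans f.map_zero }
  letI : IsScalarTower k Aᵐᵒᵖ (M →ₗ[k] N) := ⟨fun c a f => by
    ext m
    exact (congrArg f (smul_assoc c a.unop m)).trans (f.map_smul _ _)⟩
  letI : IsScalarTower k A (M →ₗ[k] N) := ⟨fun c a f => by
    ext m
    exact smul_assoc c a (f m)⟩
  letI : SMulCommClass A Aᵐᵒᵖ (M →ₗ[k] N) := ⟨fun a b f => rfl⟩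
  TensorProduct.Algebra.module

theorem homEnv_smul (N : Type u) [AddCommGroup N] [Module A N] [Module k N]
    [IsScalarTower k A N] (a : A) (b : Aᵐᵒᵖ) (f : M →ₗ[k] N) (m : M) :
    letI := homEnv k A M N
    ((a ⊗ₜ[k] b) • f) m = a • f (b.unop • m) := rfl

/-- An additive map that is compatible with the action of pure tensors is linear. -/
def linearOfTmul {A' : Type*} [Ring A'] [Algebra k A'] {X Y : Type*} [AddCommGroup X]
    [AddCommGroup Y] [Module (A ⊗[k] A') X]
    [Module (A ⊗[k] A') Y] (f : X →+ Y)
    (hf : ∀ (a : A) (b : A') (x : X), f ((a ⊗ₜ[k] b) • x) = (a ⊗ₜ[k] b) • f x) : X →ₗ[A ⊗[k] A'] Y where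
  toFun := f
  map_add' := f.map_add
  map_smul' r x := by
    induction r using TensorProduct.induction_on with
    | zero => rw [RingHom.id_apply, zero_smul (A ⊗[k] A') x, zero_smul (A ⊗[k] A'), map_zero]
    | add r s hr hs =>
      rw [RingHom.id_apply] at hr hs ⊢
      rw [add_smul, add_smul, map_add, hr, hs]
    | tmul a b => exact hf a b x

/-- By adjunction, maps of `A`-modules from `X ⊗_A M` to `N` are bimodule maps from `X` to `Hom_k(M,
N)`, and `Hom_k(M, -)` preserves surjections because `k` is a field. -/
theorem projective_bTensor [Module.Projective (A ⊗[k] Aᵐᵒᵖ) X] :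
    Module.Projective A (BTensor k A M X) := by
  refine Module.Projective.of_lifting_property'' fun f hf => ?_
  let T := BTensor k A M X
  let F := T →₀ A
  have : SMulCommClass k A F := IsScalarTower.to_smulCommClass
  have : SMulCommClass k A T := IsScalarTower.to_smulCommClass
  let _ := homEnv k A M F
  let _ := homEnv k A M T
  let η : X →ₗ[A ⊗[k] Aᵐᵒᵖ] (M →ₗ[k] T) := linearOfTmul
    { toFun := fun x => ((balancedRel k A M X).mkQ.restrictScalars k) ∘ₗ
        TensorProduct.mk k (Bim k A X) M x
      map_zero' := by
        ext m
        exact (congrArg (balancedRel k A M X).mkQ (TensorProduct.zero_tmul _ m)).trans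
          (map_zero _)
      map_add' := fun x y => by
        ext m
        exact congrArg (balancedRel k A M X).mkQ (TensorProduct.add_tmul (R := k)
          (show Bim k A X from x) (show Bim k A X from y) m) }
    fun a b x => by
      ext m
      have h1 : (balancedRel k A M X).mkQ ((b • (show Bim k A X from x)) ⊗ₜ[k] m) =
          (balancedRel k A M X).mkQ ((show Bim k A X from x) ⊗ₜ[k] (b.unop • m)) :=
        (Submodule.Quotient.eq _).2 (Submodule.subset_span ⟨x, b.unop, m, rfl⟩)
      change (balancedRel k A M X).mkQ ((show Bim k A X from (a ⊗ₜ[k] b) • x) ⊗ₜ[k] m) =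
        a • (balancedRel k A M X).mkQ ((show Bim k A X from x) ⊗ₜ[k] (b.unop • m))
      rw [← h1, ← map_smul, TensorProduct.smul_tmul', bim_smul_smul]
  let Φ : (M →ₗ[k] F) →ₗ[A ⊗[k] Aᵐᵒᵖ] (M →ₗ[k] T) := linearOfTmul
    { toFun := fun g => f.restrictScalars k ∘ₗ g
      map_zero' := LinearMap.comp_zero _
      map_add' := fun g g' => LinearMap.comp_add _ _ _ }
    fun a b g => by
      ext m
      exact f.map_smul a (g (b.unop • m))
  have hΦ : Function.Surjective Φ := by
    intro g
    obtain ⟨s, hs⟩ := (f.restrictScalars k).exists_rightInverse_of_surjective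
      (LinearMap.range_eq_top.2 hf)
    exact ⟨s ∘ₗ g, by
      ext m
      exact LinearMap.congr_fun hs (g m)⟩
  obtain ⟨h, hh⟩ := Module.projective_lifting_property Φ η hΦ
  let B : Bim k A X →ₗ[A] M →ₗ[k] F :=
    { toFun := fun x => h x
      map_add' := h.map_add
      map_smul' := fun a x => by
        have := h.map_smul (a ⊗ₜ[k] (1 : Aᵐᵒᵖ)) x
        refine this.trans ?_
        ext1 m
        rw [homEnv_smul, MulOpposite.unop_one, one_smul]
        rfl }
  refine ⟨(balancedRel k A M X).liftQ (TensorProduct.AlgebraTensorModule.lift B)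
    (Submodule.span_le.2 ?_), ?_⟩
  · rintro _ ⟨x, a, m, rfl⟩
    change TensorProduct.AlgebraTensorModule.lift B _ = 0
    rw [map_sub, sub_eq_zero]
    have := LinearMap.congr_fun (h.map_smul ((1 : A) ⊗ₜ[k] MulOpposite.op a) x) m
    rw [homEnv_smul, one_smul] at this
    exact this
  · refine LinearMap.ext fun t => ?_
    obtain ⟨t, rfl⟩ := Submodule.mkQ_surjective _ t
    change f (TensorProduct.AlgebraTensorModule.lift B t) = (balancedRel k A M X).mkQ t
    induction t using TensorProduct.induction_on with
    | zero => rw [map_zero, map_zero, map_zero]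
    | add s t hs ht => rw [map_add, map_add, map_add, hs, ht]
    | tmul x m => exact LinearMap.congr_fun (LinearMap.congr_fun hh x) m

attribute [local instance] leftEnvModule

variable (k A) in
/-- The right multiplications, inside the enveloping algebra. -/
noncomputable abbrev rightMul : Aᵐᵒᵖ →+* A ⊗[k] Aᵐᵒᵖ :=
  (Algebra.TensorProduct.includeRight : Aᵐᵒᵖ →ₐ[k] A ⊗[k] Aᵐᵒᵖ).toRingHom

theorem projectiveOver_rightMul_env : ProjectiveOver (rightMul k A) (A ⊗[k] Aᵐᵒᵖ) := by
  let _ := Module.compHom (A ⊗[k] Aᵐᵒᵖ) (rightMul k A)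
  let e := Algebra.TensorProduct.comm k Aᵐᵒᵖ A
  refine Module.Projective.of_equiv' (R := Aᵐᵒᵖ) (M := Aᵐᵒᵖ ⊗[k] A)
    { e with map_smul' := fun c t => ?_ }
  change e (c • t) = (1 : A) ⊗ₜ[k] c * e t
  induction t using TensorProduct.induction_on with
  | zero => simp
  | add s t hs ht => rw [smul_add, map_add, map_add, mul_add, hs, ht]
  | tmul a b =>
    change e ((c * a) ⊗ₜ b) = 1 ⊗ₜ c * e (a ⊗ₜ b)
    simp [e]

theorem projectiveOver_rightMul_self : ProjectiveOver (rightMul k A) A := by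
  let _ := Module.compHom A (rightMul k A)
  refine Module.Projective.of_equiv' (R := Aᵐᵒᵖ) (M := Aᵐᵒᵖ)
    { (MulOpposite.opAddEquiv (α := A)).symm with map_smul' := fun c t => ?_ }
  change (c * t).unop = ((1 : A) ⊗ₜ[k] MulOpposite.op c.unop) • t.unop
  rw [leftEnv_smul, one_mul, MulOpposite.unop_mul]

variable (M) in
/-- The map `x ⊗ m ↦ f x • m`. -/
noncomputable def mulMap (f : X →ₗ[A ⊗[k] Aᵐᵒᵖ] A) :
    Bim k A X ⊗[k] M →ₗ[A] M :=
  letI : SMulCommClass A k M := IsScalarTower.to_smulCommClass'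
  TensorProduct.AlgebraTensorModule.lift
    { toFun := fun x =>
        { toFun := fun m => f x • m
          map_add' := fun m m' => smul_add _ _ _
          map_smul' := fun c m => smul_comm _ _ _ }
      map_add' := fun x y => by
        ext m
        exact (congrArg (· • m) (f.map_add x y)).trans (add_smul _ _ _)
      map_smul' := fun a x => by
        ext m
        have h := f.map_smul (a ⊗ₜ[k] (1 : Aᵐᵒᵖ)) x
        rw [← MulOpposite.op_one, leftEnv_smul, mul_one] at h
        exact (congrArg (· • m) h).trans (mul_smul a (f x) m) }

theorem mulMap_rel (f : X →ₗ[A ⊗[k] Aᵐᵒᵖ] A) {t : Bim k A X ⊗[k] M}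
    (ht : t ∈ balancedRel k A M X) : mulMap M f t = 0 := by
  refine balancedRel_induction (p := fun t => mulMap M f t = 0) (map_zero _) ?_ ?_ ht
  · intro s t hs ht
    rw [map_add, hs, ht, add_zero]
  · intro x a m
    have h := f.map_smul ((1 : A) ⊗ₜ[k] MulOpposite.op a) x
    rw [leftEnv_smul, one_mul] at h
    rw [map_sub, sub_eq_zero]
    exact (congrArg (· • m) h).trans (mul_smul (f x) a m)

/-- Injectivity of `A ⊗_A M → M`: modulo the relations, `a ⊗ m` is `1 ⊗ a m`. -/
theorem mem_balancedRel_of_mulMap {t : Bim k A A ⊗[k] M}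
    (ht : mulMap M (LinearMap.id : A →ₗ[A ⊗[k] Aᵐᵒᵖ] A) t = 0) : t ∈ balancedRel k A M A := by
  have key : ∀ t : Bim k A A ⊗[k] M, t - (show Bim k A A from (1 : A)) ⊗ₜ[k]
      mulMap M (LinearMap.id : A →ₗ[A ⊗[k] Aᵐᵒᵖ] A) t ∈ balancedRel k A M A := by
    intro t
    induction t using TensorProduct.induction_on with
    | zero =>
      rw [map_zero, TensorProduct.tmul_zero, sub_zero]
      exact zero_mem _
    | add s t hs ht =>
      rw [map_add, TensorProduct.tmul_add, add_sub_add_comm]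
      exact add_mem hs ht
    | tmul a m =>
      refine Submodule.subset_span ⟨(1 : A), a, m, ?_⟩
      have h : (MulOpposite.op (show A from a) • (show Bim k A A from (1 : A)) : Bim k A A) = a := by
        have := leftEnv_smul k A 1 (show A from a) (1 : A)
        rw [one_mul, one_mul] at this
        exact this
      exact congrArg (fun z : Bim k A A => z ⊗ₜ[k] m - _) h.symm
  have := key t
  rwa [ht, TensorProduct.tmul_zero, sub_zero] at this

/-- The tensor product with `M` of a resolution of the bimodule `A` is a resolution of `M`. -/
theorem Res.exists_tensor (P : Res (A ⊗[k] Aᵐᵒᵖ) A) :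
    ∃ Q : Res A M, ∀ n, Subsingleton (P.X n) → Subsingleton (Q.X n) := by
  let D : ∀ n, BTensor k A M (P.X (n + 1)) →ₗ[A] BTensor k A M (P.X n) := fun n =>
    Submodule.mapQ _ _ (lmap (P.d n)) fun t => lmap_mem (P.d n)
  let E : BTensor k A M (P.X 0) →ₗ[A] M := Submodule.liftQ _ (mulMap M P.ε)
    fun t => mulMap_rel P.ε
  -- Factoring the augmentation through `A ⊗ M` makes exactness at the end an instance of
  -- `exact_lmap`.
  have hE : ∀ t, mulMap M P.ε t = mulMap M LinearMap.id (lmap P.ε t) := by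
    intro t
    induction t using TensorProduct.induction_on with
    | zero => rw [map_zero, map_zero, map_zero]
    | add s t hs ht => rw [map_add, map_add, map_add, hs, ht]
    | tmul x m => rfl
  have hcomp : ∀ {X Y Z : Type u} [AddCommGroup X] [Module (A ⊗[k] Aᵐᵒᵖ) X] [AddCommGroup Y]
      [Module (A ⊗[k] Aᵐᵒᵖ) Y] [AddCommGroup Z] [Module (A ⊗[k] Aᵐᵒᵖ) Z]
      (f : X →ₗ[A ⊗[k] Aᵐᵒᵖ] Y) (g : Y →ₗ[A ⊗[k] Aᵐᵒᵖ] Z) (h : ∀ x, g (f x) = 0)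
      (t : Bim k A X ⊗[k] M), lmap g (lmap f t) = 0 := by
    intro X Y Z _ _ _ _ _ _ f g h t
    induction t using TensorProduct.induction_on with
    | zero => rw [map_zero, map_zero]
    | add s t hs ht => rw [map_add, map_add, hs, ht, add_zero]
    | tmul x m =>
      exact (congrArg (fun z : Bim k A Z => z ⊗ₜ[k] m) (h x)).trans (TensorProduct.zero_tmul _ _)
  refine ⟨{ X := fun n => ModuleCat.of A (BTensor k A M (P.X n))
            d := D
            ε := E
            projective := fun n => by
              have := P.projective n
              exact projective_bTensor
            surjective := fun m => ?_
            exact_zero := fun x => ?_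
            exact_succ := fun n x => ?_ }, fun n h => ?_⟩
  · obtain ⟨x, hx⟩ := P.surjective 1
    refine ⟨Submodule.Quotient.mk ((show Bim k A (P.X 0) from x) ⊗ₜ[k] m), ?_⟩
    change P.ε x • m = m
    rw [hx, one_smul]
  · obtain ⟨t, rfl⟩ := Submodule.mkQ_surjective _ x
    constructor
    · intro ht
      replace ht : mulMap M P.ε t = 0 := ht
      rw [hE] at ht
      obtain ⟨s, hs, hεs⟩ := P.exists_splitting_zero (rightMul k A) projectiveOver_rightMul_env
        projectiveOver_rightMul_self
      obtain ⟨u, hu⟩ := exact_lmap (P.d 0) P.ε P.exact_zero s hs (fun y => hεs _)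
        (mem_balancedRel_of_mulMap ht)
      exact ⟨Submodule.Quotient.mk u, ((Submodule.Quotient.eq _).2 hu).symm⟩
    · rintro ⟨y, hy⟩
      obtain ⟨u, rfl⟩ := Submodule.mkQ_surjective _ y
      rw [← hy]
      change mulMap M P.ε (lmap (P.d 0) u) = 0
      rw [hE, hcomp _ _ P.ε_d, map_zero]
  · obtain ⟨t, rfl⟩ := Submodule.mkQ_surjective _ x
    constructor
    · intro ht
      obtain ⟨s, hs, hds⟩ := P.exists_splitting (rightMul k A) projectiveOver_rightMul_env
        projectiveOver_rightMul_self n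
      obtain ⟨u, hu⟩ := exact_lmap (P.d (n + 1)) (P.d n) (P.exact_succ n) s hs hds
        ((Submodule.Quotient.mk_eq_zero _).1 ht)
      exact ⟨Submodule.Quotient.mk u, ((Submodule.Quotient.eq _).2 hu).symm⟩
    · rintro ⟨y, hy⟩
      obtain ⟨u, rfl⟩ := Submodule.mkQ_surjective _ y
      rw [← hy]
      change Submodule.mkQ _ (lmap (P.d n) (lmap (P.d (n + 1)) u)) = 0
      rw [hcomp _ _ (P.d_d n), map_zero]
  · have : Subsingleton (Bim k A (P.X n)) := h
    have : Subsingleton (Bim k A (P.X n) ⊗[k] M) := inferInstance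
    exact (Submodule.mkQ_surjective (balancedRel k A M (P.X n))).subsingleton

end
end Tensor

open CategoryTheory in
theorem Res.hasProjectiveDimensionLT {R : Type u} [Ring R] {M : Type u} [AddCommGroup M]
    [Module R M] (P : Res R M) {n : ℕ} (h : ∀ i, n < i → Subsingleton (P.X i)) :
    HasProjectiveDimensionLT (ModuleCat.of R M) (n + 1) := by
  rw [hasProjectiveDimensionLT_iff]
  intro i hi Y e
  obtain ⟨i, rfl⟩ := Nat.exists_eq_add_of_le' (show 1 ≤ i by omega)
  have := h (i + 1) (by omega)
  have := (P.subsingleton_ext_succ_iff (N := Y) i).2 fun f _ =>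
    ⟨0, LinearMap.ext fun x => by rw [Subsingleton.elim x 0, map_zero, map_zero]⟩
  exact Subsingleton.elim (α := Abelian.Ext (ModuleCat.of R M) (ModuleCat.of R Y) (i + 1)) e 0

section Dual

variable {R : Type u} [Ring R] {𝓡 : ℤ → AddSubgroup R} [GradedRing 𝓡]

/-! ### Coordinate functions and dual bases -/

/-- An element of the graded dual as a linear form. -/
def dval {P : GrMod 𝓡} : (gradedHom P (regular 𝓡)).carrier →+ (P.carrier →ₗ[R] R) where
  toFun f := f.1
  map_zero' := rfl
  map_add' _ _ := rfl

theorem dval_injective {P : GrMod 𝓡} : Function.Injective (dval (P := P)) :=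
  fun _ _ h => Subtype.ext h

namespace GrMod.HBasis

variable {P : GrMod 𝓡} {ι : Type*} (B : HBasis P ι)

/-- The coordinate functions with respect to a homogeneous basis. -/
noncomputable def coord (v : ι) : (gradedHom P (regular 𝓡)).carrier :=
  ⟨B.b.coord v, AddSubgroup.mem_iSup_of_mem (-B.e v) fun _ _ hx => B.mem_deg_iff.1 hx v⟩

theorem coord_mem (v : ι) : B.coord v ∈ (gradedHom P (regular 𝓡)).deg (-B.e v) :=
  fun _ _ hx => B.mem_deg_iff.1 hx v

@[simp] theorem dval_coord (v : ι) (x : P.carrier) : dval (B.coord v) x = B.b.repr x v := rfl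

theorem dval_sum_coord (s : Finset ι) (c : ι → Rᵐᵒᵖ) (x : P.carrier) :
    dval (∑ v ∈ s, c v • B.coord v) x = ∑ v ∈ s, B.b.repr x v * (c v).unop := by
  rw [map_sum, LinearMap.sum_apply]
  rfl

theorem sum_coord [Fintype ι] (f : (gradedHom P (regular 𝓡)).carrier) :
    f = ∑ v, MulOpposite.op (dval f (B.b v)) • B.coord v := by
  apply dval_injective
  ext x
  rw [B.dval_sum_coord]
  conv_lhs => rw [← B.b.sum_repr x, map_sum]
  exact Finset.sum_congr rfl fun v _ => (dval f).map_smul _ _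

variable [Finite ι]

/-- The coordinates on the graded dual given by a finite homogeneous basis. -/
noncomputable def dualEquiv : (gradedHom P (regular 𝓡)).carrier ≃ₗ[Rᵐᵒᵖ] (ι → Rᵐᵒᵖ) :=
  letI := Fintype.ofFinite ι
  { toFun := fun f v => MulOpposite.op (dval f (B.b v))
    map_add' := fun f g => rfl
    map_smul' := fun s f => rfl
    invFun := fun c => ∑ v, c v • B.coord v
    left_inv := fun f => (B.sum_coord f).symm
    right_inv := fun c => by
      classical
      funext w
      change MulOpposite.op (dval (∑ v, c v • B.coord v) (B.b w)) = c w
      rw [B.dval_sum_coord, Finset.sum_eq_single w]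
      · simp
      · intro v _ hv
        simp [Finsupp.single_eq_of_ne hv]
      · simp }

/-- The dual basis of a finite homogeneous basis. -/
noncomputable def dual : HBasis (gradedHom P (regular 𝓡)) ι where
  e v := -B.e v
  b := Module.Basis.ofEquivFun B.dualEquiv
  mem v := by
    classical
    rw [Module.Basis.coe_ofEquivFun]
    change B.dualEquiv.symm (Pi.single v 1) ∈ _
    have : B.dualEquiv.symm (Pi.single v 1) = B.coord v := by
      rw [LinearEquiv.symm_apply_eq]
      funext w
      refine MulOpposite.unop_injective ?_
      change _ = dval (B.coord v) (B.b w)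
      rw [dval_coord, Module.Basis.repr_self, Finsupp.single_apply, Pi.single_apply]
      split_ifs <;> rfl
    rw [this]
    exact B.coord_mem v

theorem dual_repr (f : (gradedHom P (regular 𝓡)).carrier) (v : ι) :
    B.dual.b.repr f v = MulOpposite.op (dval f (B.b v)) := rfl

end GrMod.HBasis

/-! ### The terms of minimal resolutions with concentrated dual -/

namespace Aug

variable {K : Type*} [Field K] (a : Aug 𝓡 K)

theorem hom_apply_of_mem_sub {P : GrMod 𝓡} (f : P.carrier →ₗ[R] R)
    {x : P.carrier} (hx : x ∈ a.sub P) : a.hom (f x) = 0 := by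
  induction hx using Submodule.span_induction with
  | mem x hx =>
    obtain ⟨r, m, hr, rfl⟩ := hx
    simp [hr]
  | zero => simp
  | add x y _ _ hx hy => simp [hx, hy]
  | smul r x _ hx => simp [hx]

variable {M : GrMod 𝓡} {P : ProjRes M} (hd : ∀ n x, (P.d n).toLin x ∈ a.sub (P.X n))
include hd

/-- A coboundary is `g ∘ d`, and `d` has values in `R₊P` by minimality. -/
theorem hom_coboundary {n : ℕ} {c : (gradedHom (P.X n) (regular 𝓡)).carrier}
    (hc : c ∈ P.coboundaries (regular 𝓡) n) (x : (P.X n).carrier) : a.hom (dval c x) = 0 := by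
  cases n with
  | zero =>
    rw [ProjRes.mem_coboundaries_zero] at hc
    rw [hc, map_zero, LinearMap.zero_apply, map_zero]
  | succ n =>
    obtain ⟨g, hg⟩ := (ProjRes.mem_coboundaries_succ _).1 hc
    have : dval c x = dval g ((P.d n).toLin x) := (hg x).symm
    rw [this]
    exact a.hom_apply_of_mem_sub _ (hd _ _)

theorem coord_notMem_coboundaries {n : ℕ} {ι : Type*} (B : GrMod.HBasis (P.X n) ι) (v : ι) :
    B.coord v ∉ P.coboundaries (regular 𝓡) n := by
  intro h
  have h1 := a.hom_coboundary hd h (B.b v)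
  simp at h1

variable {n : ℕ} {E : GrMod (opGrading 𝓡)}
  {ψ : P.cocycles (regular 𝓡) n →ₗ[Rᵐᵒᵖ] E.carrier}
  (hψ : P.Concentrated (regular 𝓡) n E ψ) {ι : ℕ → Type*}
  (B : ∀ i, GrMod.HBasis (P.X i) (ι i))
include hψ B

/-- Descending induction: when the next term vanishes every cochain is a cocycle, hence for `i > n`
a coboundary, which a coordinate function is not. The basis is therefore empty. -/
theorem subsingleton_of_bounded {m : ℕ} (hm : ∀ i, m < i → Subsingleton (P.X i).carrier) :
    ∀ i, n < i → Subsingleton (P.X i).carrier := by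
  have key : ∀ l i, n < i → m < i + l → Subsingleton (P.X i).carrier := by
    intro l
    induction l with
    | zero => exact fun i _ hi => hm i hi
    | succ l ih =>
      intro i hi hl
      have := ih (i + 1) (by omega) (by omega)
      have : IsEmpty (ι i) := ⟨fun v => by
        refine a.coord_notMem_coboundaries hd (B i) v (hψ.exact i hi.ne' ?_)
        rw [ProjRes.mem_cocycles]
        intro x
        rw [Subsingleton.elim x 0, map_zero, map_zero]⟩
      exact (B i).b.repr.injective.subsingleton
  exact fun i hi => key (m + 1) i hi (by omega)

/-- The differentials of the finitely many basis elements in degree `i + 1` involve finitely many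
`v`. For any other `v` the coordinate function would be a cocycle, hence a coboundary. -/
theorem finite_of_succ {i : ℕ} (hi : i ≠ n) [Finite (ι (i + 1))] : Finite (ι i) := by
  classical
  have hfin : (⋃ w : ι (i + 1), (((B i).b.repr ((P.d i).toLin ((B (i + 1)).b w))).support :
      Set (ι i))).Finite := Set.finite_iUnion fun w => Finset.finite_toSet _
  refine Set.finite_univ_iff.1 (hfin.subset ?_)
  rintro v -
  by_contra hv
  refine a.coord_notMem_coboundaries hd (B i) v (hψ.exact i hi ?_)
  rw [ProjRes.mem_cocycles]
  intro x
  have : dval ((B i).coord v) ∘ₗ (P.d i).toLin = 0 := by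
    refine (B (i + 1)).b.ext fun w => ?_
    by_contra hw
    exact hv (Set.mem_iUnion.2 ⟨w, Finsupp.mem_support_iff.2 hw⟩)
  exact LinearMap.congr_fun this x

/-- In top degree all cochains are cocycles, so modulo coboundaries each coordinate function is a
multiple of one form `f`. Over the residue field all of them become proportional, which two distinct
coordinates are not. -/
theorem subsingleton_basis_top {g : E.carrier} (hg : ∀ y, ∃ s : Rᵐᵒᵖ, y = s • g)
    [Subsingleton (P.X (n + 1)).carrier] : Subsingleton (ι n) := by
  have hcoc : ∀ c : (gradedHom (P.X n) (regular 𝓡)).carrier, c ∈ P.cocycles (regular 𝓡) n := by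
    intro c
    rw [ProjRes.mem_cocycles]
    intro x
    rw [Subsingleton.elim x 0, map_zero, map_zero]
  obtain ⟨f, rfl⟩ := hψ.surjective g
  have key : ∀ v, ∃ s : K, ∀ x, a.hom (dval ((B n).coord v) x) = a.hom (dval f.1 x) * s := by
    intro v
    obtain ⟨s, hs⟩ := hg (ψ ⟨(B n).coord v, hcoc _⟩)
    rw [← map_smul, ← sub_eq_zero, ← map_sub, hψ.eq_zero_iff] at hs
    refine ⟨a.hom s.unop, fun x => ?_⟩
    have h := a.hom_coboundary hd hs x
    have h1 : a.hom (dval ((B n).coord v) x - dval f.1 x * s.unop) = 0 := h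
    rw [map_sub, map_mul, sub_eq_zero] at h1
    exact h1
  refine ⟨fun v w => ?_⟩
  by_contra hvw
  obtain ⟨s, hs⟩ := key v
  obtain ⟨t, ht⟩ := key w
  have h1 := hs ((B n).b v)
  have h2 := ht ((B n).b w)
  have h3 := ht ((B n).b v)
  rw [(B n).dval_coord, Module.Basis.repr_self, Finsupp.single_eq_same, map_one] at h1 h2
  rw [(B n).dval_coord, Module.Basis.repr_self, Finsupp.single_eq_of_ne (Ne.symm hvw),
    map_zero] at h3
  have h4 : a.hom (dval f.1 ((B n).b v)) ≠ 0 := left_ne_zero_of_mul (h1 ▸ one_ne_zero)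
  have h5 : t ≠ 0 := right_ne_zero_of_mul (h2 ▸ one_ne_zero)
  exact mul_ne_zero h4 h5 h3.symm

end Aug
end Dual
section Duality

variable {R : Type u} [Ring R] {𝓡 : ℤ → AddSubgroup R} [GradedRing 𝓡]
variable {S : Type u} [Ring S] {𝓢 : ℤ → AddSubgroup S} [GradedRing 𝓢]
variable {K : Type*} [Field K]

/-! ### Minimality -/

/-- The bound on the generators may depend on `n`: for dual resolutions it comes from the finiteness
of each basis. -/
theorem Aug.isMinimal (a : Aug 𝓡 K) {M : GrMod 𝓡} {P : ProjRes M} {ι : ℕ → Type*}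
    (B : ∀ n, GrMod.HBasis (P.X n) (ι n)) (hB : ∀ n, ∃ c, ∀ j, c ≤ (B n).e j)
    (hd : ∀ n x, (P.d n).toLin x ∈ a.sub (P.X n)) : P.IsMinimal := by
  constructor
  · obtain ⟨c, hc⟩ := hB 0
    refine a.isSuperfluous (a.bounded_of_hbasis (B 0) hc) fun x hx => ?_
    obtain ⟨y, rfl⟩ := (P.exact_zero x).1 hx
    exact hd 0 y
  · intro n
    obtain ⟨c, hc⟩ := hB (n + 1)
    refine a.isSuperfluous (a.bounded_of_hbasis (B (n + 1)) hc) fun x hx => ?_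
    obtain ⟨y, rfl⟩ := (P.exact_succ n x).1 hx
    exact hd (n + 1) y

theorem exists_bound {ι : Type*} [Finite ι] (e : ι → ℤ) : ∃ c, ∀ j, c ≤ e j := by
  obtain ⟨c, hc⟩ := (Set.finite_range e).bddBelow
  exact ⟨c, fun j => hc ⟨j, rfl⟩⟩

/-! ### The dual resolution -/

namespace ProjRes

variable {M : GrMod 𝓡} (P : ProjRes M)

/-- The differential between two terms, zero unless the indices are consecutive. -/
def dd (a b : ℕ) : GrMod.Hom (P.X a) (P.X b) :=
  if h : a = b + 1 then h ▸ P.d b else GrMod.Hom.zero _ _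

/-- Indices of dual terms are computed by subtraction and are consecutive only propositionally; `dd`
is defined for all pairs to avoid casts in the dual complex. -/
theorem dd_succ (b : ℕ) : P.dd (b + 1) b = P.d b := by simp [dd]

theorem dd_mem_sub (a : Aug 𝓡 K) (hd : ∀ n x, (P.d n).toLin x ∈ a.sub (P.X n)) (i j : ℕ)
    (x : (P.X i).carrier) : (P.dd i j).toLin x ∈ a.sub (P.X j) := by
  by_cases h : i = j + 1
  · subst h
    rw [dd_succ]
    exact hd j x
  · rw [dd, dif_neg h]
    exact zero_mem _

/-- The index of the term of a resolution whose dual is in degree `i` of the dual complex. -/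
def dualIdx (n i : ℕ) : ℕ := if i ≤ n then n - i else n + 1

theorem dualIdx_of_add {n i j : ℕ} (h : i + j = n) : dualIdx n i = j := by
  rw [dualIdx, if_pos (by omega)]
  omega

/-- The default index `n + 1` points to a term that vanishes in the applications, so the dual
complex is zero beyond `n`. -/
theorem dualIdx_of_lt {n i : ℕ} (h : n < i) : dualIdx n i = n + 1 := if_neg (by omega)

/-- The dual of a differential. -/
noncomputable def dualMap (i j : ℕ) : GrMod.Hom (gradedHom (P.X j) (regular 𝓡)) (gradedHom (P.X i) (regular 𝓡)) :=
  gradedHomMap (P.dd i j) (regular 𝓡)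

/-- The isomorphism between the duals of terms of the same index. -/
noncomputable def castIso {i j : ℕ} (h : i = j) :
    GrMod.Iso (gradedHom (P.X i) (regular 𝓡)) (gradedHom (P.X j) (regular 𝓡)) :=
  h ▸ GrMod.Iso.refl _

theorem castIso_d {i i' j : ℕ} (h : i = j + 1) (h' : i' = j)
    (x : (gradedHom (P.X i') (regular 𝓡)).carrier) :
    (P.castIso h).toEquiv ((P.dualMap i i').toLin x) =
      (gradedHomMap (P.d j) (regular 𝓡)).toLin ((P.castIso h').toEquiv x) := by
  subst h h'
  rw [dualMap, dd_succ]
  rfl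

theorem dval_dualMap (i j : ℕ) (f : (gradedHom (P.X j) (regular 𝓡)).carrier)
    (x : (P.X i).carrier) : dval ((P.dualMap i j).toLin f) x = dval f ((P.dd i j).toLin x) := rfl

variable {P}

/-- The second alternative is the end of the dual complex: the middle term is the dual of `P.X 0`,
the incoming one is zero, and exactness says that there are no nonzero cocycles in degree 0. -/
theorem Concentrated.exact_dualMap {n : ℕ} {E : GrMod (opGrading 𝓡)}
    {ψ : P.cocycles (regular 𝓡) n →ₗ[Rᵐᵒᵖ] E.carrier}
    (hψ : P.Concentrated (regular 𝓡) n E ψ) {i j l : ℕ} (hj : j ≠ n) (hl : l = j + 1)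
    (hi : j = i + 1 ∨ j = 0 ∧ i ≠ 0 ∧ Subsingleton (P.X i).carrier) :
    Function.Exact (P.dualMap j i).toLin (P.dualMap l j).toLin := by
  subst hl
  have h0 : P.dualMap (j + 1) j = gradedHomMap (P.d j) (regular 𝓡) := by
    rw [dualMap, dd_succ]
  rw [h0]
  intro c
  have h1 : (gradedHomMap (P.d j) (regular 𝓡)).toLin c = 0 ↔ c ∈ P.cocycles (regular 𝓡) j :=
    Iff.rfl
  rw [h1]
  have h2 : c ∈ P.cocycles (regular 𝓡) j → c ∈ P.coboundaries (regular 𝓡) j :=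
    fun h => hψ.exact j hj h
  rcases hi with rfl | ⟨rfl, -, hi⟩
  · have h3 : P.dualMap (i + 1) i = gradedHomMap (P.d i) (regular 𝓡) := by
      rw [dualMap, dd_succ]
    rw [h3]
    refine ⟨h2, ?_⟩
    rintro ⟨f, rfl⟩
    rw [mem_cocycles]
    intro x
    change f.1 ((P.d i).toLin ((P.d (i + 1)).toLin x)) = 0
    rw [P.d_d, map_zero]
  · constructor
    · intro hc
      exact ⟨0, (map_zero _).trans (h2 hc).symm⟩
    · rintro ⟨f, rfl⟩
      have : (P.dualMap 0 i).toLin f = 0 := by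
        apply dval_injective
        ext x
        rw [dval_dualMap, Subsingleton.elim ((P.dd 0 i).toLin x) 0, map_zero]
        rfl
      rw [this]
      exact zero_mem _

/-- As `P.X (n + 1)` vanishes, all cochains of degree `n` are cocycles, and `ψ` itself is an
augmentation of the dual complex. -/
theorem Concentrated.exists_augmentation {n : ℕ} (hn : 1 ≤ n) {E : GrMod (opGrading 𝓡)}
    {ψ : P.cocycles (regular 𝓡) n →ₗ[Rᵐᵒᵖ] E.carrier}
    (hψ : P.Concentrated (regular 𝓡) n E ψ) [Subsingleton (P.X (n + 1)).carrier] {i j : ℕ}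
    (hi : i = n) (hj : j + 1 = n) : ∃ ε : GrMod.Hom (gradedHom (P.X i) (regular 𝓡)) E,
      Function.Surjective ε.toLin ∧ Function.Exact (P.dualMap i j).toLin ε.toLin := by
  subst hj hi
  have hcoc : ∀ c : (gradedHom (P.X (j + 1)) (regular 𝓡)).carrier,
      c ∈ P.cocycles (regular 𝓡) (j + 1) := by
    intro c
    rw [mem_cocycles]
    intro x
    rw [Subsingleton.elim x 0, map_zero, map_zero]
  refine ⟨⟨ψ ∘ₗ LinearMap.codRestrict _ LinearMap.id hcoc, fun {l x} hx => hψ.deg l _ hx⟩,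
    fun y => ?_, fun c => ?_⟩
  · obtain ⟨c, rfl⟩ := hψ.surjective y
    exact ⟨c.1, rfl⟩
  · have : P.dualMap (j + 1) j = gradedHomMap (P.d j) (regular 𝓡) := by
      rw [dualMap, dd_succ]
    rw [this]
    exact hψ.eq_zero_iff ⟨c, hcoc c⟩

theorem Concentrated.exists_dual {n : ℕ} (hn : 1 ≤ n) {E : GrMod (opGrading 𝓡)}
    {ψ : P.cocycles (regular 𝓡) n →ₗ[Rᵐᵒᵖ] E.carrier}
    (hψ : P.Concentrated (regular 𝓡) n E ψ) (h0 : ∀ i, n < i → Subsingleton (P.X i).carrier)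
    {ι : ℕ → Type u} (B : ∀ i, GrMod.HBasis (P.X i) (ι i)) [∀ i, Finite (ι i)] (a : Aug 𝓡 K)
    (hd : ∀ n x, (P.d n).toLin x ∈ a.sub (P.X n)) :
    ∃ (Q : ProjRes E) (κ : ℕ → Type u) (_ : ∀ i, GrMod.HBasis (Q.X i) (κ i)),
      (∀ i, Finite (κ i)) ∧ (∀ n x, (Q.d n).toLin x ∈ a.op.sub (Q.X n)) ∧ IsDual n P Q := by
  have hs := h0 (n + 1) (Nat.lt_succ_self n)
  obtain ⟨ε, hε, hex⟩ := hψ.exists_augmentation hn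
    (dualIdx_of_add (n := n) (i := 0) (j := n) (by omega))
    (show dualIdx n 1 + 1 = n by rw [dualIdx, if_pos hn]; omega)
  have hdual : ∀ i, n < i → Subsingleton (gradedHom (P.X (dualIdx n i)) (regular 𝓡)).carrier := by
    intro i hi
    rw [dualIdx_of_lt hi]
    refine ⟨fun f g => dval_injective (LinearMap.ext fun x => ?_)⟩
    rw [Subsingleton.elim x 0, map_zero, map_zero]
  let Q : ProjRes E :=
    { X := fun i => gradedHom (P.X (dualIdx n i)) (regular 𝓡)
      d := fun i => P.dualMap (dualIdx n i) (dualIdx n (i + 1))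
      ε := ε
      projective := fun i => (B (dualIdx n i)).dual.isProjective
      surjective := hε
      exact_zero := hex
      exact_succ := fun i => by
        rcases lt_trichotomy (i + 1) n with hi | hi | hi
        · refine hψ.exact_dualMap ?_ ?_ (Or.inl ?_)
          all_goals
            unfold dualIdx
            split_ifs <;> omega
        · refine hψ.exact_dualMap ?_ ?_ (Or.inr ⟨?_, ?_, ?_⟩)
          rotate_right
          · rw [dualIdx_of_lt (by omega)]
            exact hs
          all_goals
            unfold dualIdx
            split_ifs <;> omega
        · have := hdual (i + 1) hi
          intro x
          rw [Subsingleton.elim x 0, map_zero]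
          exact ⟨fun _ => ⟨0, map_zero _⟩, fun _ => rfl⟩ }
  refine ⟨Q, fun i => ι (dualIdx n i), fun i => (B (dualIdx n i)).dual, fun i => inferInstance,
    fun i x => ?_, h0, hdual, fun i j h => P.castIso (dualIdx_of_add h), fun i j h x => ?_⟩
  · refine (a.op.mem_sub_iff (B (dualIdx n i)).dual).2 fun v => ?_
    -- A dual coordinate of the differential of `x` is the value of `x` on the differential of a
    -- basis element: transposing keeps the entries in the augmentation ideal.
    exact a.hom_apply_of_mem_sub (dval x) (P.dd_mem_sub a hd (dualIdx n i) (dualIdx n (i + 1)) _)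
  · exact P.castIso_d _ _ x

/-! ### Biduality -/

/-- Evaluation identifies each finite free term of `P` with its bidual and turns `P.d` into the dual
of `Q.d`. The Ext computed with `Q` is thus the homology of `P`: zero except at the augmentation. -/
theorem _root_.GradedCY.IsDual.exists_concentrated {M : GrMod 𝓡} {M' : GrMod (opGrading 𝓡)} {n : ℕ}
    (hn : 1 ≤ n) {P : ProjRes M} {Q : ProjRes M'} (h : IsDual n P Q) {ι : ℕ → Type*}
    (B : ∀ i, GrMod.HBasis (P.X i) (ι i)) [∀ i, Finite (ι i)] :
    ∃ ψ, Q.Concentrated (regularOp 𝓡) n M ψ := by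
  obtain ⟨hP, hQ, θ, hθ⟩ := h
  let ev' : ∀ i j (hij : i + j = n), (P.X j).carrier → (Q.X i).carrier →ₗ[Rᵐᵒᵖ] (regularOp 𝓡).carrier :=
    fun i j hij x =>
      { toFun := fun q => dval ((θ i j hij).toEquiv q) x
        map_add' := fun q q' => by rw [map_add, map_add]; rfl
        map_smul' := fun s q => by rw [map_smul]; rfl }
  have hev' : ∀ i j (hij : i + j = n) l x, x ∈ (P.X j).deg l →
      ev' i j hij x ∈ homDeg (Q.X i) (regularOp 𝓡) l := by
    intro i j hij l x hx p q hq
    rw [add_comm]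
    exact ((θ i j hij).mem_iff p q).2 hq l x hx
  let ev : ∀ i j (hij : i + j = n), GrMod.Hom (P.X j) (gradedHom (Q.X i) (regularOp 𝓡)) :=
    fun i j hij =>
      { toLin :=
          { toFun := fun x => ⟨ev' i j hij x, by
              refine dinduction (P.X j).isInternal
                (p := fun x => ev' i j hij x ∈ gradedHomSubmodule (Q.X i) (regularOp 𝓡)) x
                (fun l x hx => AddSubgroup.mem_iSup_of_mem l (hev' i j hij l x hx)) ?_
              intro x y hx hy
              have : ev' i j hij (x + y) = ev' i j hij x + ev' i j hij y := by
                ext q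
                exact map_add (dval ((θ i j hij).toEquiv q)) x y
              rw [this]
              exact add_mem hx hy⟩
            map_add' := fun x y => Subtype.ext (by
              ext q
              exact map_add (dval ((θ i j hij).toEquiv q)) x y)
            map_smul' := fun r x => Subtype.ext (by
              ext q
              exact map_smul (dval ((θ i j hij).toEquiv q)) r x) }
        map_mem := fun {l x} hx => hev' i j hij l x hx }
  have hev : ∀ i j hij x q, ((ev i j hij).toLin x).1 q = dval ((θ i j hij).toEquiv q) x :=
    fun _ _ _ _ _ => rfl
  have hbij : ∀ i j hij, Function.Bijective (ev i j hij).toLin := by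
    intro i j hij
    have _ := Fintype.ofFinite (ι j)
    constructor
    · rw [injective_iff_map_eq_zero]
      intro x hx
      apply (B j).b.repr.injective
      ext v
      have h1 := hev i j hij x ((θ i j hij).toEquiv.symm ((B j).coord v))
      rw [hx, LinearEquiv.apply_symm_apply, GrMod.HBasis.dval_coord] at h1
      rw [map_zero]
      exact h1.symm
    · intro c
      let q : ι j → (Q.X i).carrier := fun v => (θ i j hij).toEquiv.symm ((B j).coord v)
      refine ⟨∑ v, (show R from c.1 (q v)) • (B j).b v, ?_⟩
      rw [ProjRes.gradedHom_ext_iff]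
      intro y
      rw [hev, map_sum]
      have h1 := (B j).sum_coord ((θ i j hij).toEquiv y)
      have h2 : y = ∑ v, MulOpposite.op (dval ((θ i j hij).toEquiv y) ((B j).b v)) • q v := by
        apply (θ i j hij).toEquiv.injective
        conv_lhs => rw [h1]
        rw [map_sum]
        refine Finset.sum_congr rfl fun v _ => ?_
        rw [map_smul, LinearEquiv.apply_symm_apply]
      conv_rhs => rw [h2]
      rw [map_sum]
      refine Finset.sum_congr rfl fun v _ => ?_
      rw [map_smul, map_smul]
      rfl
  have hcomm : ∀ i j (hij : i + 1 + j = n) x q,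
      ((ev i (j + 1) (by omega)).toLin x).1 ((Q.d i).toLin q) =
        ((ev (i + 1) j hij).toLin ((P.d j).toLin x)).1 q := by
    intro i j hij x q
    rw [hev, hev, hθ i j hij q]
    rfl
  let Ev := (ev n 0 (add_zero n)).toIso (hbij n 0 _)
  have hEv : ∀ x, Ev.toEquiv x = (ev n 0 (add_zero n)).toLin x := fun _ => rfl
  -- Degree `n` for the dual of `Q` is degree 0 for `P`, where the cokernel is read off by `P.ε`.
  refine ⟨P.ε.toLin ∘ₗ Ev.symm.toEquiv.toLinearMap ∘ₗ Submodule.subtype _, ?_, ?_, ?_, ?_⟩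
  · intro m
    obtain ⟨x, rfl⟩ := P.surjective m
    refine ⟨⟨Ev.toEquiv x, ?_⟩, ?_⟩
    · rw [ProjRes.mem_cocycles]
      intro y
      have := hQ (n + 1) (Nat.lt_succ_self n)
      rw [Subsingleton.elim y 0, map_zero, map_zero]
    · change P.ε.toLin (Ev.toEquiv.symm (Ev.toEquiv x)) = _
      rw [LinearEquiv.symm_apply_apply]
  · rintro ⟨c, hc⟩
    obtain ⟨x, rfl⟩ := Ev.toEquiv.surjective c
    change P.ε.toLin (Ev.toEquiv.symm (Ev.toEquiv x)) = 0 ↔ Ev.toEquiv x ∈ _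
    rw [LinearEquiv.symm_apply_apply]
    obtain ⟨m, rfl⟩ := Nat.exists_eq_add_of_le' hn
    rw [ProjRes.mem_coboundaries_succ]
    constructor
    · intro hx
      obtain ⟨y, rfl⟩ := (P.exact_zero x).1 hx
      exact ⟨(ev m 1 rfl).toLin y, fun q => hcomm m 0 rfl y q⟩
    · rintro ⟨g, hg⟩
      obtain ⟨y, rfl⟩ := (hbij m 1 rfl).2 g
      have : x = (P.d 0).toLin y := by
        apply (hbij (m + 1) 0 rfl).1
        rw [ProjRes.gradedHom_ext_iff]
        intro q
        exact (hg q).symm.trans (hcomm m 0 rfl y q)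
      rw [this, P.ε_d]
  · intro j c hc
    exact P.ε.map_mem (Ev.symm.hom.map_mem hc)
  · intro i hi c hc
    rcases lt_or_gt_of_ne hi with hi | hi
    · obtain ⟨j, rfl⟩ : ∃ j, n = i + 1 + j := Nat.exists_eq_add_of_lt hi |>.imp fun j h => by omega
      obtain ⟨x, rfl⟩ := (hbij i (j + 1) (by omega)).2 c
      rw [ProjRes.mem_cocycles] at hc
      have hx : (P.d j).toLin x = 0 := by
        apply (hbij (i + 1) j rfl).1
        rw [map_zero, ProjRes.gradedHom_ext_iff]
        intro q
        exact (hcomm i j rfl x q).symm.trans (hc q)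
      obtain ⟨y, rfl⟩ := (P.exact_succ j x).1 hx
      cases i with
      | zero =>
        -- Here `j + 2 = n + 1`, so injectivity of the last differential of `P` takes the place of a
        -- coboundary.
        have := hP (j + 2) (by omega)
        rw [Subsingleton.elim y 0, map_zero, map_zero]
        exact zero_mem _
      | succ i =>
        rw [ProjRes.mem_coboundaries_succ]
        exact ⟨(ev i (j + 2) (by omega)).toLin y, fun q => hcomm i (j + 1) (by omega) y q⟩
    · have : c = 0 := by
        rw [ProjRes.gradedHom_ext_iff]
        intro x
        have := hQ i hi
        rw [Subsingleton.elim x 0, map_zero, map_zero]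
      rw [this]
      exact zero_mem _

end ProjRes

/-! ### Shifts -/

theorem GrMod.IsProjective.shift {P : GrMod 𝓡} (hP : P.IsProjective) (m : ℤ) :
    (P.shift m).IsProjective := by
  intro M N g f hg
  obtain ⟨h, hh⟩ := hP (M.shift (-m)) (N.shift (-m)) ⟨g.toLin, fun hx => g.map_mem hx⟩
    ⟨f.toLin, fun {i x} hx => f.map_mem (i := i + -m) (by
      change x ∈ P.deg (i + -m + m)
      rwa [neg_add_cancel_right])⟩ hg
  refine ⟨⟨h.toLin, fun {i x} hx => ?_⟩, hh⟩
  have : h.toLin x ∈ M.deg (i + m + -m) := h.map_mem hx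
  rwa [add_neg_cancel_right] at this

theorem mem_homDeg_shift {X : GrMod 𝓡} {N : GrBimod 𝓡 𝓢} {m j : ℤ}
    {f : X.carrier →ₗ[R] N.carrier} : f ∈ homDeg (X.shift m) N j ↔ f ∈ homDeg X N (j - m) := by
  constructor
  · intro h i x hx
    have := h (i - m) x (by change x ∈ X.deg (i - m + m); rwa [sub_add_cancel])
    rwa [show i - m + j = i + (j - m) by ring] at this
  · intro h i x hx
    have := h (i + m) x hx
    rwa [show i + m + (j - m) = i + j by ring] at this

theorem gradedHomSubmodule_shift (X : GrMod 𝓡) (N : GrBimod 𝓡 𝓢) (m : ℤ) :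
    gradedHomSubmodule (X.shift m) N = gradedHomSubmodule X N := by
  ext f
  constructor
  · intro hf
    exact (iSup_le fun j g hg => AddSubgroup.mem_iSup_of_mem (j - m) (mem_homDeg_shift.1 hg) :
      (⨆ j, homDeg (X.shift m) N j) ≤ ⨆ j, homDeg X N j) hf
  · intro hf
    refine (iSup_le fun j g hg => AddSubgroup.mem_iSup_of_mem (j + m) (mem_homDeg_shift.2 ?_) :
      (⨆ j, homDeg X N j) ≤ ⨆ j, homDeg (X.shift m) N j) hf
    rwa [add_sub_cancel_right]

/-- The resolution of `M` obtained from a resolution of `M(ℓ)`. -/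
def ProjRes.unshift {M : GrMod 𝓡} {ℓ : ℤ} (P : ProjRes (M.shift ℓ)) : ProjRes M where
  X n := (P.X n).shift (-ℓ)
  d n := ⟨(P.d n).toLin, fun hx => (P.d n).map_mem hx⟩
  ε := ⟨P.ε.toLin, fun {i x} hx => by
    have : P.ε.toLin x ∈ M.deg (i + -ℓ + ℓ) := P.ε.map_mem hx
    rwa [neg_add_cancel_right] at this⟩
  projective n := (P.projective n).shift _
  surjective := P.surjective
  exact_zero := P.exact_zero
  exact_succ := P.exact_succ

variable (N : GrBimod 𝓡 𝓢) in
/-- The graded Hom does not depend, as a module, on a shift of its first argument. -/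
def gradedHomShift (X : GrMod 𝓡) (m : ℤ) :
    (gradedHom (X.shift m) N).carrier ≃ₗ[S] (gradedHom X N).carrier where
  toFun c := ⟨c.1, SetLike.ext_iff.1 (gradedHomSubmodule_shift X N m) _ |>.1 c.2⟩
  invFun c := ⟨c.1, SetLike.ext_iff.1 (gradedHomSubmodule_shift X N m) _ |>.2 c.2⟩
  left_inv _ := rfl
  right_inv _ := rfl
  map_add' _ _ := rfl
  map_smul' _ _ := rfl

theorem gradedHomShift_mem {N : GrBimod 𝓡 𝓢} {X : GrMod 𝓡} {m j : ℤ}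
    {c : (gradedHom (X.shift m) N).carrier} (hc : c ∈ (gradedHom (X.shift m) N).deg j) :
    gradedHomShift N X m c ∈ (gradedHom X N).deg (j - m) :=
  mem_homDeg_shift.1 hc

section

variable {M : GrMod 𝓡} {N : GrBimod 𝓡 𝓢} {ℓ : ℤ} {P : ProjRes (M.shift ℓ)}

theorem ProjRes.mem_cocycles_unshift {i : ℕ} (c : (gradedHom ((P.X i).shift (-ℓ)) N).carrier) :
    c ∈ P.unshift.cocycles N i ↔ gradedHomShift N (P.X i) (-ℓ) c ∈ P.cocycles N i :=
  ⟨fun h => (mem_cocycles N (P := P)).2 fun x => (mem_cocycles N (P := P.unshift)).1 h x,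
    fun h => (mem_cocycles N (P := P.unshift)).2 fun x => (mem_cocycles N (P := P)).1 h x⟩

theorem ProjRes.mem_coboundaries_unshift {i : ℕ}
    (c : (gradedHom ((P.X i).shift (-ℓ)) N).carrier) :
    c ∈ P.unshift.coboundaries N i ↔ gradedHomShift N (P.X i) (-ℓ) c ∈ P.coboundaries N i := by
  cases i with
  | zero => exact (LinearEquiv.map_eq_zero_iff (gradedHomShift N (P.X 0) (-ℓ))).symm
  | succ i =>
    refine (mem_coboundaries_succ N (P := P.unshift)).trans
      (Iff.trans ?_ (mem_coboundaries_succ N (P := P)).symm)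
    constructor
    · rintro ⟨g, hg⟩
      exact ⟨gradedHomShift N (P.X i) (-ℓ) g, hg⟩
    · rintro ⟨g, hg⟩
      exact ⟨(gradedHomShift N (P.X i) (-ℓ)).symm g, hg⟩

/-- The identification of cocycles for a shifted resolution. -/
def ProjRes.unshiftCocycles (P : ProjRes (M.shift ℓ)) (N : GrBimod 𝓡 𝓢) (n : ℕ) :
    P.unshift.cocycles N n →ₗ[S] P.cocycles N n where
  toFun c := ⟨gradedHomShift N (P.X n) (-ℓ) c.1, (mem_cocycles_unshift c.1).1 c.2⟩
  map_add' _ _ := rfl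
  map_smul' _ _ := rfl

theorem ProjRes.unshiftCocycles_surjective (n : ℕ) :
    Function.Surjective (P.unshiftCocycles N n) := fun c =>
  ⟨⟨(gradedHomShift N (P.X n) (-ℓ)).symm c.1, (mem_cocycles_unshift _).2 (by
    rw [LinearEquiv.apply_symm_apply]; exact c.2)⟩,
    Subtype.ext ((gradedHomShift N (P.X n) (-ℓ)).apply_symm_apply c.1)⟩

/-- A form of degree `j` on `X(-ℓ)` has degree `j + ℓ` on `X`; the shift removed from `M` thus
reappears on `E`. -/
theorem ProjRes.Concentrated.unshift {n : ℕ} {E : GrMod 𝓢} {ψ : P.cocycles N n →ₗ[S] E.carrier}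
    (h : P.Concentrated N n E ψ) : ∃ ψ', P.unshift.Concentrated N n (E.shift ℓ) ψ' := by
  refine ⟨(ψ ∘ₗ P.unshiftCocycles N n :), ?_, ?_, ?_, ?_⟩
  · exact h.surjective.comp (ProjRes.unshiftCocycles_surjective n)
  · intro c
    exact (h.eq_zero_iff _).trans (mem_coboundaries_unshift c.1).symm
  · intro j c hc
    have h1 := gradedHomShift_mem (X := P.X n) hc
    rw [sub_neg_eq_add] at h1
    exact h.deg (j + ℓ) (P.unshiftCocycles N n c) h1
  · intro i hi c hc
    exact (mem_coboundaries_unshift c).2 (h.exact i hi ((mem_cocycles_unshift c).1 hc))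

end

end Duality
section Reduction

variable {R : Type u} [Ring R] {𝓡 : ℤ → AddSubgroup R} [GradedRing 𝓡]
variable {S : Type u} [Ring S] {𝓢 : ℤ → AddSubgroup S} [GradedRing 𝓢]
variable {C : Type u} [Ring C] {C' : Type u} [Ring C']

/-! ### Reduction along a surjective ring morphism -/

/-- The subgroup generated by the products with the elements of `C` that `τ` kills. -/
def redSub (τ : R →+* S) (γ : C →+* R) (Y : Type*) [AddCommGroup Y] [Module R Y] :
    AddSubgroup Y :=
  AddSubgroup.closure {x | ∃ c y, τ (γ c) = 0 ∧ x = γ c • y}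

/-- A surjective ring morphism whose kernel is generated as a right ideal by elements of `C`. -/
structure IsReduction (τ : R →+* S) (γ : C →+* R) : Prop where
  surjective : Function.Surjective τ
  ker : ∀ r, τ r = 0 → r ∈ redSub τ γ R

section

variable {τ : R →+* S} {γ : C →+* R}
variable {X Y Z : Type*} [AddCommGroup X] [AddCommGroup Y] [AddCommGroup Z]
  [Module R X] [Module R Y] [Module R Z]

theorem smul_mem_redSub {r : R} (hr : r ∈ redSub τ γ R) (y : Y) : r • y ∈ redSub τ γ Y := by
  induction hr using AddSubgroup.closure_induction with
  | mem r hr =>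
    obtain ⟨c, r', hc, rfl⟩ := hr
    rw [smul_eq_mul, mul_smul]
    exact AddSubgroup.subset_closure ⟨c, _, hc, rfl⟩
  | zero => rw [zero_smul]; exact zero_mem _
  | add r s _ _ hr hs => rw [add_smul]; exact add_mem hr hs
  | neg r _ hr => rw [neg_smul]; exact neg_mem hr

/-- The reason for generating the kernel of `τ` by elements of `C`: maps that are linear over `C`
only, such as the splittings, are still compatible with reduction. -/
theorem map_mem_redSub {s : Z →+ Y} (hs : Commutes γ s) {z : Z} (hz : z ∈ redSub τ γ Z) :
    s z ∈ redSub τ γ Y := by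
  induction hz using AddSubgroup.closure_induction with
  | mem z hz =>
    obtain ⟨c, z, hc, rfl⟩ := hz
    rw [hs]
    exact AddSubgroup.subset_closure ⟨c, _, hc, rfl⟩
  | zero => rw [map_zero]; exact zero_mem _
  | add r s _ _ hr hs => rw [map_add]; exact add_mem hr hs
  | neg r _ hr => rw [map_neg]; exact neg_mem hr

theorem semilinear_redSub {Y' : Type*} [AddCommGroup Y'] [Module S Y'] {π : Y →+ Y'}
    (hπ : ∀ (r : R) y, π (r • y) = τ r • π y) {y : Y} (hy : y ∈ redSub τ γ Y) : π y = 0 := by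
  induction hy using AddSubgroup.closure_induction with
  | mem z hz =>
    obtain ⟨c, z, hc, rfl⟩ := hz
    rw [hπ, hc, zero_smul]
  | zero => rw [map_zero]
  | add r s _ _ hr hs => rw [map_add, hr, hs, add_zero]
  | neg r _ hr => rw [map_neg, hr, neg_zero]

/-- Exactness is preserved by reduction if there is a splitting over `C`. -/
theorem exact_reduction {Y' Z' : Type*} [AddCommGroup Y'] [Module S Y'] [AddCommGroup Z']
    {f : X →ₗ[R] Y} {g : Y →ₗ[R] Z} (hfg : Function.Exact f g) {s : Z →+ Y} (hs : Commutes γ s)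
    (hgs : ∀ y, g (s (g y)) = g y) {π : Y →+ Y'} (hπ : ∀ (r : R) y, π (r • y) = τ r • π y)
    {ρ : Z →+ Z'} (hρ : ∀ z, ρ z = 0 → z ∈ redSub τ γ Z) {y : Y} (hy : ρ (g y) = 0) :
    ∃ x, π (f x) = π y := by
  obtain ⟨x, hx⟩ := (hfg (y - s (g y))).1 (by rw [map_sub, hgs, sub_self])
  refine ⟨x, ?_⟩
  rw [hx, map_sub, semilinear_redSub hπ (map_mem_redSub hs (hρ _ hy)), sub_zero]

end

/-! ### Coordinatewise reduction of free modules -/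

namespace GrMod.HBasis

variable {Y : GrMod 𝓡} {Y' : GrMod 𝓢} {ι : Type*} (B : HBasis Y ι) (B' : HBasis Y' ι)
variable (τ : R →+* S)

/-- The map that reduces the coordinates. -/
noncomputable def red : Y.carrier →+ Y'.carrier :=
  B'.b.repr.symm.toLinearMap.toAddMonoidHom.comp
    ((Finsupp.mapRange.addMonoidHom τ.toAddMonoidHom).comp B.b.repr.toLinearMap.toAddMonoidHom)

theorem red_repr (x : Y.carrier) (v : ι) :
    B'.b.repr (B.red B' τ x) v = τ (B.b.repr x v) := by
  change B'.b.repr (B'.b.repr.symm (Finsupp.mapRange.addMonoidHom τ.toAddMonoidHom _)) v = _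
  rw [LinearEquiv.apply_symm_apply]
  rfl

theorem red_smul (r : R) (x : Y.carrier) : B.red B' τ (r • x) = τ r • B.red B' τ x := by
  apply B'.b.repr.injective
  ext v
  rw [red_repr, map_smul, map_smul, Finsupp.smul_apply, Finsupp.smul_apply, red_repr, smul_eq_mul,
    smul_eq_mul, map_mul]

theorem red_basis (v : ι) : B.red B' τ (B.b v) = B'.b v := by
  classical
  apply B'.b.repr.injective
  ext w
  rw [red_repr, Module.Basis.repr_self, Module.Basis.repr_self, Finsupp.single_apply,
    Finsupp.single_apply]
  split_ifs <;> simp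

variable {τ}

theorem red_surjective (hτ : Function.Surjective τ) : Function.Surjective (B.red B' τ) := by
  intro y
  obtain ⟨x, hx⟩ := Finsupp.mapRange_surjective (α := ι) τ (map_zero τ) hτ (B'.b.repr y)
  refine ⟨B.b.repr.symm x, B'.b.repr.injective ?_⟩
  ext v
  rw [red_repr, LinearEquiv.apply_symm_apply, ← hx]
  rfl

theorem mem_redSub_of_red {γ : C →+* R} (hτ : IsReduction τ γ) {x : Y.carrier}
    (hx : B.red B' τ x = 0) : x ∈ redSub τ γ Y.carrier := by
  rw [← B.b.linearCombination_repr x, Finsupp.linearCombination_apply]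
  refine sum_mem fun v _ => smul_mem_redSub (hτ.ker _ ?_) _
  rw [← red_repr B B', hx, map_zero]
  rfl

theorem red_mem (hdeg : ∀ i, ∀ r ∈ 𝓡 i, τ r ∈ 𝓢 i) (he : B'.e = B.e) {i : ℤ} {x : Y.carrier}
    (hx : x ∈ Y.deg i) : B.red B' τ x ∈ Y'.deg i := by
  rw [B'.mem_deg_iff]
  intro v
  rw [red_repr, he]
  exact hdeg _ _ (B.mem_deg_iff.1 hx v)

/-- Universal property of the reduction: a `τ`-semilinear map factors through it, and the factor is
determined on the basis. -/
theorem lift_red {Z : GrMod 𝓢} (φ : Y.carrier →+ Z.carrier)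
    (hφ : ∀ (r : R) y, φ (r • y) = τ r • φ y) (h : ∀ v, φ (B.b v) ∈ Z.deg (B'.e v))
    (y : Y.carrier) : (B'.lift (fun v => φ (B.b v)) h).toLin (B.red B' τ y) = φ y := by
  refine B.induction (p := fun y => (B'.lift (fun v => φ (B.b v)) h).toLin (B.red B' τ y) = φ y)
    y ?_ ?_ ?_
  · rw [map_zero, map_zero, map_zero]
  · intro x y hx hy
    rw [map_add, map_add, map_add, hx, hy]
  · intro r v
    rw [red_smul, red_basis, map_smul, lift_basis, hφ]

end GrMod.HBasis

/-- The resolution of modules that underlies a resolution by graded free modules. -/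
noncomputable def ProjRes.toRes {M : GrMod 𝓡} (P : ProjRes M) {ι : ℕ → Type*}
    (B : ∀ n, GrMod.HBasis (P.X n) (ι n)) : Res R M.carrier where
  X n := ModuleCat.of R (P.X n).carrier
  d n := (P.d n).toLin
  ε := P.ε.toLin
  projective n := Module.Projective.of_basis (B n).b
  surjective := P.surjective
  exact_zero := P.exact_zero
  exact_succ := P.exact_succ

/-- The reduction of a graded free resolution. -/
theorem ProjRes.exists_reduction {M : GrMod 𝓡} (P : ProjRes M) {ι : ℕ → Type u}
    (B : ∀ n, GrMod.HBasis (P.X n) (ι n)) {τ : R →+* S} {γ : C →+* R} (hτ : IsReduction τ γ)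
    (hdeg : ∀ i, ∀ r ∈ 𝓡 i, τ r ∈ 𝓢 i) (hR : ProjectiveOver γ R)
    (hM : ProjectiveOver γ M.carrier) {M' : GrMod 𝓢} (p : M.carrier →+ M'.carrier)
    (hp : ∀ (r : R) m, p (r • m) = τ r • p m) (hp_surj : Function.Surjective p)
    (hp_ker : ∀ m, p m = 0 → m ∈ redSub τ γ M.carrier)
    (hp_deg : ∀ i, ∀ m ∈ M.deg i, p m ∈ M'.deg i) :
    ∃ (F : ProjRes M') (B' : ∀ n, GrMod.HBasis (F.X n) (ι n)), (∀ n, (B' n).e = (B n).e) ∧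
      (∀ n x, (F.d n).toLin ((B (n + 1)).red (B' (n + 1)) τ x) =
        (B n).red (B' n) τ ((P.d n).toLin x)) := by
  let B' : ∀ n, GrMod.HBasis (GrMod.free 𝓢 (B n).e) (ι n) := fun n => GrMod.freeBasis _
  have he : ∀ n, (B' n).e = (B n).e := fun n => rfl
  let π := fun n => (B n).red (B' n) τ
  have hπ : ∀ n r x, π n (r • x) = τ r • π n x := fun n => (B n).red_smul (B' n) τ
  have hsurj : ∀ n, Function.Surjective (π n) := fun n => (B n).red_surjective (B' n) hτ.surjective
  let φ : ∀ n, (P.X (n + 1)).carrier →+ (GrMod.free 𝓢 (B n).e).carrier := fun n =>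
    (π n).comp (P.d n).toLin.toAddMonoidHom
  let φ' : (P.X 0).carrier →+ M'.carrier := p.comp P.ε.toLin.toAddMonoidHom
  -- The reduced matrices. By `lift_red` they commute with the projections `π`, through which all
  -- relations and exactness are checked.
  let d : ∀ n, GrMod.Hom (GrMod.free 𝓢 (B (n + 1)).e) (GrMod.free 𝓢 (B n).e) := fun n =>
    (B' (n + 1)).lift (fun v => φ n ((B (n + 1)).b v)) fun v =>
      (B n).red_mem (B' n) hdeg (he n) ((P.d n).map_mem ((B (n + 1)).mem v))
  let ε : GrMod.Hom (GrMod.free 𝓢 (B 0).e) M' :=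
    (B' 0).lift (fun v => φ' ((B 0).b v)) fun v => hp_deg _ _ (P.ε.map_mem ((B 0).mem v))
  have hd : ∀ n x, (d n).toLin (π (n + 1) x) = π n ((P.d n).toLin x) := fun n =>
    (B (n + 1)).lift_red (B' (n + 1)) (φ n)
      (fun r y => (congrArg (π n) (map_smul (P.d n).toLin r y)).trans (hπ n _ _)) _
  have hε : ∀ x, ε.toLin (π 0 x) = p (P.ε.toLin x) :=
    (B 0).lift_red (B' 0) φ'
      (fun r y => (congrArg p (map_smul P.ε.toLin r y)).trans (hp _ _)) _
  refine ⟨{ X := fun n => GrMod.free 𝓢 (B n).e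
            d := d
            ε := ε
            projective := fun n => (B' n).isProjective
            surjective := fun y => ?_
            exact_zero := fun y => ?_
            exact_succ := fun n y => ?_ }, B', he, hd⟩
  · obtain ⟨m, rfl⟩ := hp_surj y
    obtain ⟨x, rfl⟩ := P.surjective m
    exact ⟨π 0 x, hε x⟩
  · obtain ⟨y, rfl⟩ := hsurj 0 y
    constructor
    · intro hy
      obtain ⟨s, hs, hεs⟩ := (P.toRes B).exists_splitting_zero γ hR hM
      obtain ⟨x, hx⟩ := exact_reduction (τ := τ) P.exact_zero hs (fun y => hεs _) (hπ 0) hp_ker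
        ((hε y).symm.trans hy)
      exact ⟨π 1 x, (hd 0 x).trans hx⟩
    · rintro ⟨x, hx⟩
      obtain ⟨x, rfl⟩ := hsurj 1 x
      rw [← hx, hd, hε, P.ε_d, map_zero]
  · obtain ⟨y, rfl⟩ := hsurj (n + 1) y
    constructor
    · intro hy
      obtain ⟨s, hs, hds⟩ := (P.toRes B).exists_splitting γ hR hM n
      obtain ⟨x, hx⟩ := exact_reduction (τ := τ) (P.exact_succ n) hs hds (hπ (n + 1))
        (fun z => (B n).mem_redSub_of_red (B' n) hτ) ((hd n y).symm.trans hy)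
      exact ⟨π (n + 2) x, (hd (n + 1) x).trans hx⟩
    · rintro ⟨x, hx⟩
      obtain ⟨x, rfl⟩ := hsurj (n + 2) x
      rw [← hx, hd, hd, P.d_d, map_zero]

/-- The reduction of a graded free resolution with dual `Q` computes the graded Ext if `Q` can be
reduced. -/
theorem ProjRes.exists_concentrated_reduction {M : GrMod 𝓡} {P : ProjRes M} {ι : ℕ → Type u}
    (B : ∀ n, GrMod.HBasis (P.X n) (ι n)) [∀ n, Finite (ι n)] {τ : R →+* S} {M' : GrMod 𝓢}
    {F : ProjRes M'} (B' : ∀ n, GrMod.HBasis (F.X n) (ι n)) (he : ∀ n, (B' n).e = (B n).e)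
    (hF : ∀ n x, (F.d n).toLin ((B (n + 1)).red (B' (n + 1)) τ x) =
        (B n).red (B' n) τ ((P.d n).toLin x))
    {n : ℕ} (hn : 1 ≤ n) {N : GrMod (opGrading 𝓡)} {Q : ProjRes N} (hPQ : IsDual n P Q)
    {κ : ℕ → Type u} (BQ : ∀ n, GrMod.HBasis (Q.X n) (κ n))
    {γ : C →+* Rᵐᵒᵖ} (hτ : IsReduction τ.op γ)
    (hR : ProjectiveOver γ Rᵐᵒᵖ)
    (hN : ProjectiveOver γ N.carrier) {N' : GrMod (opGrading 𝓢)} (p : N.carrier →+ N'.carrier)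
    (hp : ∀ (r : Rᵐᵒᵖ) m, p (r • m) = τ.op r • p m) (hp_surj : Function.Surjective p)
    (hp_ker : ∀ m, p m = 0 → m ∈ redSub τ.op γ N.carrier)
    (hp_deg : ∀ i, ∀ m ∈ N.deg i, p m ∈ N'.deg i) :
    ∃ ψ, F.Concentrated (regular 𝓢) n N' ψ := by
  obtain ⟨hP, hQ, θ, hθ⟩ := hPQ
  -- The basis of `Q` dual to that of `P`. Reducing its coordinates maps `Q.X i` onto the dual of
  -- `F.X j`.
  let C : ∀ i j, i + j = n → GrMod.HBasis (Q.X i) (ι j) := fun i j h =>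
    (B j).dual.ofIso (θ i j h).symm
  have hC : ∀ i j h q v, (C i j h).b.repr q v =
      MulOpposite.op (dval ((θ i j h).toEquiv q) ((B j).b v)) := fun i j h q v => rfl
  let π : ∀ i j, i + j = n → (Q.X i).carrier →+ (gradedHom (F.X j) (regular 𝓢)).carrier :=
    fun i j h => (C i j h).red (B' j).dual τ.op
  have hπ : ∀ i j h (r : Rᵐᵒᵖ) x, π i j h (r • x) = τ.op r • π i j h x := fun i j h =>
    (C i j h).red_smul (B' j).dual τ.op
  have hsurj : ∀ i j h, Function.Surjective (π i j h) := fun i j h =>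
    (C i j h).red_surjective (B' j).dual hτ.surjective
  -- Reduction is compatible with the pairing between `P` and `Q`; hence the dual differentials of
  -- `F` are the reductions of those of `Q`.
  have hval : ∀ i j h q x, dval (π i j h q) ((B j).red (B' j) τ x) =
      τ (dval ((θ i j h).toEquiv q) x) := by
    intro i j h q x
    refine (B j).induction (p := fun x => dval (π i j h q) ((B j).red (B' j) τ x) =
      τ (dval ((θ i j h).toEquiv q) x)) x ?_ ?_ ?_
    · rw [map_zero, map_zero, map_zero, map_zero]
    · intro x y hx hy
      rw [map_add, map_add, map_add, map_add, hx, hy]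
    · intro r v
      rw [GrMod.HBasis.red_smul, GrMod.HBasis.red_basis, map_smul, map_smul, smul_eq_mul,
        smul_eq_mul, map_mul]
      congr 1
      have h1 := (C i j h).red_repr (B' j).dual τ.op q v
      rw [hC, GrMod.HBasis.dual_repr] at h1
      exact MulOpposite.op_injective h1
  have hsq : ∀ i j (h : i + 1 + j = n) q, π i (j + 1) (by omega) ((Q.d i).toLin q) =
      (gradedHomMap (F.d j) (regular 𝓢)).toLin (π (i + 1) j h q) := by
    intro i j h q
    apply dval_injective
    refine (B' (j + 1)).b.ext fun v => ?_
    rw [← (B (j + 1)).red_basis (B' (j + 1)) τ, hval, hθ i j h q]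
    change τ (dval ((θ (i + 1) j h).toEquiv q) ((P.d j).toLin ((B (j + 1)).b v))) =
      dval (π (i + 1) j h q) ((F.d j).toLin ((B (j + 1)).red (B' (j + 1)) τ ((B (j + 1)).b v)))
    rw [hF, hval]
  have hFX : ∀ j, n < j → Subsingleton (F.X j).carrier := by
    intro j hj
    have := hP j hj
    exact ((B j).red_surjective (B' j)
      (fun s => (hτ.surjective (MulOpposite.op s)).imp' MulOpposite.unop
        fun r hr => MulOpposite.op_injective hr)).subsingleton
  have hcoc : ∀ c, c ∈ F.cocycles (regular 𝓢) n := by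
    intro c
    rw [mem_cocycles]
    intro x
    have := hFX (n + 1) (Nat.lt_succ_self n)
    rw [Subsingleton.elim x 0, map_zero, map_zero]
  have h0 : 0 + n = n := zero_add n
  let φ : (Q.X 0).carrier →+ N'.carrier := p.comp Q.ε.toLin.toAddMonoidHom
  have hφ : ∀ v, φ ((C 0 n h0).b v) ∈ N'.deg ((B' n).dual.e v) := by
    intro v
    have : (B' n).dual.e v = (C 0 n h0).e v := congrArg Neg.neg (congrFun (he n) v)
    rw [this]
    exact hp_deg _ _ (Q.ε.map_mem ((C 0 n h0).mem v))
  let ψ := (B' n).dual.lift (fun v => φ ((C 0 n h0).b v)) hφ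
  have hψ : ∀ q, ψ.toLin (π 0 n h0 q) = p (Q.ε.toLin q) :=
    (C 0 n h0).lift_red (B' n).dual φ
      (fun r y => (congrArg p (map_smul Q.ε.toLin r y)).trans (hp _ _)) hφ
  refine ⟨ψ.toLin ∘ₗ Submodule.subtype _, ?_, ?_, ?_, ?_⟩
  · intro y
    obtain ⟨m, rfl⟩ := hp_surj y
    obtain ⟨q, rfl⟩ := Q.surjective m
    exact ⟨⟨π 0 n h0 q, hcoc _⟩, hψ q⟩
  · rintro ⟨c, hc⟩
    obtain ⟨q, rfl⟩ := hsurj 0 n h0 c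
    change ψ.toLin (π 0 n h0 q) = 0 ↔ _
    rw [hψ]
    obtain ⟨m, rfl⟩ := Nat.exists_eq_add_of_le' hn
    constructor
    · intro hq
      obtain ⟨s, hs, hεs⟩ := (Q.toRes BQ).exists_splitting_zero γ hR hN
      obtain ⟨x, hx⟩ := exact_reduction (τ := τ.op) Q.exact_zero hs (fun y => hεs _)
        (hπ 0 (m + 1) h0) hp_ker hq
      exact ⟨π 1 m (by omega) x, ((hsq 0 m (by omega) x).symm.trans hx)⟩
    · rintro ⟨g, hg⟩
      obtain ⟨x, rfl⟩ := hsurj 1 m (by omega) g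
      have hg' : π 0 (m + 1) h0 ((Q.d 0).toLin x) = π 0 (m + 1) h0 q :=
        (hsq 0 m (by omega) x).trans hg
      rw [← hψ, ← hg', hψ, Q.ε_d, map_zero]
  · intro j c hc
    exact ψ.map_mem hc
  · intro j hj c hc
    rcases lt_or_gt_of_ne hj with hj | hj
    · obtain ⟨i, hi⟩ : ∃ i, i + 1 + j = n := ⟨n - j - 1, by omega⟩
      obtain ⟨q, rfl⟩ := hsurj (i + 1) j hi c
      -- Exactness of the reduced dual complex comes from a splitting of `Q`, not from one of `P`.
      obtain ⟨s, hs, hds⟩ := (Q.toRes BQ).exists_splitting γ hR hN i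
      obtain ⟨x, hx⟩ := exact_reduction (τ := τ.op) (Q.exact_succ i) hs hds (hπ (i + 1) j hi)
        (fun z => (C i (j + 1) (by omega)).mem_redSub_of_red (B' (j + 1)).dual hτ)
        ((hsq i j hi q).trans hc)
      rw [← hx]
      cases j with
      | zero =>
        have := hQ (i + 2) (by omega)
        rw [Subsingleton.elim x 0, map_zero, map_zero]
        exact zero_mem _
      | succ j =>
        exact ⟨π (i + 2) j (by omega) x, (hsq (i + 1) j (by omega) x).symm⟩
    · have : c = 0 := by
        rw [gradedHom_ext_iff]
        intro x
        have := hFX j hj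
        rw [Subsingleton.elim x 0, map_zero, map_zero]
      rw [this]
      exact zero_mem _

end Reduction
section Connected

variable {k : Type v} [Field k] {A : Type u} [Ring A] [Algebra k A]
variable {𝒜 : ℕ → Submodule k A} [GradedAlgebra 𝒜]

/-! ### The augmentations of a connected algebra and of its enveloping algebra -/

theorem IsConnected.exists_aug (h : IsConnected 𝒜) :
    ∃ ε : A →ₐ[k] k, ∀ x, algebraMap k A (ε x) = GradedRing.projZeroRingHom 𝒜 x := by
  have := h.1
  have hinj := FaithfulSMul.algebraMap_injective k A
  have hx : ∀ x, ∃ c, algebraMap k A c = GradedRing.projZeroRingHom 𝒜 x := by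
    intro x
    have : GradedRing.projZeroRingHom 𝒜 x ∈ 𝒜 0 := SetLike.coe_mem _
    rw [h.2] at this
    exact this
  choose ε hε using hx
  have hc : ∀ c, GradedRing.projZeroRingHom 𝒜 (algebraMap k A c) = algebraMap k A c := by
    intro c
    refine DirectSum.decompose_of_mem_same 𝒜 ?_
    rw [h.2]
    exact ⟨c, rfl⟩
  refine ⟨{ toFun := ε
            map_one' := hinj ?_
            map_mul' := fun x y => hinj ?_
            map_zero' := hinj ?_
            map_add' := fun x y => hinj ?_
            commutes' := fun c => hinj ?_ }, hε⟩
  · rw [hε, map_one, map_one]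
  · rw [hε, map_mul, map_mul, hε, hε]
  · rw [hε, map_zero, map_zero]
  · rw [hε, map_add, map_add, hε, hε]
  · rw [hε, hc]
    rfl

namespace IsConnected

variable (h : IsConnected 𝒜)

/-- The augmentation of a connected algebra. -/
noncomputable def aug : A →ₐ[k] k := h.exists_aug.choose

theorem algebraMap_aug (x : A) : algebraMap k A (h.aug x) = GradedRing.projZeroRingHom 𝒜 x :=
  h.exists_aug.choose_spec x

theorem aug_of_ne {i : ℕ} (hi : i ≠ 0) {x : A} (hx : x ∈ 𝒜 i) : h.aug x = 0 := by
  have := h.1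
  apply FaithfulSMul.algebraMap_injective k A
  rw [h.algebraMap_aug, map_zero]
  exact DirectSum.decompose_of_mem_ne 𝒜 hx hi

theorem algebraMap_aug_of_mem {x : A} (hx : x ∈ 𝒜 0) : algebraMap k A (h.aug x) = x := by
  rw [h.algebraMap_aug]
  exact DirectSum.decompose_of_mem_same 𝒜 hx

theorem algebraMap_mem (h : IsConnected 𝒜) (c : k) : algebraMap k A c ∈ 𝒜 0 := by
  rw [h.2]
  exact ⟨c, rfl⟩

/-- The augmentation of a connected algebra, as an augmentation of graded rings. -/
noncomputable def augA : Aug (intGrading 𝒜) k where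
  hom := h.aug
  neg i hi x hx := by
    obtain ⟨h0, -⟩ | h0 := mem_intGrading.1 hx
    · omega
    · exact h0
  ne i hi x hx := by
    obtain ⟨h0, hx⟩ | rfl := mem_intGrading.1 hx
    · exact h.aug_of_ne (by omega) hx
    · exact map_zero h.aug
  inj x hx h0 := by
    obtain ⟨-, hx⟩ | rfl := mem_intGrading.1 hx
    · rw [← h.algebraMap_aug_of_mem hx]
      exact (congrArg _ h0).trans (map_zero _)
    · rfl
  surj c := ⟨algebraMap k A c, mem_intGrading.2 (Or.inl ⟨le_rfl, h.algebraMap_mem c⟩),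
    h.aug.commutes c⟩

/-- The augmentation of the opposite algebra. -/
noncomputable def augOp : Aᵐᵒᵖ →ₐ[k] k := h.aug.fromOpposite fun _ _ => mul_comm _ _

/-- The morphism `A ⊗ Aᵒᵖ → A`, `a ⊗ b ↦ a ε(b)`. -/
noncomputable def τ : A ⊗[k] Aᵐᵒᵖ →ₐ[k] A :=
  Algebra.TensorProduct.lift (AlgHom.id k A) ((Algebra.ofId k A).comp h.augOp)
    fun _ _ => (Algebra.commutes _ _).symm

theorem τ_tmul (a b : A) :
    h.τ (a ⊗ₜ[k] MulOpposite.op b) = a * algebraMap k A (h.aug b) :=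
  Algebra.TensorProduct.lift_tmul _ _ _ _ _

theorem τ_mem {i : ℤ} {r : A ⊗[k] Aᵐᵒᵖ} (hr : r ∈ envInt 𝒜 i) : h.τ r ∈ intGrading 𝒜 i := by
  rw [mem_intGrading] at hr
  obtain ⟨hi, hr⟩ | rfl := hr
  · refine mem_intGrading.2 (Or.inl ⟨hi, ?_⟩)
    induction hr using Submodule.span_induction with
    | zero => rw [map_zero]; exact zero_mem _
    | add x y _ _ hx hy => rw [map_add]; exact add_mem hx hy
    | smul c x _ hx => rw [map_smul]; exact Submodule.smul_mem _ _ hx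
    | mem r hr =>
      obtain ⟨p, q, hpq, a, ha, b, hb, rfl⟩ := hr
      rw [τ_tmul]
      by_cases hq : q = 0
      · rw [← Algebra.commutes, ← Algebra.smul_def]
        refine Submodule.smul_mem _ _ ?_
        rwa [← hpq, hq, add_zero]
      · rw [h.aug_of_ne hq hb, map_zero, mul_zero]
        exact zero_mem _
  · rw [map_zero]
    exact zero_mem _

/-- Degree 0 only contains `A_0 ⊗ A_0`, which consists of scalars: the enveloping algebra is
connected too. -/
theorem eq_algebraMap_of_mem_envGrading {r : A ⊗[k] Aᵐᵒᵖ} (hr : r ∈ envGrading 𝒜 0) :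
    r = algebraMap k _ (h.aug (h.τ r)) := by
  induction hr using Submodule.span_induction with
  | zero => rw [map_zero, map_zero, map_zero]
  | add x y _ _ hx hy => rw [map_add, map_add, map_add, ← hx, ← hy]
  | smul c x _ hx =>
    rw [map_smul, map_smul, smul_eq_mul, map_mul, ← hx]
    exact Algebra.smul_def c x
  | mem r hr =>
    obtain ⟨p, q, hpq, a, ha, b, hb, rfl⟩ := hr
    obtain ⟨rfl, rfl⟩ : p = 0 ∧ q = 0 := by omega
    have h1 := h.algebraMap_aug_of_mem ha
    have h2 := h.algebraMap_aug_of_mem hb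
    rw [τ_tmul, map_mul, AlgHom.commutes, Algebra.algebraMap_self_apply]
    conv_lhs => rw [← h1, ← h2]
    change algebraMap k A _ ⊗ₜ[k] algebraMap k Aᵐᵒᵖ _ = _
    rw [map_mul, Algebra.algebraMap_eq_smul_one, Algebra.algebraMap_eq_smul_one,
      Algebra.algebraMap_eq_smul_one, Algebra.algebraMap_eq_smul_one, TensorProduct.smul_tmul_smul,
      smul_mul_smul_comm, mul_one, Algebra.TensorProduct.one_def]

/-- The augmentation of the enveloping algebra, as an augmentation of graded rings. -/
noncomputable def augE : Aug (envInt 𝒜) k where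
  hom := (h.aug.comp h.τ : A ⊗[k] Aᵐᵒᵖ →ₐ[k] k)
  neg i hi x hx := by
    obtain ⟨h0, -⟩ | h0 := mem_intGrading.1 hx
    · omega
    · exact h0
  ne i hi x hx := h.augA.ne i hi _ (h.τ_mem hx)
  inj x hx h0 := by
    obtain ⟨-, hx⟩ | rfl := mem_intGrading.1 hx
    · rw [h.eq_algebraMap_of_mem_envGrading hx]
      exact (congrArg _ h0).trans (map_zero _)
    · rfl
  surj c := ⟨algebraMap k _ c, mem_intGrading.2 (Or.inl ⟨le_rfl, by
    rw [Algebra.algebraMap_eq_smul_one]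
    exact Submodule.smul_mem _ _ (SetLike.GradedOne.one_mem (A := envGrading 𝒜))⟩), (h.aug.comp h.τ).commutes c⟩

/-! ### Reduction on the left -/

theorem τ_rightMul (b : Aᵐᵒᵖ) : h.τ (rightMul k A b) = algebraMap k A (h.aug b.unop) :=
  (h.τ_tmul 1 b.unop).trans (one_mul _)

/-- It rests on `a ⊗ b - a ε(b) ⊗ 1 = (1 ⊗ (b - ε(b))) (a ⊗ 1)`. -/
theorem isReduction_left : IsReduction (h.τ : A ⊗[k] Aᵐᵒᵖ →+* A) (rightMul k A) where
  surjective a := ⟨a ⊗ₜ 1, by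
    change h.τ (a ⊗ₜ[k] MulOpposite.op 1) = a
    rw [τ_tmul, map_one, map_one, mul_one]⟩
  ker := by
    have key : ∀ r, r - h.τ r ⊗ₜ[k] (1 : Aᵐᵒᵖ) ∈
        redSub (h.τ : A ⊗[k] Aᵐᵒᵖ →+* A) (rightMul k A) (A ⊗[k] Aᵐᵒᵖ) := by
      intro r
      induction r using TensorProduct.induction_on with
      | zero =>
        rw [map_zero, TensorProduct.zero_tmul, sub_zero]
        exact zero_mem _
      | add x y hx hy =>
        rw [map_add, TensorProduct.add_tmul, add_sub_add_comm]
        exact add_mem hx hy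
      | tmul a b =>
        refine AddSubgroup.subset_closure
          ⟨b - algebraMap k Aᵐᵒᵖ (h.augOp b), a ⊗ₜ 1, ?_, ?_⟩
        · refine (h.τ_rightMul _).trans ?_
          change algebraMap k A (h.augOp (b - algebraMap k Aᵐᵒᵖ (h.augOp b))) = 0
          rw [map_sub, AlgHom.commutes, Algebra.algebraMap_self_apply, sub_self, map_zero]
        · change a ⊗ₜ b - h.τ (a ⊗ₜ MulOpposite.op b.unop) ⊗ₜ 1 =
            (1 : A) ⊗ₜ[k] (b - algebraMap k Aᵐᵒᵖ (h.augOp b)) * a ⊗ₜ[k] (1 : Aᵐᵒᵖ)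
          rw [τ_tmul, Algebra.TensorProduct.tmul_mul_tmul, one_mul, mul_one,
            TensorProduct.tmul_sub, ← Algebra.commutes, ← Algebra.smul_def,
            TensorProduct.smul_tmul, Algebra.algebraMap_eq_smul_one (A := Aᵐᵒᵖ)]
          rfl
    intro r hr
    have := key r
    rwa [show h.τ r = 0 from hr, TensorProduct.zero_tmul, sub_zero] at this

variable (𝒜) in
/-- The projection of `A` on its component of degree `0`. -/
noncomputable def projZero : A →+* 𝒜 0 := GradedRing.projZeroRingHom' 𝒜

theorem projZero_algebraMap_aug (x : A) :
    projZero 𝒜 (algebraMap k A (h.aug x)) = projZero 𝒜 x := by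
  rw [h.algebraMap_aug]
  exact Subtype.ext (DirectSum.decompose_of_mem_same 𝒜 (SetLike.coe_mem _))

theorem projZero_eq_zero_iff {x : A} : projZero 𝒜 x = 0 ↔ h.aug x = 0 := by
  constructor
  · intro hx
    have := h.1
    apply FaithfulSMul.algebraMap_injective k A
    rw [map_zero, h.algebraMap_aug]
    exact congrArg Subtype.val hx
  · intro hx
    rw [← h.projZero_algebraMap_aug, hx, map_zero, map_zero]

theorem projZero_surjective : Function.Surjective (projZero 𝒜) := fun x =>
  ⟨x.1, Subtype.ext (DirectSum.decompose_of_mem_same 𝒜 x.2)⟩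

theorem projZero_mem {i : ℤ} {x : A} (hx : x ∈ intGrading 𝒜 i) :
    projZero 𝒜 x ∈ degreeZero (𝒜 0) i := by
  by_cases hi : i = 0
  · rw [degreeZero, if_pos hi]
    trivial
  · have : projZero 𝒜 x = 0 := projZero_of_mem 𝒜 hi hx
    rw [this]
    exact zero_mem _

attribute [local instance] leftEnvModule rightEnvModule

theorem projZero_left_smul (r : A ⊗[k] Aᵐᵒᵖ) (m : A) :
    projZero 𝒜 (r • m) = projZero 𝒜 (h.τ r) * projZero 𝒜 m := by
  induction r using TensorProduct.induction_on with
  | zero => rw [zero_smul (A ⊗[k] Aᵐᵒᵖ) m, map_zero, map_zero, map_zero, zero_mul]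
  | add x y hx hy => rw [add_smul, map_add, hx, hy, map_add, map_add, add_mul]
  | tmul a b =>
    change projZero 𝒜 ((a ⊗ₜ[k] MulOpposite.op b.unop) • m) =
      projZero 𝒜 (h.τ (a ⊗ₜ[k] MulOpposite.op b.unop)) * _
    rw [leftEnv_smul, τ_tmul, map_mul, ← h.projZero_algebraMap_aug b.unop, ← map_mul, ← map_mul,
      mul_assoc, mul_assoc, ← Algebra.commutes _ m]

/-- `m` is obtained from 1 by right multiplication by `m`, which `τ` kills; so the reduction of `A`
is `A / A₊`. -/
theorem mem_redSub_left {m : A} (hm : projZero 𝒜 m = 0) :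
    m ∈ redSub (h.τ : A ⊗[k] Aᵐᵒᵖ →+* A) (rightMul k A) A := by
  refine AddSubgroup.subset_closure ⟨MulOpposite.op m, (1 : A), ?_, ?_⟩
  · refine (h.τ_rightMul _).trans ?_
    rw [MulOpposite.unop_op, h.projZero_eq_zero_iff.1 hm, map_zero]
  · change m = ((1 : A) ⊗ₜ[k] MulOpposite.op m) • (1 : A)
    rw [leftEnv_smul, one_mul, one_mul]

/-! ### Reduction on the right -/

variable (k A) in
/-- The left multiplications by the second factor, inside the opposite of the enveloping
algebra. -/
noncomputable def rightMulOp : A →+* (A ⊗[k] Aᵐᵒᵖ)ᵐᵒᵖ :=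
  (rightMul k A).op.comp (RingEquiv.opOp A : A →+* Aᵐᵒᵖᵐᵒᵖ)

theorem rightMulOp_apply (c : A) :
    rightMulOp k A c = MulOpposite.op ((1 : A) ⊗ₜ[k] MulOpposite.op c) := rfl

theorem op_τ_rightMulOp (c : A) :
    RingHom.op (h.τ : A ⊗[k] Aᵐᵒᵖ →+* A) (rightMulOp k A c) =
      MulOpposite.op (algebraMap k A (h.aug c)) :=
  congrArg MulOpposite.op (h.τ_rightMul (MulOpposite.op c))

/-- The factors `1 ⊗ (b - ε(b))` and `a ⊗ 1` commute, so the identity used on the left also serves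
in the opposite ring. -/
theorem isReduction_right :
    IsReduction (RingHom.op (h.τ : A ⊗[k] Aᵐᵒᵖ →+* A)) (rightMulOp k A) where
  surjective a := by
    obtain ⟨r, hr⟩ := h.isReduction_left.surjective a.unop
    exact ⟨MulOpposite.op r, MulOpposite.unop_injective hr⟩
  ker := by
    have key : ∀ r, MulOpposite.op (r - h.τ r ⊗ₜ[k] (1 : Aᵐᵒᵖ)) ∈
        redSub (RingHom.op (h.τ : A ⊗[k] Aᵐᵒᵖ →+* A)) (rightMulOp k A) (A ⊗[k] Aᵐᵒᵖ)ᵐᵒᵖ := by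
      intro r
      induction r using TensorProduct.induction_on with
      | zero =>
        rw [map_zero, TensorProduct.zero_tmul, sub_zero]
        exact zero_mem _
      | add x y hx hy =>
        rw [map_add, TensorProduct.add_tmul, add_sub_add_comm, MulOpposite.op_add]
        exact add_mem hx hy
      | tmul a b =>
        refine AddSubgroup.subset_closure
          ⟨b.unop - algebraMap k A (h.augOp b), MulOpposite.op (a ⊗ₜ 1), ?_, ?_⟩
        · rw [op_τ_rightMulOp]
          change MulOpposite.op (algebraMap k A (h.aug (b.unop - algebraMap k A (h.aug b.unop)))) = 0
          rw [map_sub, AlgHom.commutes, Algebra.algebraMap_self_apply, sub_self, map_zero]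
          rfl
        · rw [rightMulOp_apply, smul_eq_mul, ← MulOpposite.op_mul]
          congr 1
          change a ⊗ₜ b - h.τ (a ⊗ₜ MulOpposite.op b.unop) ⊗ₜ 1 =
            a ⊗ₜ[k] (1 : Aᵐᵒᵖ) * (1 : A) ⊗ₜ[k] (b - algebraMap k Aᵐᵒᵖ (h.augOp b))
          rw [τ_tmul, Algebra.TensorProduct.tmul_mul_tmul, one_mul, mul_one,
            TensorProduct.tmul_sub, ← Algebra.commutes, ← Algebra.smul_def,
            TensorProduct.smul_tmul, Algebra.algebraMap_eq_smul_one (A := Aᵐᵒᵖ)]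
          rfl
    intro r hr
    have := key r.unop
    rwa [show h.τ r.unop = 0 from MulOpposite.op_injective hr, TensorProduct.zero_tmul,
      sub_zero] at this

theorem projZero_right_smul (r : (A ⊗[k] Aᵐᵒᵖ)ᵐᵒᵖ) (m : A) :
    projZero 𝒜 (r • m) = projZero 𝒜 m * projZero 𝒜 (h.τ r.unop) := by
  have key : ∀ r : A ⊗[k] Aᵐᵒᵖ, projZero 𝒜 (MulOpposite.op r • m) =
      projZero 𝒜 m * projZero 𝒜 (h.τ r) := by
    intro r
    induction r using TensorProduct.induction_on with
    | zero =>
      rw [MulOpposite.op_zero, zero_smul (A ⊗[k] Aᵐᵒᵖ)ᵐᵒᵖ m, map_zero, map_zero, map_zero,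
        mul_zero]
    | add x y hx hy =>
      rw [MulOpposite.op_add, add_smul, map_add, hx, hy, map_add, map_add, mul_add]
    | tmul a b =>
      change projZero 𝒜 (MulOpposite.op (a ⊗ₜ[k] MulOpposite.op b.unop) • m) =
        _ * projZero 𝒜 (h.τ (a ⊗ₜ[k] MulOpposite.op b.unop))
      rw [rightEnv_smul, τ_tmul, map_mul, map_mul, ← h.projZero_algebraMap_aug b.unop, ← map_mul,
        ← map_mul, ← map_mul, ← Algebra.commutes _ a, ← mul_assoc, Algebra.commutes _ m]
  exact key r.unop

theorem mem_redSub_right {m : A} (hm : projZero 𝒜 m = 0) :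
    m ∈ redSub (RingHom.op (h.τ : A ⊗[k] Aᵐᵒᵖ →+* A)) (rightMulOp k A) A := by
  refine AddSubgroup.subset_closure ⟨m, (1 : A), ?_, ?_⟩
  · rw [op_τ_rightMulOp, h.projZero_eq_zero_iff.1 hm, map_zero]
    rfl
  · rw [rightMulOp_apply, rightEnv_smul, mul_one, mul_one]

theorem projectiveOver_rightMulOp_self : ProjectiveOver (rightMulOp k A) A := by
  have : Module.compHom A (rightMulOp k A) = Semiring.toModule := Module.ext' _ _ fun c t => by
    change MulOpposite.op ((1 : A) ⊗ₜ[k] MulOpposite.op c) • t = c * t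
    rw [rightEnv_smul, mul_one]
  change @Module.Projective A _ A _ (Module.compHom A (rightMulOp k A))
  rw [this]
  infer_instance

/-- `envFlip` carries the action to multiplication on the first factor of `A ⊗ Aᵒᵖ`, which is free
over `A`. -/
theorem projectiveOver_rightMulOp_env :
    ProjectiveOver (rightMulOp k A) (A ⊗[k] Aᵐᵒᵖ)ᵐᵒᵖ := by
  let _ := Module.compHom (A ⊗[k] Aᵐᵒᵖ)ᵐᵒᵖ (rightMulOp k A)
  let e := (envFlip k A).symm
  refine Module.Projective.of_equiv' (R := A) (M := A ⊗[k] Aᵐᵒᵖ)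
    { e with map_smul' := fun c t => ?_ }
  change e (c • t) = rightMulOp k A c * e t
  have h1 : rightMulOp k A c = e (c ⊗ₜ 1) := by
    rw [AlgEquiv.eq_symm_apply, rightMulOp_apply]
    rfl
  rw [h1, ← map_mul]
  congr 1
  induction t using TensorProduct.induction_on with
  | zero => rw [smul_zero, mul_zero]
  | add s t hs ht => rw [smul_add, mul_add, hs, ht]
  | tmul a b =>
    rw [Algebra.TensorProduct.tmul_mul_tmul, one_mul]
    rfl

end IsConnected
end Connected
section ExtComparison

variable {R : Type u} [Ring R] {𝓡 : ℤ → AddSubgroup R} [GradedRing 𝓡]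
variable {S : Type u} [Ring S] {𝓢 : ℤ → AddSubgroup S} [GradedRing 𝓢]

open CategoryTheory

/-! ### Ext and minimal resolutions -/

namespace Aug

variable {K : Type*} [Field K] (a : Aug 𝓡 K) {M : GrMod 𝓡} {P : ProjRes M}
  {ι : ℕ → Type*} (B : ∀ i, GrMod.HBasis (P.X i) (ι i))
  (hd : ∀ n x, (P.d n).toLin x ∈ a.sub (P.X n))
include hd B

/-- A coordinate function times a nonzero `y` is a cocycle, as `d` has values in `R₊P` and `R₊`
kills `N`. For the same reason every coboundary vanishes, so this cocycle would have to be zero. -/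
theorem isEmpty_of_subsingleton_ext {N : Type u} [AddCommGroup N] [Module R N] [Nontrivial N]
    (hN : ∀ r, a.hom r = 0 → ∀ y : N, r • y = 0) {m : ℕ}
    (h : Subsingleton (Abelian.Ext (ModuleCat.of R M.carrier) (ModuleCat.of R N) (m + 1))) :
    IsEmpty (ι (m + 1)) := by
  refine ⟨fun v => ?_⟩
  obtain ⟨y, hy⟩ := exists_ne (0 : N)
  let f : (P.X (m + 1)).carrier →ₗ[R] N := ((B (m + 1)).b.coord v).smulRight y
  have hf : ∀ x, f x = (B (m + 1)).b.repr x v • y := fun x => rfl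
  obtain ⟨g, hg⟩ : ∃ g : (P.X m).carrier →ₗ[R] N, g ∘ₗ (P.d m).toLin = f :=
    ((P.toRes B).subsingleton_ext_succ_iff m).1 h f (by
    refine LinearMap.ext fun x => (hf ((P.d (m + 1)).toLin x)).trans (hN _ ?_ _)
    exact (a.mem_sub_iff (B (m + 1))).1 (hd (m + 1) x) v)
  have hsub : ∀ x ∈ a.sub (P.X m), g x = 0 := by
    intro x hx
    induction hx using Submodule.span_induction with
    | mem x hx =>
      obtain ⟨r, z, hr, rfl⟩ := hx
      rw [map_smul]
      exact hN r hr _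
    | zero => exact map_zero g
    | add x y _ _ hx hy => rw [map_add, hx, hy, add_zero]
    | smul r x _ hx => rw [map_smul, hx, smul_zero]
  have h1 : g ((P.d m).toLin ((B (m + 1)).b v)) = f ((B (m + 1)).b v) :=
    LinearMap.congr_fun hg ((B (m + 1)).b v)
  rw [hsub _ (hd m _), hf, Module.Basis.repr_self, Finsupp.single_eq_same, one_smul] at h1
  exact hy h1.symm

/-- At the top of the resolution a coordinate function is a cocycle with value 1, while coboundaries
have values in the augmentation ideal. The isomorphism `e` allows `A` in place of `Aᵒᵖ` as a right
module. -/
theorem not_subsingleton_ext {N : Type u} [AddCommGroup N] [Module R N] (e : N ≃ₗ[R] R) {m : ℕ}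
    [Subsingleton (P.X (m + 2)).carrier] (v : ι (m + 1)) :
    ¬ Subsingleton (Abelian.Ext (ModuleCat.of R M.carrier) (ModuleCat.of R N) (m + 1)) := by
  intro h
  let f : (P.X (m + 1)).carrier →ₗ[R] N := e.symm.toLinearMap ∘ₗ (B (m + 1)).b.coord v
  obtain ⟨g, hg⟩ : ∃ g : (P.X m).carrier →ₗ[R] N, g ∘ₗ (P.d m).toLin = f :=
    ((P.toRes B).subsingleton_ext_succ_iff m).1 h f (by
    refine LinearMap.ext fun x => ?_
    have : x = 0 := Subsingleton.elim (α := (P.X (m + 2)).carrier) x 0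
    rw [this, map_zero, map_zero])
  have h1 : g ((P.d m).toLin ((B (m + 1)).b v)) = e.symm ((B (m + 1)).b.coord v ((B (m + 1)).b v)) :=
    LinearMap.congr_fun hg ((B (m + 1)).b v)
  have h2 := a.hom_apply_of_mem_sub (P := P.X m) (e.toLinearMap ∘ₗ g) (hd m ((B (m + 1)).b v))
  have h3 : (e.toLinearMap ∘ₗ g) ((P.d m).toLin ((B (m + 1)).b v)) = 1 := by
    refine (congrArg e h1).trans ?_
    rw [LinearEquiv.apply_symm_apply, Module.Basis.coord_apply, Module.Basis.repr_self,
      Finsupp.single_eq_same]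
  rw [h3, map_one] at h2
  exact one_ne_zero h2

end Aug

/-! ### Graded and ungraded Ext -/

/-- With a finite basis a linear map is a finite sum of coordinate functions times values, and the
values split into homogeneous components. Graded and ungraded Hom, hence Ext, then coincide. -/
theorem GrMod.HBasis.mem_gradedHomSubmodule {X : GrMod 𝓡} {ι : Type*} [Finite ι]
    (B : GrMod.HBasis X ι) (N : GrBimod 𝓡 𝓢) (f : X.carrier →ₗ[R] N.carrier) :
    f ∈ gradedHomSubmodule X N := by
  have _ := Fintype.ofFinite ι
  have key : ∀ v (y : N.carrier), (B.b.coord v).smulRight y ∈ ⨆ j, homDeg X N j := by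
    intro v y
    refine dinduction N.isInternal
      (p := fun y => (B.b.coord v).smulRight y ∈ ⨆ j, homDeg X N j) y ?_ ?_
    · intro l y hy
      refine AddSubgroup.mem_iSup_of_mem (l - B.e v) fun i x hx => ?_
      have := N.smul_mem (B.mem_deg_iff.1 hx v) hy
      rw [show i - B.e v + l = i + (l - B.e v) by ring] at this
      exact this
    · intro y z hy hz
      have : (B.b.coord v).smulRight (y + z) =
          (B.b.coord v).smulRight y + (B.b.coord v).smulRight z := by
        ext x
        exact smul_add _ _ _
      rw [this]
      exact add_mem hy hz
  have : f = ∑ v, (B.b.coord v).smulRight (f (B.b v)) := by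
    ext x
    rw [LinearMap.sum_apply]
    conv_lhs => rw [← B.b.sum_repr x, map_sum]
    exact Finset.sum_congr rfl fun v _ => map_smul f _ _
  rw [this, GradedCY.mem_gradedHomSubmodule]
  exact sum_mem fun v _ => key v _

namespace ProjRes.Concentrated

variable {M : GrMod 𝓡} {P : ProjRes M} {N : GrBimod 𝓡 𝓢} {n : ℕ} {E : GrMod 𝓢}
  {ψ : P.cocycles N n →ₗ[S] E.carrier} (h : P.Concentrated N n E ψ)
  {ι : ℕ → Type*} (B : ∀ i, GrMod.HBasis (P.X i) (ι i)) [∀ i, Finite (ι i)]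
include h B

theorem subsingleton_ext {i : ℕ} (hi : i ≠ n) :
    Subsingleton (Abelian.Ext (ModuleCat.of R M.carrier) (ModuleCat.of R N.carrier) i) := by
  have hc : ∀ f ∈ (P.toRes B).cocycles N.carrier i, (⟨f, (B i).mem_gradedHomSubmodule N f⟩ :
      (gradedHom (P.X i) N).carrier) ∈ P.coboundaries N i := fun f hf =>
    h.exact i hi ((ProjRes.mem_cocycles N).2 fun x => LinearMap.congr_fun hf x)
  cases i with
  | zero =>
    refine (P.toRes B).subsingleton_ext_zero fun f hf => ?_
    exact congrArg Subtype.val ((ProjRes.mem_coboundaries_zero N).1 (hc f hf))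
  | succ i =>
    refine ((P.toRes B).subsingleton_ext_succ_iff i).2 fun f hf => ?_
    obtain ⟨g, hg⟩ := (ProjRes.mem_coboundaries_succ N).1 (hc f hf)
    exact ⟨g.1, LinearMap.ext hg⟩

theorem extIso [SMulCommClass S R N.carrier] (hn : 1 ≤ n) :
    ExtIso R S M.carrier N.carrier E.carrier n := by
  obtain ⟨m, rfl⟩ := Nat.exists_eq_add_of_le' hn
  let j : (P.toRes B).cocycles N.carrier (m + 1) → P.cocycles N (m + 1) := fun f =>
    ⟨⟨f.1, (B (m + 1)).mem_gradedHomSubmodule N f.1⟩,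
      (ProjRes.mem_cocycles N).2 fun x => LinearMap.congr_fun f.2 x⟩
  refine (P.toRes B).extIso m
    { toFun := fun f => ψ (j f)
      map_zero' := map_zero ψ
      map_add' := fun f g => map_add ψ (j f) (j g) } ?_ ?_ ?_
  · intro y
    obtain ⟨c, rfl⟩ := h.surjective y
    exact ⟨⟨c.1.1, LinearMap.ext ((ProjRes.mem_cocycles N).1 c.2)⟩, rfl⟩
  · intro f
    refine (h.eq_zero_iff (j f)).trans ((ProjRes.mem_coboundaries_succ N).trans ?_)
    constructor
    · rintro ⟨g, hg⟩
      exact ⟨g.1, LinearMap.ext hg⟩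
    · rintro ⟨g, hg⟩
      exact ⟨⟨g, (B m).mem_gradedHomSubmodule N g⟩, LinearMap.congr_fun hg⟩
  · intro s f f' hff'
    have : j f' = s • j f := Subtype.ext (Subtype.ext hff')
    exact (congrArg ψ this).trans (map_smul ψ s _)

end ProjRes.Concentrated

end ExtComparison

/-! ### Change of rings along an isomorphism -/

/-- Transport of a resolution along a ring isomorphism. -/
noncomputable def Res.ofRingEquiv {R R' : Type u} [Ring R] [Ring R'] (σ : R' ≃+* R) {M M' : Type u}
    [AddCommGroup M] [Module R M] [AddCommGroup M'] [Module R' M'] (P : Res R M) (e : M ≃+ M')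
    (he : ∀ (r : R') m, e (σ r • m) = r • e m) : Res R' M' where
  X n := @ModuleCat.of R' _ (P.X n) _ (Module.compHom _ (σ : R' →+* R))
  d n :=
    let _ := Module.compHom (P.X (n + 1)) (σ : R' →+* R)
    let _ := Module.compHom (P.X n) (σ : R' →+* R)
    { toFun := P.d n
      map_add' := map_add _
      map_smul' := fun r x => map_smul (P.d n) (σ r) x }
  ε :=
    let _ := Module.compHom (P.X 0) (σ : R' →+* R)
    { toFun := fun x => e (P.ε x)
      map_add' := fun x y => by rw [map_add, map_add]
      map_smul' := fun r x => (congrArg e (map_smul P.ε (σ r) x)).trans (he r _) }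
  projective n := by
    let _ := Module.compHom (P.X n) (σ : R' →+* R)
    have := P.projective n
    let f : R →+* R' := σ.symm
    let _ : RingHomInvPair f (σ : R' →+* R) := ⟨by ext; simp [f], by ext; simp [f]⟩
    let _ : RingHomInvPair (σ : R' →+* R) f := ⟨by ext; simp [f], by ext; simp [f]⟩
    exact Module.Projective.of_equiv (σ := f)
      { AddEquiv.refl (P.X n) with
        map_smul' := fun r x => by
          change r • x = σ (σ.symm r) • x
          rw [RingEquiv.apply_symm_apply] }
  surjective := e.surjective.comp P.surjective
  exact_zero x := (e.map_eq_zero_iff (x := P.ε x)).trans (P.exact_zero x)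
  exact_succ n := P.exact_succ n

/-! ### Passage to the opposite algebra -/

section Opposite

variable {k : Type v} [Field k] {A : Type u} [Ring A] [Algebra k A]

attribute [local instance] leftEnvModule

variable (k A) in
/-- The isomorphism between the enveloping algebras of `Aᵒᵖ` and of `A`. -/
noncomputable def envOpEquiv : Aᵐᵒᵖ ⊗[k] Aᵐᵒᵖᵐᵒᵖ ≃ₐ[k] A ⊗[k] Aᵐᵒᵖ :=
  (Algebra.TensorProduct.congr AlgEquiv.refl (AlgEquiv.opOp k A).symm).trans
    (Algebra.TensorProduct.comm k Aᵐᵒᵖ A)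

theorem envOpEquiv_smul (r : Aᵐᵒᵖ ⊗[k] Aᵐᵒᵖᵐᵒᵖ) (m : A) :
    MulOpposite.op (envOpEquiv k A r • m) = r • MulOpposite.op m := by
  induction r using TensorProduct.induction_on with
  | zero =>
    rw [map_zero, zero_smul (A ⊗[k] Aᵐᵒᵖ) m, zero_smul (Aᵐᵒᵖ ⊗[k] Aᵐᵒᵖᵐᵒᵖ) (MulOpposite.op m)]
    rfl
  | add x y hx hy => rw [map_add, add_smul, MulOpposite.op_add, hx, hy, add_smul]
  | tmul a b =>
    have h1 : envOpEquiv k A (a ⊗ₜ b) = b.unop.unop ⊗ₜ MulOpposite.op a.unop := rfl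
    have h2 : a ⊗ₜ[k] b = a ⊗ₜ[k] MulOpposite.op b.unop := rfl
    rw [h1, leftEnv_smul, h2, leftEnv_smul, mul_assoc]
    rfl

/-- The resolution of the bimodule `Aᵒᵖ` obtained from a resolution of the bimodule `A`. -/
noncomputable def Res.opBimodule (P : Res (A ⊗[k] Aᵐᵒᵖ) A) : Res (Aᵐᵒᵖ ⊗[k] Aᵐᵒᵖᵐᵒᵖ) Aᵐᵒᵖ :=
  P.ofRingEquiv (envOpEquiv k A).toRingEquiv MulOpposite.opAddEquiv envOpEquiv_smul

end Opposite
/-! ### Resolutions of the bimodule `A` -/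

section

variable {R : Type u} [Ring R] {𝓡 : ℤ → AddSubgroup R} [GradedRing 𝓡]
variable {S : Type u} [Ring S] {𝓢 : ℤ → AddSubgroup S} [GradedRing 𝓢]

theorem ProjRes.Concentrated.not_subsingleton {M : GrMod 𝓡} {P : ProjRes M} {N : GrBimod 𝓡 𝓢}
    {n : ℕ} {E : GrMod 𝓢} {ψ : P.cocycles N n →ₗ[S] E.carrier} (h : P.Concentrated N n E ψ)
    [Nontrivial E.carrier] : ¬ Subsingleton (P.X n).carrier := by
  intro hs
  obtain ⟨y, hy⟩ := exists_ne (0 : E.carrier)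
  obtain ⟨c, rfl⟩ := h.surjective y
  refine hy ?_
  have : c = 0 := Subtype.ext ((ProjRes.gradedHom_ext_iff N).2 fun x => by
    rw [Subsingleton.elim x 0, map_zero, map_zero])
  rw [this, map_zero]

theorem GrMod.HBasis.nonempty_of_not_subsingleton {P : GrMod 𝓡} {ι : Type*} (B : GrMod.HBasis P ι)
    (h : ¬ Subsingleton P.carrier) : Nonempty ι := by
  by_contra hι
  rw [not_nonempty_iff] at hι
  exact h B.b.repr.injective.subsingleton

theorem Aug.isEmpty_of_subsingleton {K : Type*} [Field K] (a : Aug 𝓡 K) {P : GrMod 𝓡} {ι : Type*}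
    (B : GrMod.HBasis P ι) [Subsingleton P.carrier] : IsEmpty ι :=
  ⟨fun v => a.basis_notMem_sub B v (by
    rw [Subsingleton.elim (B.b v) 0]
    exact zero_mem _)⟩

theorem Aug.exists_minimal {K : Type*} [Field K] (a : Aug 𝓡 K) (M : GrMod 𝓡) {c : ℤ}
    (hc : ∀ i < c, ∀ x ∈ M.deg i, x = 0) :
    ∃ (P : ProjRes M) (ι : ℕ → Type u) (B : ∀ n, GrMod.HBasis (P.X n) (ι n)),
      (∀ n j, c ≤ (B n).e j) ∧ ∀ n x, (P.d n).toLin x ∈ a.sub (P.X n) := by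
  obtain ⟨P, ι, B, he, h0, h1⟩ := a.exists_resolution M hc
  refine ⟨P, ι, B, he, fun n x => ?_⟩
  cases n with
  | zero => exact h0 (P.ε_d x)
  | succ n => exact h1 n (P.d_d n x)

/-- Minimal resolutions are graded free if one of them is. -/
theorem ProjRes.exists_hbasis {K : Type*} [Field K] (a : Aug 𝓡 K) {M : GrMod 𝓡} {P P' : ProjRes M}
    (hP : P.IsMinimal) (hP' : P'.IsMinimal) {ι : ℕ → Type u}
    (B : ∀ n, GrMod.HBasis (P.X n) (ι n)) (hd : ∀ n x, (P.d n).toLin x ∈ a.sub (P.X n)) :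
    ∃ _ : ∀ n, GrMod.HBasis (P'.X n) (ι n), ∀ n x, (P'.d n).toLin x ∈ a.sub (P'.X n) := by
  obtain ⟨f⟩ := exists_chainMap P P'
  refine ⟨fun n => (B n).ofIso ((f.f n).toIso (f.bijective hP hP' n)), fun n x => ?_⟩
  obtain ⟨x, rfl⟩ := (f.bijective hP hP' (n + 1)).2 x
  rw [f.d]
  exact a.map_mem_sub _ (hd n x)

-- Projective dimensions bound the injective dimension from above; one nonzero Ext in degree `n`
-- bounds it from below.
open CategoryTheory in
theorem injectiveDimension_eq {X M : ModuleCat.{u} R} {n : ℕ}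
    (h : ∀ M : ModuleCat.{u} R, HasProjectiveDimensionLT M (n + 1))
    (hM : ¬ Subsingleton (Abelian.Ext M X n)) : injectiveDimension X = n := by
  refine le_antisymm ((injectiveDimension_le_iff X n).2 ?_) ((injectiveDimension_ge_iff X n).2 ?_)
  · refine (hasInjectiveDimensionLT_iff X (n + 1)).2 fun i hi Y e => ?_
    have := h Y
    exact e.eq_zero_of_hasProjectiveDimensionLT (n + 1) hi
  · intro hX
    rw [hasInjectiveDimensionLT_iff] at hX
    exact hM ⟨fun x y => (hX n le_rfl x).trans (hX n le_rfl y).symm⟩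

end

/-! ### Consequences of the Calabi-Yau condition -/

section CalabiYau

variable {k : Type v} [Field k] {A : Type u} [Ring A] [Algebra k A]

-- Tensoring with `M` over `A` produces a projective resolution of `M` that is no longer than `P`.
attribute [local instance] leftEnvModule in
open CategoryTheory in
theorem Res.hasProjectiveDimensionLT_of_bimodule (P : Res (A ⊗[k] Aᵐᵒᵖ) A) {n : ℕ}
    (hP : ∀ i, n < i → Subsingleton (P.X i)) (M : ModuleCat.{u} A) :
    HasProjectiveDimensionLT M (n + 1) := by
  let _ : Module k M := Module.compHom M (algebraMap k A)
  have : IsScalarTower k A M := ⟨fun c a m => by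
    rw [Algebra.smul_def, mul_smul]
    rfl⟩
  obtain ⟨Q, hQ⟩ := P.exists_tensor (M := M)
  exact Q.hasProjectiveDimensionLT fun i hi => hQ i (hP i hi)

variable {𝒜 : ℕ → Submodule k A} [GradedAlgebra 𝒜]

namespace IsConnected

open CategoryTheory

variable (h : IsConnected 𝒜)
include h

theorem nontrivial_trivialLeft : Nontrivial (trivialLeft 𝒜).carrier := by
  have := h.1
  refine ⟨⟨(1 : 𝒜 0), (0 : 𝒜 0), fun h0 => ?_⟩⟩
  exact one_ne_zero (congrArg Subtype.val h0)

theorem smul_trivialLeft {r : A} (hr : h.aug r = 0) (y : (trivialLeft 𝒜).carrier) : r • y = 0 := by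
  have : projZero 𝒜 r = 0 := h.projZero_eq_zero_iff.2 hr
  change projZero 𝒜 r * (show 𝒜 0 from y) = 0
  rw [this, zero_mul]

/-- The reduction of a resolution of the bimodule `A` is a resolution of the trivial module. -/
theorem exists_reduction_left {P : ProjRes (leftBimodule 𝒜)} {ι : ℕ → Type u}
    (B : ∀ n, GrMod.HBasis (P.X n) (ι n))
    (hd : ∀ n x, (P.d n).toLin x ∈ h.augE.sub (P.X n)) :
    ∃ (F : ProjRes (trivialLeft 𝒜)) (B' : ∀ n, GrMod.HBasis (F.X n) (ι n)),
      (∀ n, (B' n).e = (B n).e) ∧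
      (∀ n x, (F.d n).toLin ((B (n + 1)).red (B' (n + 1)) (h.τ : A ⊗[k] Aᵐᵒᵖ →+* A) x) =
        (B n).red (B' n) (h.τ : A ⊗[k] Aᵐᵒᵖ →+* A) ((P.d n).toLin x)) ∧
      ∀ n x, (F.d n).toLin x ∈ h.augA.sub (F.X n) := by
  obtain ⟨F, B', he, hF⟩ := P.exists_reduction B h.isReduction_left (fun i r hr => h.τ_mem hr)
    projectiveOver_rightMul_env (projectiveOver_rightMul_self (k := k) (A := A)) (M' := trivialLeft 𝒜)
    (projZero 𝒜).toAddMonoidHom h.projZero_left_smul (projZero_surjective (A := A))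
    (fun m hm => h.mem_redSub_left hm) (fun i m hm => projZero_mem hm)
  refine ⟨F, B', he, hF, fun n x => ?_⟩
  obtain ⟨x, rfl⟩ := (B (n + 1)).red_surjective (B' (n + 1)) h.isReduction_left.surjective x
  rw [hF, h.augA.mem_sub_iff (B' n)]
  intro v
  rw [GrMod.HBasis.red_repr]
  exact (h.augE.mem_sub_iff (B n)).1 (hd n x) v

/-- The trivial module has projective dimension at most `D`, and its minimal resolution detects this
through Ext with values in the trivial module itself. -/
theorem isEmpty_basis {D : ℕ} (hD : globalDimension A = (D : WithBot ℕ∞))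
    {F : ProjRes (trivialLeft 𝒜)} {ι : ℕ → Type u} (B : ∀ n, GrMod.HBasis (F.X n) (ι n))
    (hd : ∀ n x, (F.d n).toLin x ∈ h.augA.sub (F.X n)) {i : ℕ} (hi : D < i) : IsEmpty (ι i) := by
  obtain ⟨m, rfl⟩ := Nat.exists_eq_add_of_le' (show 1 ≤ i by omega)
  have := h.nontrivial_trivialLeft
  refine h.augA.isEmpty_of_subsingleton_ext B hd (N := (trivialLeft 𝒜).carrier)
    (fun r hr y => h.smul_trivialLeft hr y) ?_
  let X := ModuleCat.of A (trivialLeft 𝒜).carrier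
  have h1 : projectiveDimension X ≤ (D : WithBot ℕ∞) := hD ▸ le_iSup projectiveDimension X
  have := (projectiveDimension_le_iff X D).1 h1
  exact ⟨fun x y => (Abelian.Ext.eq_zero_of_hasProjectiveDimensionLT x (D + 1) hi).trans
    (Abelian.Ext.eq_zero_of_hasProjectiveDimensionLT y (D + 1) hi).symm⟩

theorem exists_smul_one (ℓ : ℤ) (y : ((rightBimodule 𝒜).shift ℓ).carrier) :
    ∃ s : (A ⊗[k] Aᵐᵒᵖ)ᵐᵒᵖ, y = s • (show ((rightBimodule 𝒜).shift ℓ).carrier from (1 : A)) :=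
  ⟨MulOpposite.op ((show A from y) ⊗ₜ[k] MulOpposite.op 1), by
    exact ((rightEnv_smul k A y 1 1).trans ((congrArg (· * (show A from y)) (one_mul 1)).trans (one_mul _))).symm⟩

/-- The minimal resolution of the bimodule `A`. -/
theorem exists_finite_resolution {n : ℕ} {ℓ : ℤ} (hCY : IsLeftGradedCalabiYau 𝒜 n ℓ) {D : ℕ}
    (hD : globalDimension A = (D : WithBot ℕ∞)) :
    n ≤ D ∧ 0 ≤ ℓ ∧ ∃ (P : ProjRes (leftBimodule 𝒜)) (ι : ℕ → Type u)
      (_ : ∀ n, GrMod.HBasis (P.X n) (ι n)),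
      (∀ n x, (P.d n).toLin x ∈ h.augE.sub (P.X n)) ∧ (∀ i, Finite (ι i)) ∧
      ∀ i, n < i → Subsingleton (P.X i).carrier := by
  have hA := h.1
  obtain ⟨P, ι, B, he, hd⟩ := h.augE.exists_minimal (leftBimodule 𝒜) (c := 0) fun i hi x hx => by
    obtain ⟨h0, -⟩ | h0 := (mem_intGrading (A := A)).1 hx
    · omega
    · exact h0
  obtain ⟨P', he', hP'⟩ := hCY.2
  obtain ⟨ψ', hψ'⟩ := ProjRes.exists_concentrated he' hP'
  obtain ⟨ψ, hψ⟩ := hψ'.transfer P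
  obtain ⟨F, B', -, -, hdF⟩ := h.exists_reduction_left B hd
  have hEn : Nontrivial ((rightBimodule 𝒜).shift ℓ).carrier := hA
  have hXn := hψ.not_subsingleton
  have hempty : ∀ i, D < i → IsEmpty (ι i) := fun i hi => h.isEmpty_basis hD B' hdF hi
  have h0 := h.augE.subsingleton_of_bounded hd hψ B (m := D) fun i hi => by
    have := hempty i hi
    exact (B i).b.repr.injective.subsingleton
  have hs := h0 (n + 1) (Nat.lt_succ_self n)
  -- Descending induction from `n`, where cyclicity of `A(ℓ)` leaves at most one generator.
  have hfin : ∀ l i, i + l = n → Finite (ι i) := by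
    intro l
    induction l with
    | zero =>
      rintro i rfl
      have := h.augE.subsingleton_basis_top hd hψ B (h.exists_smul_one ℓ)
      infer_instance
    | succ l ih =>
      intro i hi
      have := ih (i + 1) (by omega)
      exact h.augE.finite_of_succ hd hψ B (by omega)
  obtain ⟨v⟩ := (B n).nonempty_of_not_subsingleton hXn
  refine ⟨?_, ?_, P, ι, B, hd, fun i => ?_, h0⟩
  · by_contra hlt
    exact (hempty n (not_le.1 hlt)).false v
  · by_contra hlt
    have hcoc : (B n).coord v ∈ P.cocycles (regular (envInt 𝒜)) n := by
      rw [ProjRes.mem_cocycles]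
      intro x
      rw [Subsingleton.elim x 0, map_zero, map_zero]
    -- If `ℓ < 0`, the class of this coordinate function has degree `ℓ - e v < 0` in `A`, so it
    -- vanishes and the function is a coboundary.
    refine h.augE.coord_notMem_coboundaries hd (B n) v ((hψ.eq_zero_iff ⟨_, hcoc⟩).1 ?_)
    have h1 : ψ ⟨_, hcoc⟩ ∈ intGrading 𝒜 (-(B n).e v + ℓ) := hψ.deg _ _ ((B n).coord_mem v)
    have h2 := he n v
    obtain ⟨h3, -⟩ | h3 := (mem_intGrading (A := A)).1 h1
    · omega
    · exact h3
  · rcases le_or_gt i n with hi | hi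
    · exact hfin (n - i) i (by omega)
    · have := h0 i hi
      have := h.augE.isEmpty_of_subsingleton (B i)
      infer_instance

/-- The dual of a minimal resolution of the bimodule `A`. -/
theorem exists_dual_resolution {n : ℕ} {ℓ : ℤ} (hCY : IsLeftGradedCalabiYau 𝒜 n ℓ)
    {P : ProjRes (leftBimodule 𝒜)} {ι : ℕ → Type u} (B : ∀ n, GrMod.HBasis (P.X n) (ι n))
    (hd : ∀ n x, (P.d n).toLin x ∈ h.augE.sub (P.X n)) [∀ i, Finite (ι i)]
    (h0 : ∀ i, n < i → Subsingleton (P.X i).carrier) :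
    ∃ (Q : ProjRes ((rightBimodule 𝒜).shift ℓ)) (κ : ℕ → Type u)
      (_ : ∀ i, GrMod.HBasis (Q.X i) (κ i)), (∀ i, Finite (κ i)) ∧ Q.IsMinimal ∧ IsDual n P Q := by
  obtain ⟨P', he', hP'⟩ := hCY.2
  obtain ⟨ψ', hψ'⟩ := ProjRes.exists_concentrated he' hP'
  obtain ⟨ψ, hψ⟩ := hψ'.transfer P
  obtain ⟨Q, κ, C, hκ, hdQ, hPQ⟩ := hψ.exists_dual hCY.1 h0 B h.augE hd
  exact ⟨Q, κ, C, hκ, h.augE.op.isMinimal C (fun i => exists_bound _) hdQ, hPQ⟩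

/-- Reducing `P` and its dual gives the left Ext. The reduced resolution `F` of `k` is again minimal
and finite free with concentrated dual, so duality over `A` gives the right Ext from the left one.
-/
theorem isASGorenstein {n : ℕ} (hn : 1 ≤ n) {ℓ : ℤ}
    {P : ProjRes (leftBimodule 𝒜)} {ι : ℕ → Type u} (B : ∀ n, GrMod.HBasis (P.X n) (ι n))
    (hd : ∀ n x, (P.d n).toLin x ∈ h.augE.sub (P.X n)) [∀ i, Finite (ι i)]
    {Q : ProjRes ((rightBimodule 𝒜).shift ℓ)} {κ : ℕ → Type u}
    (C : ∀ i, GrMod.HBasis (Q.X i) (κ i)) (hPQ : IsDual n P Q) : IsASGorenstein 𝒜 n ℓ := by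
  obtain ⟨F, B', he, hF, hdF⟩ := h.exists_reduction_left B hd
  have hNl : Nontrivial (trivialLeft 𝒜).carrier := h.nontrivial_trivialLeft
  have hNr : Nontrivial ((trivialRight 𝒜).shift ℓ).carrier := hNl
  obtain ⟨ψ, hψ⟩ := ProjRes.exists_concentrated_reduction B B' he hF hn hPQ C
    h.isReduction_right projectiveOver_rightMulOp_env
    (projectiveOver_rightMulOp_self (k := k) (A := A))
    (N' := (trivialRight 𝒜).shift ℓ) (projZero 𝒜).toAddMonoidHom h.projZero_right_smul
    (projZero_surjective (A := A)) (fun m hm => h.mem_redSub_right hm) (fun i m hm => projZero_mem hm)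
  have hFX : ∀ i, n < i → Subsingleton (F.X i).carrier := fun i hi => by
    have := hPQ.subsingleton_left i hi
    have := h.augE.isEmpty_of_subsingleton (B i)
    exact (B' i).b.repr.injective.subsingleton
  obtain ⟨G, κ', C', hκ', hdG, hFG⟩ := hψ.exists_dual hn hFX B' h.augA hdF
  obtain ⟨ψ', hψ'⟩ := hFG.exists_concentrated hn B'
  obtain ⟨ψ'', hψ''⟩ := hψ'.unshift
  obtain ⟨v⟩ := (B' n).nonempty_of_not_subsingleton hψ.not_subsingleton
  obtain ⟨w⟩ := (C' n).nonempty_of_not_subsingleton hψ'.not_subsingleton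
  have hPX := hPQ.subsingleton_left
  have hs := hFX (n + 1) (Nat.lt_succ_self n)
  have hs' := hFG.subsingleton_right (n + 1) (Nat.lt_succ_self n)
  obtain ⟨m, rfl⟩ := Nat.exists_eq_add_of_le' hn
  refine ⟨?_, ?_, hψ.extConcentrated, hψ''.extConcentrated⟩
  · exact injectiveDimension_eq ((P.toRes B).hasProjectiveDimensionLT_of_bimodule hPX)
      (h.augA.not_subsingleton_ext B' hdF (LinearEquiv.refl A A) v)
  -- Right modules over `A` are left modules over `Aᵒᵖ`, whose bimodule resolution has the same
  -- length.
  · exact injectiveDimension_eq ((P.toRes B).opBimodule.hasProjectiveDimensionLT_of_bimodule hPX)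
      (h.augA.op.not_subsingleton_ext C' hdG
        { MulOpposite.opAddEquiv with map_smul' := fun _ _ => rfl } w)

end IsConnected
end CalabiYau
end GradedCY

/-! ### Assembly of the six assertions -/

theorem mainTheorem5 {k : Type v} [Field k] {A : Type u} [Ring A] [Algebra k A]
    (𝒜 : ℕ → Submodule k A) [GradedAlgebra 𝒜] (hconn : GradedCY.IsConnected 𝒜)
    (n : ℕ) (ℓ : ℤ) (hCY : GradedCY.IsLeftGradedCalabiYau 𝒜 n ℓ)
    (D : ℕ) (hD : GradedCY.globalDimension A = (D : WithBot ℕ∞)) :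
    n = D ∧
    (∃ P : GradedCY.ProjRes (GradedCY.leftBimodule 𝒜),
      (∀ i, (P.X i).IsFiniteFree) ∧ ∀ i, n < i → Subsingleton (P.X i).carrier) ∧
    (∀ P : GradedCY.ProjRes (GradedCY.leftBimodule 𝒜), P.IsMinimal →
      ∃ Q : GradedCY.ProjRes ((GradedCY.rightBimodule 𝒜).shift ℓ),
        Q.IsMinimal ∧ GradedCY.IsDual n P Q) ∧
    (GradedCY.IsASGorenstein 𝒜 n ℓ ∧ 0 ≤ ℓ) ∧
    GradedCY.IsRightGradedCalabiYau 𝒜 n ℓ ∧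
    (GradedCY.IsLeftCalabiYau k A n ∧ GradedCY.IsRightCalabiYau k A n) := by
  obtain ⟨hnD, hℓ, P, ι, B, hd, hι, h0⟩ := hconn.exists_finite_resolution hCY hD
  obtain ⟨Q, κ, C, hκ, hQ, hPQ⟩ := hconn.exists_dual_resolution hCY B hd h0
  obtain ⟨P', he', hP'⟩ := hCY.2
  obtain ⟨ψ', hψ'⟩ := GradedCY.ProjRes.exists_concentrated he' hP'
  obtain ⟨ψ, hψ⟩ := hψ'.transfer P
  obtain ⟨φ, hφ⟩ := hPQ.exists_concentrated hCY.1 B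
  refine ⟨le_antisymm hnD ?_, ⟨P, fun i => (B i).isFiniteFree, h0⟩, fun P₁ hP₁ => ?_,
    ⟨hconn.isASGorenstein hCY.1 B hd C hPQ, hℓ⟩, ⟨hCY.1, ?_⟩, ⟨hCY.1, ?_, fun i hi => ?_⟩,
    ⟨hCY.1, ?_, fun i hi => ?_⟩⟩
  · have h1 : GradedCY.globalDimension A ≤ (n : WithBot ℕ∞) := iSup_le fun M =>
      (CategoryTheory.projectiveDimension_le_iff M n).2
        ((P.toRes B).hasProjectiveDimensionLT_of_bimodule h0 M)
    rw [hD] at h1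
    exact_mod_cast h1
  -- An arbitrary minimal resolution is isomorphic to `P`, so it inherits finite homogeneous bases
  -- and the vanishing above `n`, and can be dualised directly.
  · obtain ⟨B₁, hd₁⟩ := GradedCY.ProjRes.exists_hbasis hconn.augE
      (hconn.augE.isMinimal B (fun i => GradedCY.exists_bound _) hd) hP₁ B hd
    have h1 : ∀ i, n < i → Subsingleton (P₁.X i).carrier := fun i hi => by
      have := h0 i hi
      have := hconn.augE.isEmpty_of_subsingleton (B i)
      exact (B₁ i).b.repr.injective.subsingleton
    obtain ⟨Q₁, κ₁, C₁, -, hQ₁, hPQ₁⟩ := hconn.exists_dual_resolution hCY B₁ hd₁ h1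
    exact ⟨Q₁, hQ₁, hPQ₁⟩
  -- `Q` resolves `A(ℓ)` and its dual computes `A`; unshifting moves `ℓ` from the argument to the
  -- value of Ext.
  · obtain ⟨φ', hφ'⟩ := hφ.unshift
    exact hφ'.extConcentrated
  · have := SMulCommClass.symm (A ⊗[k] Aᵐᵒᵖ) (A ⊗[k] Aᵐᵒᵖ)ᵐᵒᵖ
      (GradedCY.regular (GradedCY.envInt 𝒜)).carrier
    exact hψ.extIso B hCY.1
  · exact hψ.subsingleton_ext B hi
  · have := SMulCommClass.symm (A ⊗[k] Aᵐᵒᵖ)ᵐᵒᵖ (A ⊗[k] Aᵐᵒᵖ)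
      (GradedCY.regularOp (GradedCY.envInt 𝒜)).carrier
    exact hφ.extIso C hCY.1
  · exact hφ.subsingleton_ext C hi
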